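/- Let $V$ be a vertex algebra over $\mathbb{C}$, with Li filtration $F^pV=\operatorname{span}\{a^1_{(-n_1-1)}\cdots a^r_{(-n_r-1)}b : a^i,b\in V,\ n_i\ge 0,\ n_1+\cdots+n_r\ge p\}$, and let $\operatorname{gr}V=\bigoplus_{p\ge0}F^pV/F^{p+1}V$ be the associated graded vertex Poisson algebra: writing $\sigma_p(a)$ for the class of $a\in F^pV$ in $F^pV/F^{p+1}V$, its product is $\sigma_p(a)\sigma_q(b)=\sigma_{p+q}(a_{(-1)}b)$, its derivation $T$ is induced by the translation operator, and its $n$-th products, $n\ge0$, are $\sigma_p(a)_{(n)}\sigma_q(b)=\sigma_{p+q-n}(a_{(n)}b)$ (zero if $n>p+q$). Let $R_V=V/C_2(V)=F^0V/F^1V$ be Zhu's $C_2$-algebra, a Poisson algebra under $\bar a\cdot\bar b=\overline{a_{(-1)}b}$ and $\{\bar a,\bar b\}=\overline{a_{(0)}b}$, let $X_V=\operatorname{Specm}R_V$ be the associated variety, a (reduced) Poisson variety with coordinate ring $\mathbb{C}[X_V]=R_V/\sqrt{0}$, and let $SS(V)=\operatorname{Specm}\operatorname{gr}V$ be the reduced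 singular support. For an ideal $I$ of $\operatorname{gr}V$, its chiral Poisson core $\mathscr{P}(I)$ is the biggest ideal contained in $I$ that is stable under all operators $a_{(n)}$, $a\in\operatorname{gr}V$, $n\ge0$. The chiral symplectic core of a point $x\in SS(V)$, with maximal ideal $\mathfrak{m}_x$, is $\{y\in SS(V) : \mathscr{P}(\mathfrak{m}_y)=\mathscr{P}(\mathfrak{m}_x)\}$. For a finitely generated $\mathbb{C}$-algebra $R$, let $J_\infty R$ denote the universal differential $\mathbb{C}$-algebra with a $\mathbb{C}$-algebra homomorphism from $R$; it is the coordinate ring of the arc space of $\operatorname{Spec}R$. **Theorem.** Assume that $\bigcap_pF^pV=0$, that $V$ is strongly finitely generated (i.e. $R_V$ is a finitely generated $\mathbb{C}$-algebra), and that $V$ is quasi-lisse, i.e. $X_V$ has only finitely many symplectic leaves. Then: 1. $SS(V)$ is a finite union of Zariski closures of chiral symplectic cores of points of $SS(V)$. 2. $SS(V)=J_\infty X_V$ as topological spaces. That is, the homomorphism of differential algebras $\varphi\colon J_\infty R_V\to\operatorname{gr}V$ induced by the identity of $R_V$ induces a homeomorphism $\mathfrak{m}\mapsto\varphi^{-1}(\mathfrak{m})$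 from $SS(V)$ onto the arc space $\operatorname{Specm}J_\infty R_V$ of $\operatorname{Spec}R_V$. Moreover, for the homomorphism $\pi\colon J_\infty R_V\to J_\infty(R_V/\sqrt{0})=\mathbb{C}[J_\infty X_V]$ induced by $R_V\to R_V/\sqrt{0}$, there is a homeomorphism $e\colon SS(V)\to J_\infty X_V=\operatorname{Specm}J_\infty(R_V/\sqrt{0})$ with $\pi^{-1}(e(\mathfrak{m}))=\varphi^{-1}(\mathfrak{m})$ for all $\mathfrak{m}\in SS(V)$. (All spaces carry the Zariski topology.) -/

import Mathlib

/-- A vertex algebra over `ℂ`: a vacuum vector, vertex operators `a(z) = ∑ a_(n) z^(-n-1)` depending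
linearly on `a`, and a translation operator, subject to the vacuum, translation and locality
axioms.  Mathlib's `VertexOperator ℂ V` is the space of linear maps `V → V((z))`, and
`VertexOperator.ncoeff A n` is the coefficient of `z^(-n-1)`. -/
class VertexAlgebra (V : Type*) [AddCommGroup V] [Module ℂ V] where
  /-- the vacuum vector -/
  vac : V
  /-- the state-field correspondence `a ↦ a(z)` -/
  Y : V →ₗ[ℂ] VertexOperator ℂ V
  /-- the translation operator -/
  T : V →ₗ[ℂ] V
  /-- `|0⟩(z) = id` -/
  vac_apply : ∀ (n : ℤ) (b : V), VertexOperator.ncoeff (Y vac) n b = if n = -1 then b else 0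
  /-- `a(z)|0⟩` has no pole at `z = 0` -/
  apply_vac : ∀ (a : V) (n : ℤ), 0 ≤ n → VertexOperator.ncoeff (Y a) n vac = 0
  /-- `a(z)|0⟩` has the value `a` at `z = 0` -/
  apply_vac_neg_one : ∀ a : V, VertexOperator.ncoeff (Y a) (-1) vac = a
  /-- `[T, a(z)] = ∂_z a(z)` -/
  translation : ∀ (a b : V) (n : ℤ),
    T (VertexOperator.ncoeff (Y a) n b) - VertexOperator.ncoeff (Y a) n (T b) =
      -n • VertexOperator.ncoeff (Y a) (n - 1) b
  T_vac : T vac = 0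
  /-- `(z - w)^N [a(z), b(w)] = 0` for some `N`, coefficient by coefficient -/
  locality : ∀ a b : V, ∃ N : ℕ, ∀ (m k : ℤ) (c : V),
    ∑ i ∈ Finset.range (N + 1), ((-1 : ℤ) ^ i * (N.choose i : ℤ)) •
      (VertexOperator.ncoeff (Y a) (m + N - i) (VertexOperator.ncoeff (Y b) (k + i) c) -
        VertexOperator.ncoeff (Y b) (k + i) (VertexOperator.ncoeff (Y a) (m + N - i) c)) = 0

namespace VertexAlgebra

/-! ### Facts on expansions of `(z - w)^n` that are needed for the Borcherds identity -/

section Expansion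

variable {W : Type*} [AddCommGroup W]

/-- The coefficients of the expansion of `(z - w)^n` in the domain `|z| > |w|`. -/
def expCoeff (n : ℤ) (j : ℕ) : ℤ := (-1) ^ j * Ring.choose n j

/-- The coefficients of `(z - w)^n f(z, w)`, expanded in the domain `|z| > |w|`. -/
noncomputable def expMul (n : ℤ) (f : ℤ → ℤ → W) (m k : ℤ) : W :=
  ∑ᶠ j : ℕ, expCoeff n j • f (m + n - j) (k + j)

theorem expCoeff_zero (n : ℤ) : expCoeff n 0 = 1 := by simp [expCoeff]

theorem expCoeff_succ_succ (n : ℤ) (j : ℕ) :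
    expCoeff (n + 1) (j + 1) = expCoeff n (j + 1) - expCoeff n j := by
  simp only [expCoeff, Ring.choose_succ_succ]
  ring

theorem choose_succ_mul (n : ℤ) (j : ℕ) :
    Ring.choose n (j + 1) * (j + 1) = Ring.choose n j * (n - j) := by
  have h1 := Ring.descPochhammer_eq_factorial_smul_choose n (j + 1)
  have h2 := Ring.descPochhammer_eq_factorial_smul_choose n j
  rw [descPochhammer_succ_right, Polynomial.smeval_mul, h2] at h1
  simp only [Polynomial.smeval_sub, Polynomial.smeval_X, Polynomial.smeval_natCast, pow_one,
    pow_zero, nsmul_eq_mul, Nat.factorial_succ, Nat.cast_mul, mul_one] at h1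
  have h3 : ((j.factorial : ℕ) : ℤ) ≠ 0 := by exact_mod_cast j.factorial_ne_zero
  apply mul_left_cancel₀ h3
  push_cast at h1
  linear_combination -h1

theorem expCoeff_mul (n : ℤ) (j : ℕ) :
    expCoeff n (j + 1) * (j + 1) = -(expCoeff n j * (n - j)) := by
  have := choose_succ_mul n j
  simp only [expCoeff, pow_succ]
  linear_combination -(-1) ^ j * this

theorem expMul_eq {n : ℤ} {f : ℤ → ℤ → W} {m k : ℤ} {J : ℕ}
    (h : ∀ m' k', k + J ≤ k' → f m' k' = 0) :
    expMul n f m k = ∑ j ∈ Finset.range J, expCoeff n j • f (m + n - j) (k + j) := by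
  apply finsum_eq_sum_of_support_subset
  intro j hj
  by_contra hJ
  apply hj
  simp only [Finset.coe_range, Set.mem_Iio, not_lt] at hJ
  simp only
  rw [h _ _ (by omega), smul_zero]

theorem expMul_rec {n : ℤ} {f : ℤ → ℤ → W} {K : ℤ} (h : ∀ m' k', K ≤ k' → f m' k' = 0)
    (m k : ℤ) : expMul n f (m + 1) k - expMul n f m (k + 1) = expMul (n + 1) f m k := by
  obtain ⟨J, hJ⟩ : ∃ J : ℕ, K ≤ k + J := ⟨(K - k).toNat, by omega⟩
  have e1 : ∀ m' k', k + (J + 1 : ℕ) ≤ k' → f m' k' = 0 := fun m' k' h' => h _ _ (by omega)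
  have e2 : ∀ m' k', (k + 1) + (J : ℕ) ≤ k' → f m' k' = 0 := fun m' k' h' => h _ _ (by omega)
  rw [expMul_eq e1, expMul_eq e2, expMul_eq e1, Finset.sum_range_succ', Finset.sum_range_succ' _ J]
  simp only [expCoeff_succ_succ, sub_smul, Finset.sum_sub_distrib, expCoeff_zero]
  have e3 : ∀ i : ℕ, f (m + 1 + n - (i + 1 : ℕ)) = f (m + (n + 1) - (i + 1 : ℕ)) := by
    intro i; congr 1; ring
  have e4 : ∀ i : ℕ, f (m + n - i) (k + 1 + i) = f (m + (n + 1) - (i + 1 : ℕ)) (k + (i + 1 : ℕ)) := by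
    intro i; congr 1 <;> push_cast <;> ring
  have e5 : f (m + 1 + n - (0 : ℕ)) = f (m + (n + 1) - (0 : ℕ)) := by congr 1; ring
  simp only [e3, e4, e5]
  abel

theorem expMul_natCast (n : ℕ) (f : ℤ → ℤ → W) (m k : ℤ) : expMul n f m k =
      ∑ j ∈ Finset.range (n + 1), ((-1 : ℤ) ^ j * (n.choose j : ℤ)) • f (m + n - j) (k + j) := by
  unfold expMul
  rw [finsum_eq_sum_of_support_subset (s := Finset.range (n + 1))]
  · simp only [expCoeff, Ring.choose_natCast]
  · intro j hj
    by_contra hJ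
    apply hj
    simp only [Finset.coe_range, Set.mem_Iio, not_lt] at hJ
    simp [expCoeff, Ring.choose_natCast, Nat.choose_eq_zero_of_lt (show n < j by omega)]

/-- A family with the recurrence of `(z - w)^n F(z, w)` that vanishes for large `n` is determined by
its residues in `z`. -/
theorem residue_formula {P : ℤ → ℤ → ℤ → W} {N : ℤ}
    (hrec : ∀ n m k, P n (m + 1) k - P n m (k + 1) = P (n + 1) m k)
    (hN : ∀ n, N ≤ n → ∀ m k, P n m k = 0) (n m k : ℤ) (J : ℕ) (hJ : N ≤ n + J) :
    P n m k = ∑ j ∈ Finset.range J, Ring.choose m j • P (n + j) 0 (m + k - j) := by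
  set G : ℤ → ℤ → ℤ → W := fun n m k =>
    P n m k - ∑ᶠ j : ℕ, Ring.choose m j • P (n + j) 0 (m + k - j) with hG
  have key : ∀ n m k (J : ℕ), N ≤ n + J →
      ∑ᶠ j : ℕ, Ring.choose m j • P (n + j) 0 (m + k - j) =
        ∑ j ∈ Finset.range J, Ring.choose m j • P (n + j) 0 (m + k - j) := by
    intro n m k J hJ
    apply finsum_eq_sum_of_support_subset
    intro j hj
    by_contra hJ'
    apply hj
    simp only [Finset.coe_range, Set.mem_Iio, not_lt] at hJ'
    simp only
    rw [hN _ (by omega), smul_zero]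
  have G0 : ∀ n k, G n 0 k = 0 := by
    intro n k
    obtain ⟨J, hJ⟩ : ∃ J : ℕ, N ≤ n + (J + 1 : ℕ) := ⟨(N - n).toNat, by omega⟩
    simp only [hG]
    rw [key _ _ _ _ hJ, Finset.sum_range_succ']
    simp [Ring.choose_zero_succ]
  have GN : ∀ n, N ≤ n → ∀ m k, G n m k = 0 := by
    intro n hn m k
    simp only [hG]
    rw [key n m k 0 (by simpa using hn), hN n hn]
    simp
  have Grec : ∀ n m k, G n (m + 1) k - G n m (k + 1) = G (n + 1) m k := by
    intro n m k
    obtain ⟨J, hJ⟩ : ∃ J : ℕ, N ≤ n + J := ⟨(N - n).toNat, by omega⟩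
    simp only [hG, ← hrec]
    rw [key n (m + 1) k (J + 1) (by push_cast; omega), key n m (k + 1) (J + 1) (by push_cast; omega),
      key (n + 1) m k J (by omega), Finset.sum_range_succ', Finset.sum_range_succ']
    simp only [Ring.choose_succ_succ, add_smul, Finset.sum_add_distrib, Ring.choose_zero_right]
    have e1 : ∀ j : ℕ, P (n + 1 + j) 0 (m + k - j) = P (n + (j + 1 : ℕ)) 0 (m + 1 + k - (j + 1 : ℕ)) := by
      intro j; congr 1 <;> push_cast <;> ring
    have e2 : ∀ j : ℕ, P (n + j) 0 (m + (k + 1) - j) = P (n + j) 0 (m + 1 + k - j) := by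
      intro j; congr 1; ring
    simp only [e1, e2]
    abel
  have main : ∀ (d : ℕ) (n : ℤ), N ≤ n + d → ∀ m k, G n m k = 0 := by
    intro d
    induction d with
    | zero => intro n hn; exact GN n (by simpa using hn)
    | succ d ih =>
      intro n hn m
      have ih' := ih (n + 1) (by push_cast at hn; omega)
      induction m using Int.induction_on with
      | zero => exact G0 n
      | succ i h =>
        intro k
        have := Grec n i k
        rw [ih', h, sub_zero] at this
        exact this
      | pred i h =>
        intro k
        have := Grec n (-i - 1) (k - 1)
        rw [ih', sub_add_cancel, sub_add_cancel, h, zero_sub, neg_eq_zero] at this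
        exact this
  have := main (N - n).toNat n (by omega) m k
  simp only [hG, sub_eq_zero] at this
  rw [this, key n m k J hJ]

variable (W) in
/-- Multiplication by `z - w`, on families of coefficients. -/
def dZW : Module.End ℤ (ℤ → ℤ → ℤ → W) where
  toFun h m k l := h (m + 1) k l - h m (k + 1) l
  map_add' _ _ := by ext; simp only [Pi.add_apply]; abel
  map_smul' _ _ := by ext; simp [smul_sub]

variable (W) in
/-- Multiplication by `z - u`, on families of coefficients. -/
def dZU : Module.End ℤ (ℤ → ℤ → ℤ → W) where
  toFun h m k l := h (m + 1) k l - h m k (l + 1)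
  map_add' _ _ := by ext; simp only [Pi.add_apply]; abel
  map_smul' _ _ := by ext; simp [smul_sub]

variable (W) in
/-- Multiplication by `w - u`, on families of coefficients. -/
def dWU : Module.End ℤ (ℤ → ℤ → ℤ → W) where
  toFun h m k l := h m (k + 1) l - h m k (l + 1)
  map_add' _ _ := by ext; simp only [Pi.add_apply]; abel
  map_smul' _ _ := by ext; simp [smul_sub]

theorem commute_dZU_dZW : Commute (dZU W) (dZW W) := by
  ext h m k l
  simp only [Module.End.mul_apply, dZU, dZW, LinearMap.coe_mk, AddHom.coe_mk]
  abel

theorem commute_dZU_dWU : Commute (dZU W) (dWU W) := by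
  ext h m k l
  simp only [Module.End.mul_apply, dZU, dWU, LinearMap.coe_mk, AddHom.coe_mk]
  abel

theorem commute_dZW_dWU : Commute (dZW W) (dWU W) := by
  ext h m k l
  simp only [Module.End.mul_apply, dZW, dWU, LinearMap.coe_mk, AddHom.coe_mk]
  abel

theorem dWU_eq : (dWU W) = dZU W + -dZW W := by
  ext h m k l
  simp only [LinearMap.add_apply, LinearMap.neg_apply, Pi.add_apply, Pi.neg_apply, dZU, dWU, dZW,
    LinearMap.coe_mk, AddHom.coe_mk]
  abel

/-- If `(z - u)^r (w - u)^s h = 0` and `(z - w)^p h = 0` then `(w - u)^(r + p + s) h = 0`. -/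
theorem dWU_pow_eq_zero {h : ℤ → ℤ → ℤ → W} {r s p : ℕ} (h1 : (dZU W ^ r) ((dWU W ^ s) h) = 0)
    (h2 : (dZW W ^ p) h = 0) : (dWU W ^ (r + p + s)) h = 0 := by
  have hcomm : Commute (dZU W) (-dZW W) := commute_dZU_dZW.neg_right
  have h2' : (dZW W ^ p) ((dWU W ^ s) h) = 0 := by
    rw [← Module.End.mul_apply, (commute_dZW_dWU.pow_pow p s).eq, Module.End.mul_apply, h2, map_zero]
  rw [pow_add, Module.End.mul_apply]
  set g := (dWU W ^ s) h
  rw [dWU_eq, hcomm.add_pow', LinearMap.sum_apply]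
  apply Finset.sum_eq_zero
  intro ij hij
  rw [Finset.HasAntidiagonal.mem_antidiagonal] at hij
  rw [LinearMap.smul_apply]
  convert smul_zero _
  rcases le_or_gt r ij.1 with hr | hr
  · rw [(hcomm.pow_pow _ _).eq, Module.End.mul_apply, ← Nat.sub_add_cancel hr, pow_add,
      Module.End.mul_apply, h1, map_zero, map_zero]
  · have h3 : (dZW W ^ ij.2) g = 0 := by
      rw [← Nat.sub_add_cancel (show p ≤ ij.2 by omega), pow_add, Module.End.mul_apply, h2', map_zero]
    rw [Module.End.mul_apply, neg_pow, Module.End.mul_apply, h3, map_zero, map_zero]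

theorem pow_apply_eq_sum (N : ℕ) (h : ℤ → ℤ → ℤ → W) (m k l : ℤ) :
    (dWU W ^ N) h m k l = ∑ i ∈ Finset.range (N + 1), ((-1 : ℤ) ^ i * (N.choose i : ℤ)) •
      h m (k + N - i) (l + i) := by
  induction N generalizing k l with
  | zero => simp
  | succ N ih =>
    rw [pow_succ', Module.End.mul_apply]
    change (dWU W ^ N) h m (k + 1) l - (dWU W ^ N) h m k (l + 1) = _
    rw [ih, ih, Finset.sum_range_succ', Finset.sum_range_succ' _ (N + 1), Finset.sum_range_succ _ N]
    have e1 : ∀ i : ℕ, h m (k + 1 + N - i) = h m (k + (N + 1 : ℕ) - i) := by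
      intro i; congr 1; push_cast; ring
    have e2 : ∀ i : ℕ, h m (k + N - i) (l + 1 + i) =
        h m (k + (N + 1 : ℕ) - (i + 1 : ℕ)) (l + (i + 1 : ℕ)) := by
      intro i; congr 1 <;> push_cast <;> ring
    simp only [e1, e2]
    have e3 : ∀ i : ℕ, ((-1 : ℤ) ^ (i + 1) * ((N + 1).choose (i + 1) : ℤ)) =
        (-1 : ℤ) ^ (i + 1) * (N.choose (i + 1) : ℤ) - (-1 : ℤ) ^ i * (N.choose i : ℤ) := by
      intro i; rw [Nat.choose_succ_succ]; push_cast; ring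
    simp only [e3, sub_smul, Finset.sum_sub_distrib]
    rw [Finset.sum_range_succ _ N, Finset.sum_range_succ _ N]
    simp
    abel

theorem expMul_zero (n m k : ℤ) : expMul n (fun _ _ => (0 : W)) m k = 0 := by simp [expMul]

theorem expMul_sub {n : ℤ} {f g : ℤ → ℤ → W} {K K' : ℤ} (hf : ∀ m' k', K ≤ k' → f m' k' = 0)
    (hg : ∀ m' k', K' ≤ k' → g m' k' = 0) (m k : ℤ) :
    expMul n (fun m k => f m k - g m k) m k = expMul n f m k - expMul n g m k := by
  obtain ⟨J, hJ⟩ : ∃ J : ℕ, K ≤ k + J ∧ K' ≤ k + J :=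
    ⟨(K - k).toNat + (K' - k).toNat, by omega, by omega⟩
  rw [expMul_eq (J := J) (fun m' k' h' => hf m' k' (by omega)),
    expMul_eq (J := J) (fun m' k' h' => hg m' k' (by omega)),
    expMul_eq (J := J) (fun m' k' h' => by rw [hf m' k' (by omega), hg m' k' (by omega), sub_zero])]
  simp only [smul_sub, Finset.sum_sub_distrib]

theorem map_expMul {W' : Type*} [AddCommGroup W'] (φ : W →+ W') {n : ℤ} {f : ℤ → ℤ → W} {K : ℤ}
    (hf : ∀ m' k', K ≤ k' → f m' k' = 0) (m k : ℤ) :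
    φ (expMul n f m k) = expMul n (fun m k => φ (f m k)) m k := by
  obtain ⟨J, hJ⟩ : ∃ J : ℕ, K ≤ k + J := ⟨(K - k).toNat, by omega⟩
  rw [expMul_eq (J := J) (fun m' k' h' => hf m' k' (by omega)),
    expMul_eq (J := J) (fun m' k' h' => by rw [hf m' k' (by omega), map_zero])]
  simp only [map_sum, map_zsmul]

/-- `expMul` with a parameter. -/
noncomputable def expMul₃ (n : ℤ) (F : ℤ → ℤ → ℤ → W) (m k l : ℤ) : W :=
  expMul n (fun m k => F m k l) m k

/-- `F(m, k, l)` vanishes for large `k`, locally uniformly in `l`. -/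
def TruncatedMid (F : ℤ → ℤ → ℤ → W) : Prop := ∀ l, ∃ K : ℤ, ∀ m k, K ≤ k → F m k l = 0

theorem expMul₃_dZU {n : ℤ} {F : ℤ → ℤ → ℤ → W} (hF : TruncatedMid F) :
    TruncatedMid (dZU W F) ∧ expMul₃ n (dZU W F) = dZU W (expMul₃ n F) := by
  constructor
  · intro l
    obtain ⟨K, hK⟩ := hF l
    obtain ⟨K', hK'⟩ := hF (l + 1)
    refine ⟨max K K', fun m k hk => ?_⟩
    change F (m + 1) k l - F m k (l + 1) = 0
    rw [hK _ _ (by omega), hK' _ _ (by omega), sub_zero]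
  · ext m k l
    obtain ⟨K, hK⟩ := hF l
    obtain ⟨K', hK'⟩ := hF (l + 1)
    change expMul n (fun m k => F (m + 1) k l - F m k (l + 1)) m k =
      expMul n (fun m k => F m k l) (m + 1) k - expMul n (fun m k => F m k (l + 1)) m k
    rw [expMul_sub (fun m' k' h' => hK (m' + 1) k' h') hK']
    congr 1
    simp only [expMul]
    congr 1
    ext j
    congr 2
    ring

theorem expMul₃_dWU {n : ℤ} {F : ℤ → ℤ → ℤ → W} (hF : TruncatedMid F) :
    TruncatedMid (dWU W F) ∧ expMul₃ n (dWU W F) = dWU W (expMul₃ n F) := by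
  constructor
  · intro l
    obtain ⟨K, hK⟩ := hF l
    obtain ⟨K', hK'⟩ := hF (l + 1)
    refine ⟨max K K', fun m k hk => ?_⟩
    change F m (k + 1) l - F m k (l + 1) = 0
    rw [hK _ _ (by omega), hK' _ _ (by omega), sub_zero]
  · ext m k l
    obtain ⟨K, hK⟩ := hF l
    obtain ⟨K', hK'⟩ := hF (l + 1)
    change expMul n (fun m k => F m (k + 1) l - F m k (l + 1)) m k =
      expMul n (fun m k => F m k l) m (k + 1) - expMul n (fun m k => F m k (l + 1)) m k
    rw [expMul_sub (K := K) (fun m' k' h' => hK m' (k' + 1) (by omega)) hK']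
    congr 1
    simp only [expMul]
    congr 1
    ext j
    congr 2
    ring

theorem expMul₃_pow {n : ℤ} {F : ℤ → ℤ → ℤ → W} (hF : TruncatedMid F) (r s : ℕ) :
    expMul₃ n ((dZU W ^ r) ((dWU W ^ s) F)) = (dZU W ^ r) ((dWU W ^ s) (expMul₃ n F)) := by
  have h1 : TruncatedMid ((dWU W ^ s) F) ∧
      expMul₃ n ((dWU W ^ s) F) = (dWU W ^ s) (expMul₃ n F) := by
    induction s with
    | zero => exact ⟨hF, rfl⟩
    | succ s ih =>
      simp only [pow_succ', Module.End.mul_apply]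
      rw [← ih.2]
      exact expMul₃_dWU ih.1
  rw [← h1.2]
  have h2 : TruncatedMid ((dZU W ^ r) ((dWU W ^ s) F)) ∧ expMul₃ n ((dZU W ^ r) ((dWU W ^ s) F)) =
      (dZU W ^ r) (expMul₃ n ((dWU W ^ s) F)) := by
    induction r with
    | zero => exact ⟨h1.1, rfl⟩
    | succ r ih =>
      simp only [pow_succ', Module.End.mul_apply]
      rw [← ih.2]
      exact expMul₃_dZU ih.1
  exact h2.2

/-- Exchange of the first two variables. -/
def swap₁₂ (F : ℤ → ℤ → ℤ → W) : ℤ → ℤ → ℤ → W := fun m k l => F k m l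

theorem dZU_pow_swap (r : ℕ) (F : ℤ → ℤ → ℤ → W) :
    (dZU W ^ r) (swap₁₂ F) = swap₁₂ ((dWU W ^ r) F) := by
  induction r with
  | zero => rfl
  | succ r ih => simp only [pow_succ', Module.End.mul_apply, ih]; rfl

theorem dWU_pow_swap (r : ℕ) (F : ℤ → ℤ → ℤ → W) :
    (dWU W ^ r) (swap₁₂ F) = swap₁₂ ((dZU W ^ r) F) := by
  induction r with
  | zero => rfl
  | succ r ih => simp only [pow_succ', Module.End.mul_apply, ih]; rfl

theorem dWU_pow_le {r s : ℕ} (h : r ≤ s) {F : ℤ → ℤ → ℤ → W} (hF : (dWU W ^ r) F = 0) :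
    (dWU W ^ s) F = 0 := by
  rw [← Nat.sub_add_cancel h, pow_add, Module.End.mul_apply, hF, map_zero]

theorem dWU_pow_const (N : ℕ) (h : ℤ → ℤ → ℤ → W) (m k l : ℤ) :
    (dWU W ^ N) (fun _ k l => h 0 k l) m k l = (dWU W ^ N) h 0 k l := by
  rw [pow_apply_eq_sum, pow_apply_eq_sum]

/-- Restriction of `(w - u)^N h` to the constant term in `u`. -/
theorem dWU_pow_neg_one (N : ℕ) {h : ℤ → ℤ → ℤ → W} (hh : ∀ m k l, 0 ≤ l → h m k l = 0)
    (m k : ℤ) : (dWU W ^ N) h m k (-1) = h m (k + N) (-1) := by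
  rw [pow_apply_eq_sum, Finset.sum_range_succ', Finset.sum_eq_zero]
  · simp
  · intro i _
    rw [hh _ _ _ (by push_cast; omega), smul_zero]

end Expansion

/-! ### The Borcherds identity -/

variable {V : Type*} [AddCommGroup V] [Module ℂ V] [VertexAlgebra V]

/-- The modes: `mode n a b = a_(n) b`. -/
noncomputable def mode (n : ℤ) : V →ₗ[ℂ] V →ₗ[ℂ] V :=
  LinearMap.proj n ∘ₗ VertexOperator.ncoeff ∘ₗ Y

theorem mode_apply (n : ℤ) (a b : V) : mode n a b = VertexOperator.ncoeff (Y a) n b := rfl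

theorem exists_mode_eq_zero (a b : V) : ∃ N : ℤ, ∀ n, N ≤ n → mode n a b = 0 :=
  ⟨-((HahnModule.of ℂ).symm (Y a b)).order, fun n hn =>
    VertexOperator.ncoeff_eq_zero_of_lt_order _ _ _ (by omega)⟩

theorem mode_vac_left (n : ℤ) (b : V) : mode n vac b = if n = -1 then b else 0 := vac_apply n b

theorem mode_vac (a : V) {n : ℤ} (hn : 0 ≤ n) : mode n a vac = 0 := apply_vac a n hn

theorem mode_neg_one_vac (a : V) : mode (-1) a vac = a := apply_vac_neg_one a

theorem T_mode (a b : V) (n : ℤ) :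
    T (mode n a b) = mode n a (T b) - n • mode (n - 1) a b := by
  have := translation a b n
  simp only [← mode_apply] at this
  rw [sub_eq_iff_eq_add] at this
  rw [this, neg_smul]
  abel

theorem exists_mode_mode_eq_zero (a b c : V) :
    ∃ K : ℤ, ∀ m k, K ≤ k → mode m a (mode k b c) = 0 := by
  obtain ⟨K, hK⟩ := exists_mode_eq_zero b c
  exact ⟨K, fun m k hk => by rw [hK k hk, map_zero]⟩

/-- The right-hand side of the Borcherds identity. -/
noncomputable def bor (a b c : V) (n m k : ℤ) : V :=
  expMul n (fun m k => mode m a (mode k b c)) m k -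
    (n.negOnePow : ℤ) • expMul n (fun k m => mode k b (mode m a c)) k m

theorem bor_rec (a b c : V) (n m k : ℤ) :
    bor a b c n (m + 1) k - bor a b c n m (k + 1) = bor a b c (n + 1) m k := by
  obtain ⟨K, hK⟩ := exists_mode_mode_eq_zero a b c
  obtain ⟨K', hK'⟩ := exists_mode_mode_eq_zero b a c
  have h1 := expMul_rec (n := n) hK m k
  have h2 := expMul_rec (n := n) hK' k m
  simp only [bor, ← h1, ← h2, Int.negOnePow_succ, Units.val_neg, neg_smul, smul_sub]
  abel

theorem bor_eq_zero (a b : V) : ∃ N : ℤ, ∀ c n, N ≤ n → ∀ m k, bor a b c n m k = 0 := by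
  obtain ⟨N, hN⟩ := locality a b
  refine ⟨N, fun c n hn => ?_⟩
  obtain ⟨d, rfl⟩ : ∃ d : ℕ, n = N + d := ⟨(n - N).toNat, by omega⟩
  clear hn
  induction d with
  | zero =>
    intro m k
    have h := hN m k c
    simp only [← mode_apply, smul_sub, Finset.sum_sub_distrib] at h
    simp only [bor, Nat.cast_zero, add_zero]
    rw [expMul_natCast, expMul_natCast, ← h]
    congr 1
    rw [Int.coe_negOnePow_natCast, Finset.smul_sum,
      ← Finset.sum_range_reflect _ (N + 1)]
    apply Finset.sum_congr rfl
    intro i hi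
    rw [Finset.mem_range] at hi
    have hi' : i ≤ N := by omega
    rw [show N + 1 - 1 - i = N - i by omega, smul_smul, Nat.choose_symm hi', Nat.cast_sub hi',
      show k + (N : ℤ) - (N - i) = k + i by ring, show m + ((N : ℤ) - i) = m + N - i by ring]
    congr 1
    obtain ⟨j, rfl⟩ := Nat.exists_eq_add_of_le hi'
    rw [Nat.add_sub_cancel_left, pow_add]
    have : ((-1 : ℤ) ^ j) * (-1) ^ j = 1 := by rw [← mul_pow]; simp
    linear_combination ((-1 : ℤ) ^ i * (i + j).choose i) * this
  | succ d ih =>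
    intro m k
    have := bor_rec a b c (N + d) m k
    rw [ih, ih, sub_zero] at this
    push_cast
    rw [← add_assoc, ← this]

theorem locality_dWU (a b : V) : ∃ N : ℕ, ∀ (φ : ℤ → V →ₗ[ℂ] V) (c : ℤ → V),
    (dWU V ^ N) (fun m k l => φ m (mode k a (mode l b (c m)) - mode l b (mode k a (c m)))) = 0 := by
  obtain ⟨N, hN⟩ := locality a b
  refine ⟨N, fun φ c => ?_⟩
  ext m k l
  have h := congrArg (φ m) (hN k l (c m))
  simp only [← mode_apply, map_zero, map_sum, map_zsmul] at h
  rw [pow_apply_eq_sum, h]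
  rfl

theorem triple_locality (a b d : V) : ∃ M₀ : ℕ, ∀ M, M₀ ≤ M → ∀ c : V,
    (dZU V ^ M) ((dWU V ^ M) (fun m k l =>
      mode m a (mode k b (mode l d c)) - mode l d (mode m a (mode k b c)))) = 0 := by
  obtain ⟨N, hN⟩ := locality_dWU b d
  obtain ⟨N', hN'⟩ := locality_dWU a d
  refine ⟨N + N', fun M hM c => ?_⟩
  have h1 := dWU_pow_le (show N ≤ M by omega) (hN (fun m => mode m a) (fun _ => c))
  have h2 := dWU_pow_le (show N' ≤ M by omega) (hN' (fun _ => LinearMap.id) (fun k => mode k b c))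
  have e : (fun m k l => mode m a (mode k b (mode l d c)) - mode l d (mode m a (mode k b c))) =
      (fun m k l => mode m a (mode k b (mode l d c) - mode l d (mode k b c))) +
      swap₁₂ (fun k m l => LinearMap.id (R := ℂ)
        (mode m a (mode l d (mode k b c)) - mode l d (mode m a (mode k b c)))) := by
    ext m k l
    simp only [swap₁₂, Pi.add_apply, map_sub, LinearMap.id_apply]
    abel
  rw [e, map_add, map_add, h1, map_zero, zero_add, ← Module.End.mul_apply,
    (commute_dZU_dWU.pow_pow M M).eq, Module.End.mul_apply, dZU_pow_swap, h2]
  exact map_zero _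

/-- Locality of the field with modes `bor a b c n 0 k` (Dong's lemma). -/
theorem bor_local (a b d : V) (n : ℤ) : ∃ M : ℕ, ∀ c : V,
    (dWU V ^ M) (fun m k l => bor a b (mode l d c) n m k - mode l d (bor a b c n m k)) = 0 := by
  obtain ⟨M₁, h1⟩ := triple_locality a b d
  obtain ⟨M₂, h2⟩ := triple_locality b a d
  obtain ⟨N, hN⟩ := bor_eq_zero a b
  set M := M₁ + M₂
  refine ⟨M + (N - n).toNat + M, fun c => ?_⟩
  set S : ℤ → ℤ → ℤ → ℤ → V :=
    fun n m k l => bor a b (mode l d c) n m k - mode l d (bor a b c n m k) with hS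
  have Srec : ∀ n, dZW V (S n) = S (n + 1) := by
    intro n
    ext m k l
    change S n (m + 1) k l - S n m (k + 1) l = _
    simp only [hS, ← bor_rec, map_sub]
    abel
  have Spow : ∀ (p : ℕ), (dZW V ^ p) (S n) = S (n + p) := by
    intro p
    induction p with
    | zero => simp
    | succ p ih => rw [pow_succ', Module.End.mul_apply, ih, Srec]; push_cast; rw [add_assoc]
  have SN : (dZW V ^ (N - n).toNat) (S n) = 0 := by
    rw [Spow]
    ext m k l
    simp only [hS]
    rw [hN _ _ (by omega), hN _ _ (by omega), map_zero, sub_zero]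
    rfl
  refine dWU_pow_eq_zero (h := S n) (r := M) (s := M) ?_ SN
  have trunc : ∀ a b : V, TruncatedMid (fun m k l =>
      mode m a (mode k b (mode l d c)) - mode l d (mode m a (mode k b c))) := by
    intro a b l
    obtain ⟨K, hK⟩ := exists_mode_mode_eq_zero a b c
    obtain ⟨K', hK'⟩ := exists_mode_mode_eq_zero a b (mode l d c)
    exact ⟨max K K', fun m k hk => by
      simp only
      rw [hK _ _ (by omega), hK' _ _ (by omega), map_zero, sub_zero]⟩
  have split : S n = expMul₃ n (fun m k l =>
        mode m a (mode k b (mode l d c)) - mode l d (mode m a (mode k b c))) -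
      (n.negOnePow : ℤ) • swap₁₂ (expMul₃ n (fun m k l =>
        mode m b (mode k a (mode l d c)) - mode l d (mode m b (mode k a c)))) := by
    ext m k l
    obtain ⟨K₁, hK₁⟩ := exists_mode_mode_eq_zero a b c
    obtain ⟨K₂, hK₂⟩ := exists_mode_mode_eq_zero a b (mode l d c)
    obtain ⟨K₃, hK₃⟩ := exists_mode_mode_eq_zero b a c
    obtain ⟨K₄, hK₄⟩ := exists_mode_mode_eq_zero b a (mode l d c)
    have e1 := map_expMul (mode l d).toAddMonoidHom (n := n) hK₁ m k
    have e2 := map_expMul (mode l d).toAddMonoidHom (n := n) hK₃ k m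
    simp only [LinearMap.toAddMonoidHom_coe] at e1 e2
    simp only [hS, bor, map_sub, map_zsmul, e1, e2, Pi.sub_apply, Pi.smul_apply, swap₁₂, expMul₃]
    rw [expMul_sub hK₂ (K' := K₁) (fun m' k' h' => by rw [hK₁ _ _ h', map_zero]),
      expMul_sub hK₄ (K' := K₃) (fun m' k' h' => by rw [hK₃ _ _ h', map_zero]), smul_sub]
    abel
  have z : expMul₃ n (0 : ℤ → ℤ → ℤ → V) = 0 := by
    ext m k l
    exact expMul_zero n m k
  rw [split, map_sub, map_sub, map_zsmul, map_zsmul, ← expMul₃_pow (trunc a b), h1 M (by omega), z,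
    dWU_pow_swap, dZU_pow_swap, ← Module.End.mul_apply (dWU V ^ M), ← (commute_dZU_dWU.pow_pow M M).eq,
    Module.End.mul_apply, ← expMul₃_pow (trunc b a), h2 M (by omega), z]
  ext m k l
  simp [swap₁₂]

theorem bor_vac (a b : V) (n k : ℤ) : bor a b vac n 0 k = mode k (mode n a b) vac := by
  have second : ∀ k, expMul n (fun k m => mode k b (mode m a vac)) k 0 = 0 := by
    intro k
    rw [expMul_eq (J := 0), Finset.range_zero, Finset.sum_empty]
    intro m' k' h
    rw [mode_vac a (by simpa using h), map_zero]
  have hz : ∀ m' k', (0 : ℤ) ≤ k' → mode m' a (mode k' b vac) = 0 := by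
    intro m' k' h
    rw [mode_vac b h, map_zero]
  have bv : ∀ k, bor a b vac n 0 k = expMul n (fun m k => mode m a (mode k b vac)) 0 k := by
    intro k
    rw [bor, second, smul_zero, sub_zero]
  have hT : ∀ k, T (bor a b vac n 0 k) = -k • bor a b vac n 0 (k - 1) := by
    intro k
    obtain ⟨J, hJ⟩ : ∃ J : ℕ, 1 ≤ k + J := ⟨(1 - k).toNat, by omega⟩
    rw [bv, bv, expMul_eq (J := J) (fun m' k' h => hz m' k' (by omega)),
      expMul_eq (J := J) (fun m' k' h => hz m' k' (by omega))]
    rw [← sub_eq_zero, map_sum, Finset.smul_sum, ← Finset.sum_sub_distrib]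
    have tele : ∀ J : ℕ, ∑ j ∈ Finset.range J, (T (expCoeff n j • mode (0 + n - j) a
        (mode (k + j) b vac)) - -k • expCoeff n j • mode (0 + n - j) a (mode (k - 1 + j) b vac)) =
        (expCoeff n J * J) • mode (0 + n - J) a (mode (k - 1 + J) b vac) := by
      intro J
      induction J with
      | zero => simp
      | succ J ih =>
        rw [Finset.sum_range_succ, ih, map_zsmul, T_mode, T_mode, T_vac, map_zero]
        rw [show k + (J : ℤ) - 1 = k - 1 + J by ring,
          show (0 : ℤ) + n - (J + 1 : ℕ) = 0 + n - J - 1 by push_cast; ring,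
          show k - 1 + ((J + 1 : ℕ) : ℤ) = k + J by push_cast; ring]
        have := expCoeff_mul n J
        push_cast
        rw [this, zero_sub, map_neg, map_zsmul]
        module
    rw [tele, hz _ _ (by omega), smul_zero]
  have hneg : ∀ i : ℕ, bor a b vac n 0 (-1 - i) = mode (-1 - i) (mode n a b) vac := by
    intro i
    induction i with
    | zero =>
      rw [bv, expMul_eq (J := 1) (fun m' k' h => hz m' k' (by push_cast at h; omega))]
      simp [expCoeff_zero, mode_neg_one_vac]
    | succ i ih =>
      have e1 := hT (-1 - i)
      rw [ih, T_mode, T_vac, map_zero, zero_sub, neg_smul, neg_inj] at e1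
      have e2 : ((-1 - i : ℤ) : ℂ) ≠ 0 := by
        have : (-1 - (i : ℤ)) ≠ 0 := by omega
        exact_mod_cast this
      rw [← Int.cast_smul_eq_zsmul ℂ, ← Int.cast_smul_eq_zsmul ℂ] at e1
      have e3 := smul_right_injective V e2 e1
      rw [show (-1 - ((i + 1 : ℕ) : ℤ)) = -1 - i - 1 by push_cast; ring]
      exact e3.symm
  rcases le_or_gt 0 k with hk | hk
  · rw [bv, mode_vac _ hk, expMul_eq (J := 0) (fun m' k' h => hz m' k' (by simp at h; omega))]
    simp
  · obtain ⟨i, rfl⟩ : ∃ i : ℕ, k = -1 - i := ⟨(-1 - k).toNat, by omega⟩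
    exact hneg i

/-- The iterate formula. -/
theorem bor_zero_left (a b d : V) (n k : ℤ) : bor a b d n 0 k = mode k (mode n a b) d := by
  obtain ⟨M, hM⟩ := bor_local a b d n
  obtain ⟨N, hN⟩ := locality_dWU (mode n a b) d
  have h1 := dWU_pow_le (show M ≤ M + N by omega) (hM vac)
  have h2 := dWU_pow_le (show N ≤ M + N by omega) (hN (fun _ => LinearMap.id) (fun _ => vac))
  set S₁ : ℤ → ℤ → ℤ → V := fun m k l =>
    bor a b (mode l d vac) n m k - mode l d (bor a b vac n m k) with hS₁
  set S₂ : ℤ → ℤ → ℤ → V := fun m k l => LinearMap.id (R := ℂ)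
    (mode k (mode n a b) (mode l d vac) - mode l d (mode k (mode n a b) vac)) with hS₂
  set h : ℤ → ℤ → ℤ → V := fun _ k l =>
    bor a b (mode l d vac) n 0 k - mode k (mode n a b) (mode l d vac) with hh
  have e1 : (dWU V ^ (M + N)) h 0 (k - (M + N : ℕ)) (-1) = 0 := by
    have e : h = fun _ k l => (S₁ - S₂) 0 k l := by
      ext m k l
      change _ = S₁ 0 k l - S₂ 0 k l
      simp only [hh, hS₁, hS₂, LinearMap.id_apply, bor_vac]
      abel
    rw [e, dWU_pow_const, map_sub, h1, h2, sub_zero]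
    rfl
  rw [dWU_pow_neg_one] at e1
  · simpa only [hh, sub_add_cancel, mode_neg_one_vac, sub_eq_zero] using e1
  · intro m k l hl
    simp [hh, mode_vac d hl, bor, expMul_zero]

/-- The Borcherds identity. -/
theorem borcherds (a b : V) : ∃ N : ℤ, ∀ (c : V) (n m k : ℤ) (J : ℕ), N ≤ n + J →
    bor a b c n m k =
      ∑ j ∈ Finset.range J, Ring.choose m j • mode (m + k - j) (mode (n + j) a b) c := by
  obtain ⟨N, hN⟩ := bor_eq_zero a b
  refine ⟨N, fun c n m k J hJ => ?_⟩
  rw [residue_formula (bor_rec a b c) (hN c) n m k J hJ]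
  simp only [bor_zero_left]

/-- The commutator formula. -/
theorem commutator_formula (a b : V) : ∃ J₀ : ℕ, ∀ (c : V) (m k : ℤ) (J : ℕ), J₀ ≤ J →
    mode m a (mode k b c) - mode k b (mode m a c) =
      ∑ j ∈ Finset.range J, Ring.choose m j • mode (m + k - j) (mode j a b) c := by
  obtain ⟨N, hN⟩ := borcherds a b
  refine ⟨N.toNat, fun c m k J hJ => ?_⟩
  have := hN c 0 m k J (by omega)
  simp only [zero_add] at this
  rw [← this, bor, ← Nat.cast_zero, expMul_natCast, expMul_natCast]
  simp

/-- The iterate formula, with its sums written out. -/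
theorem iterate_formula (a b c : V) (n k : ℤ) : ∃ J₀ : ℕ, ∀ J, J₀ ≤ J →
    mode k (mode n a b) c =
      ∑ j ∈ Finset.range J, expCoeff n j • mode (n - j) a (mode (k + j) b c) -
        (n.negOnePow : ℤ) • ∑ j ∈ Finset.range J, expCoeff n j • mode (k + n - j) b (mode j a c) := by
  obtain ⟨K, hK⟩ := exists_mode_mode_eq_zero a b c
  obtain ⟨K', hK'⟩ := exists_mode_mode_eq_zero b a c
  refine ⟨(K - k).toNat + K'.toNat, fun J hJ => ?_⟩
  rw [← bor_zero_left, bor, expMul_eq (J := J) (fun m' k' h => hK _ _ (by omega)),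
    expMul_eq (J := J) (fun m' k' h => hK' _ _ (by omega))]
  simp only [zero_add]

theorem T_eq (a : V) : T a = mode (-2) a vac := by
  have := T_mode a vac (-1)
  rw [mode_neg_one_vac, T_vac, map_zero] at this
  rw [this]
  simp

/-- `(T a)_(-1) b = a_(-2) b`. -/
theorem mode_neg_one_T (a b : V) : mode (-1) (T a) b = mode (-2) a b := by
  obtain ⟨J₀, hJ⟩ := iterate_formula a vac b (-2) (-1)
  rw [T_eq, hJ (J₀ + 1) (by omega), Finset.sum_range_succ', Finset.sum_eq_zero, Finset.sum_eq_zero]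
  · simp [mode_vac_left, expCoeff_zero]
  · intro j _
    rw [mode_vac_left, if_neg (by omega), smul_zero]
  · intro j _
    rw [mode_vac_left, if_neg (by push_cast; omega), map_zero, smul_zero]

/-! ### The Li filtration and its associated graded algebra -/

variable (V) in
/-- The Li filtration: `F^p V` is spanned by the vectors
`a¹_(-n₁-1) ⋯ aʳ_(-nᵣ-1) b` with `n₁ + ⋯ + nᵣ ≥ p`; the list holds the pairs `(aⁱ, nᵢ)`. -/
noncomputable def liF (p : ℕ) : Submodule ℂ V :=
  Submodule.span ℂ {v | ∃ (L : List (V × ℕ)) (b : V), p ≤ (L.map Prod.snd).sum ∧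
    v = L.foldr (fun x w => mode (-(x.2 : ℤ) - 1) x.1 w) b}

theorem liF_zero : liF V 0 = ⊤ := by
  rw [eq_top_iff]
  intro v _
  exact Submodule.subset_span ⟨[], v, by simp, rfl⟩

theorem liF_anti {p q : ℕ} (h : p ≤ q) : liF V q ≤ liF V p := by
  apply Submodule.span_mono
  rintro v ⟨L, b, hL, rfl⟩
  exact ⟨L, b, h.trans hL, rfl⟩

theorem mem_liF_of_eq_zero {p : ℕ} (h : p = 0) (v : V) : v ∈ liF V p := by
  rw [h, liF_zero]; trivial

theorem mode_neg_mem (a : V) (n : ℕ) {q k : ℕ} (hk : k ≤ q + n) {b : V} (hb : b ∈ liF V q) :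
    mode (-(n : ℤ) - 1) a b ∈ liF V k := by
  induction hb using Submodule.span_induction with
  | mem x hx =>
    obtain ⟨L, c, hL, rfl⟩ := hx
    exact Submodule.subset_span ⟨(a, n) :: L, c, by simp; omega, rfl⟩
  | zero => rw [map_zero]; exact zero_mem _
  | add x y _ _ hx hy => rw [map_add]; exact add_mem hx hy
  | smul r x _ hx => rw [map_smul]; exact Submodule.smul_mem _ _ hx

/-- The range of `k` for which `(F^p)_(n) F^q ⊆ F^k`. -/
def LiBound (p q : ℕ) (n : ℤ) (k : ℕ) : Prop :=
  (k : ℤ) + n + 1 ≤ p + q ∨ (0 ≤ n ∧ (k : ℤ) + n ≤ p + q)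

theorem mode_mem_aux (L : List (V × ℕ)) (b : V) : ∀ (a : V) (n : ℤ) (k : ℕ),
    LiBound 0 (L.map Prod.snd).sum n k →
      mode n a (L.foldr (fun x w => mode (-(x.2 : ℤ) - 1) x.1 w) b) ∈ liF V k := by
  induction L with
  | nil =>
    intro a n k h
    simp only [LiBound, List.map_nil, List.sum_nil, Nat.cast_zero, add_zero, List.foldr_nil] at h ⊢
    rcases le_or_gt 0 n with hn | hn
    · exact mem_liF_of_eq_zero (by omega) _
    · obtain ⟨s, rfl⟩ : ∃ s : ℕ, n = -(s : ℤ) - 1 := ⟨(-n - 1).toNat, by omega⟩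
      exact mode_neg_mem (q := 0) a s (by omega) (mem_liF_of_eq_zero rfl b)
  | cons x L ih =>
    obtain ⟨u, m⟩ := x
    intro a n k h
    simp only [LiBound, List.map_cons, List.sum_cons, List.foldr_cons, Nat.cast_zero,
      zero_add] at h ih ⊢
    set w := L.foldr (fun x w => mode (-(x.2 : ℤ) - 1) x.1 w) b with hw
    have hwm : w ∈ liF V (L.map Prod.snd).sum := Submodule.subset_span ⟨L, b, le_rfl, rfl⟩
    rcases le_or_gt 0 n with hn | hn
    · obtain ⟨J, hJ⟩ := commutator_formula a u
      have e := hJ w n (-(m : ℤ) - 1) J le_rfl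
      rw [sub_eq_iff_eq_add] at e
      rw [e]
      apply add_mem
      · apply Submodule.sum_mem
        intro j _
        apply zsmul_mem
        apply ih
        left
        simp only [Nat.cast_add] at h ⊢
        omega
      · apply mode_neg_mem u m (q := k - m) (by omega)
        by_cases hk : k - m = 0
        · exact mem_liF_of_eq_zero hk _
        · apply ih
          right
          simp only [Nat.cast_add] at h ⊢
          omega
    · obtain ⟨s, rfl⟩ : ∃ s : ℕ, n = -(s : ℤ) - 1 := ⟨(-n - 1).toNat, by omega⟩
      refine mode_neg_mem a s (q := (L.map Prod.snd).sum + m) ?_ (mode_neg_mem u m le_rfl hwm)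
      simp only [Nat.cast_add] at h
      omega

theorem mode_mem_aux' (a : V) {n : ℤ} {q k : ℕ} (h : LiBound 0 q n k) {b : V} (hb : b ∈ liF V q) :
    mode n a b ∈ liF V k := by
  induction hb using Submodule.span_induction with
  | mem x hx =>
    obtain ⟨L, c, hL, rfl⟩ := hx
    apply mode_mem_aux
    simp only [LiBound] at h ⊢
    omega
  | zero => rw [map_zero]; exact zero_mem _
  | add x y _ _ hx hy => rw [map_add]; exact add_mem hx hy
  | smul r x _ hx => rw [map_smul]; exact Submodule.smul_mem _ _ hx

theorem mode_mem_aux₂ (L : List (V × ℕ)) (c : V) {q : ℕ} {b : V} (hb : b ∈ liF V q) :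
    ∀ (n : ℤ) (k : ℕ), LiBound (L.map Prod.snd).sum q n k →
      mode n (L.foldr (fun x w => mode (-(x.2 : ℤ) - 1) x.1 w) c) b ∈ liF V k := by
  induction L generalizing b q with
  | nil =>
    intro n k h
    exact mode_mem_aux' c (by simpa using h) hb
  | cons x L ih =>
    obtain ⟨u, m⟩ := x
    intro n k h
    simp only [List.map_cons, List.sum_cons, List.foldr_cons] at h ⊢
    set w := L.foldr (fun x w => mode (-(x.2 : ℤ) - 1) x.1 w) c with hw
    obtain ⟨J, hJ⟩ := iterate_formula u w b (-(m : ℤ) - 1) n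
    rw [hJ J le_rfl]
    apply sub_mem
    · apply Submodule.sum_mem
      intro j _
      apply zsmul_mem
      rw [show -(m : ℤ) - 1 - j = -((m + j : ℕ) : ℤ) - 1 by push_cast; ring]
      apply mode_neg_mem u (m + j) (q := k - (m + j)) (by omega)
      by_cases hk : k - (m + j) = 0
      · exact mem_liF_of_eq_zero hk _
      · apply ih hb
        simp only [LiBound] at h ⊢
        simp only [Nat.cast_add] at h
        omega
    · apply zsmul_mem
      apply Submodule.sum_mem
      intro j _
      apply zsmul_mem
      have hu : mode j u b ∈ liF V (q - j) := by
        by_cases hk : q - j = 0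
        · exact mem_liF_of_eq_zero hk _
        · apply mode_mem_aux' u _ hb
          simp only [LiBound]
          omega
      apply ih hu
      simp only [LiBound] at h ⊢
      simp only [Nat.cast_add] at h
      omega

/-- Compatibility of the Li filtration with the `n`-th products. -/
theorem mode_mem {n : ℤ} {p q k : ℕ} (h : LiBound p q n k) {a b : V} (ha : a ∈ liF V p)
    (hb : b ∈ liF V q) : mode n a b ∈ liF V k := by
  induction ha using Submodule.span_induction with
  | mem x hx =>
    obtain ⟨L, c, hL, rfl⟩ := hx
    apply mode_mem_aux₂ L c hb
    simp only [LiBound] at h ⊢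
    omega
  | zero => rw [map_zero]; exact zero_mem _
  | add x y _ _ hx hy => rw [map_add]; exact add_mem hx hy
  | smul r x _ hx => rw [map_smul]; exact Submodule.smul_mem _ _ hx

theorem T_mem {p : ℕ} {a : V} (ha : a ∈ liF V p) : T a ∈ liF V (p + 1) := by
  rw [T_eq]
  exact mode_mem (p := p) (q := 0) (by simp only [LiBound]; omega) ha (mem_liF_of_eq_zero rfl _)

theorem mul_comm_mem {p q : ℕ} {a b : V} (ha : a ∈ liF V p) (hb : b ∈ liF V q) :
    mode (-1) a b - mode (-1) b a ∈ liF V (p + q + 1) := by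
  obtain ⟨J, hJ⟩ := commutator_formula a b
  have e := hJ vac (-1) (-1) J le_rfl
  rw [mode_neg_one_vac, mode_neg_one_vac] at e
  rw [e]
  apply Submodule.sum_mem
  intro j _
  apply zsmul_mem
  have hab : mode j a b ∈ liF V (p + q - j) := by
    by_cases hk : p + q - j = 0
    · exact mem_liF_of_eq_zero hk _
    · exact mode_mem (by simp only [LiBound]; omega) ha hb
  exact mode_mem (p := p + q - j) (q := 0) (by simp only [LiBound]; omega) hab
    (mem_liF_of_eq_zero rfl _)

theorem mul_assoc_mem {p q r : ℕ} {a b c : V} (ha : a ∈ liF V p) (hb : b ∈ liF V q)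
    (hc : c ∈ liF V r) :
    mode (-1) (mode (-1) a b) c - mode (-1) a (mode (-1) b c) ∈ liF V (p + q + r + 1) := by
  obtain ⟨J, hJ⟩ := iterate_formula a b c (-1) (-1)
  rw [hJ (J + 1) (by omega), Finset.sum_range_succ']
  simp only [expCoeff_zero, Nat.cast_zero, sub_zero, add_zero, one_smul]
  rw [add_sub_right_comm, add_sub_cancel_right]
  apply sub_mem
  · apply Submodule.sum_mem
    intro j _
    apply zsmul_mem
    have hbc : mode (-1 + ((j + 1 : ℕ) : ℤ)) b c ∈ liF V (q + r - j) := by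
      by_cases hk : q + r - j = 0
      · exact mem_liF_of_eq_zero hk _
      · exact mode_mem (by simp only [LiBound]; omega) hb hc
    exact mode_mem (by simp only [LiBound]; omega) ha hbc
  · apply zsmul_mem
    apply Submodule.sum_mem
    intro j _
    apply zsmul_mem
    have hac : mode j a c ∈ liF V (p + r - j) := by
      by_cases hk : p + r - j = 0
      · exact mem_liF_of_eq_zero hk _
      · exact mode_mem (by simp only [LiBound]; omega) ha hc
    exact mode_mem (by simp only [LiBound]; omega) hb hac

variable (V) in
/-- The component `F^p V / F^(p+1) V` of the associated graded space. -/
def GrPiece (p : ℕ) : Type _ := ↥(liF V p) ⧸ (liF V (p + 1)).submoduleOf (liF V p)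

noncomputable instance (p : ℕ) : AddCommGroup (GrPiece V p) :=
  inferInstanceAs (AddCommGroup (↥(liF V p) ⧸ (liF V (p + 1)).submoduleOf (liF V p)))

noncomputable instance (p : ℕ) : Module ℂ (GrPiece V p) :=
  inferInstanceAs (Module ℂ (↥(liF V p) ⧸ (liF V (p + 1)).submoduleOf (liF V p)))

/-- The symbol map `F^p V → F^p V / F^(p+1) V`. -/
noncomputable def symb (p : ℕ) : ↥(liF V p) →ₗ[ℂ] GrPiece V p :=
  Submodule.mkQ ((liF V (p + 1)).submoduleOf (liF V p))

theorem symb_eq {p : ℕ} {a b : ↥(liF V p)} (h : (a : V) - b ∈ liF V (p + 1)) :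
    symb p a = symb p b :=
  (Submodule.Quotient.eq _).2 h

theorem symb_eq_zero {p : ℕ} {a : ↥(liF V p)} (h : (a : V) ∈ liF V (p + 1)) : symb p a = 0 :=
  (Submodule.Quotient.mk_eq_zero _).2 h

theorem symb_surjective (p : ℕ) (x : GrPiece V p) : ∃ a, symb p a = x :=
  Submodule.mkQ_surjective _ x

/-- Linear maps out of `F^p V / F^(p+1) V`. -/
noncomputable def grLift {p : ℕ} {M : Type*} [AddCommGroup M] [Module ℂ M] (f : ↥(liF V p) →ₗ[ℂ] M)
    (hf : ∀ a : ↥(liF V p), (a : V) ∈ liF V (p + 1) → f a = 0) : GrPiece V p →ₗ[ℂ] M :=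
  Submodule.liftQ ((liF V (p + 1)).submoduleOf (liF V p)) f fun a ha => hf a ha

/-- The operation on symbols induced by the `n`-th product: `(σ a, σ b) ↦ σ (a_(n) b)`, where the
symbols are taken in the degrees `p`, `q` and `k`. -/
noncomputable def grOp (n : ℤ) (p q k : ℕ) (h : LiBound p q n k) :
    GrPiece V p →ₗ[ℂ] GrPiece V q →ₗ[ℂ] GrPiece V k :=
  let base : ↥(liF V p) →ₗ[ℂ] ↥(liF V q) →ₗ[ℂ] GrPiece V k :=
    LinearMap.mk₂ ℂ (fun a b => symb k ⟨mode n (a : V) (b : V), mode_mem h a.2 b.2⟩)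
      (fun a a' b => by rw [← map_add]; congr 1; ext; simp)
      (fun c a b => by rw [← map_smul]; congr 1; ext; simp)
      (fun a b b' => by rw [← map_add]; congr 1; ext; simp)
      (fun c a b => by rw [← map_smul]; congr 1; ext; simp)
  grLift (grLift base.flip fun b hb => by
      ext a
      exact symb_eq_zero (mode_mem (p := p) (q := q + 1)
        (by simp only [LiBound] at h ⊢; omega) a.2 hb)).flip fun a ha => by
    ext y
    obtain ⟨b, rfl⟩ := symb_surjective q y
    exact symb_eq_zero (mode_mem (p := p + 1) (q := q)
        (by simp only [LiBound] at h ⊢; omega) ha b.2)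

theorem grOp_symb (n : ℤ) (p q k : ℕ) (h : LiBound p q n k) (a : ↥(liF V p)) (b : ↥(liF V q)) :
    grOp n p q k h (symb p a) (symb q b) =
      symb k ⟨mode n (a : V) (b : V), mode_mem h a.2 b.2⟩ := rfl

theorem gradedMk_eq {i j : ℕ} (hij : i = j) {a : ↥(liF V i)} {b : ↥(liF V j)}
    (h : (a : V) - b ∈ liF V (i + 1)) :
    GradedMonoid.mk (A := GrPiece V) i (symb i a) = GradedMonoid.mk j (symb j b) := by
  subst hij
  rw [symb_eq h]

theorem liBound_mul (p q : ℕ) : LiBound p q (-1) (p + q) := by simp only [LiBound]; omega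

noncomputable instance : GradedMonoid.GMul (GrPiece V) where
  mul {p q} x y := grOp (-1) p q (p + q) (liBound_mul p q) x y

noncomputable instance : GradedMonoid.GOne (GrPiece V) where
  one := symb 0 ⟨vac, mem_liF_of_eq_zero rfl _⟩

noncomputable instance : GradedMonoid.GMonoid (GrPiece V) where
  one_mul := by
    rintro ⟨p, x⟩
    obtain ⟨a, rfl⟩ := symb_surjective p x
    refine gradedMk_eq (zero_add p) ?_
    simp [mode_vac_left]
  mul_one := by
    rintro ⟨p, x⟩
    obtain ⟨a, rfl⟩ := symb_surjective p x
    refine gradedMk_eq (add_zero p) ?_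
    simp [mode_neg_one_vac]
  mul_assoc := by
    rintro ⟨p, x⟩ ⟨q, y⟩ ⟨r, z⟩
    obtain ⟨a, rfl⟩ := symb_surjective p x
    obtain ⟨b, rfl⟩ := symb_surjective q y
    obtain ⟨c, rfl⟩ := symb_surjective r z
    exact gradedMk_eq (add_assoc p q r) (mul_assoc_mem a.2 b.2 c.2)

/-- The associated graded space is a commutative ring under `σ a · σ b = σ (a_(-1) b)`, with unit
the symbol of the vacuum. -/
noncomputable instance : DirectSum.GCommRing (GrPiece V) where
  mul_zero x := map_zero _
  zero_mul y := by change grOp _ _ _ _ _ 0 y = 0; rw [map_zero]; rfl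
  mul_add x y z := map_add _ _ _
  add_mul x y z := by change grOp _ _ _ _ _ (x + y) z = _; rw [map_add]; rfl
  mul_comm := by
    rintro ⟨p, x⟩ ⟨q, y⟩
    obtain ⟨a, rfl⟩ := symb_surjective p x
    obtain ⟨b, rfl⟩ := symb_surjective q y
    exact gradedMk_eq (add_comm p q) (mul_comm_mem a.2 b.2)
  natCast n := n • symb 0 ⟨vac, mem_liF_of_eq_zero rfl _⟩
  natCast_zero := zero_smul _ _
  natCast_succ n := succ_nsmul _ _
  intCast n := n • symb 0 ⟨vac, mem_liF_of_eq_zero rfl _⟩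
  intCast_ofNat n := natCast_zsmul _ _
  intCast_negSucc_ofNat n := by rw [Int.negSucc_eq, neg_smul]; norm_cast

noncomputable instance : DirectSum.GAlgebra ℂ (GrPiece V) where
  toFun := (LinearMap.toSpanSingleton ℂ (GrPiece V 0)
    (symb 0 ⟨vac, mem_liF_of_eq_zero rfl _⟩)).toAddMonoidHom
  map_one := one_smul ℂ (symb 0 ⟨vac, mem_liF_of_eq_zero rfl _⟩ : GrPiece V 0)
  map_mul r s := by
    refine gradedMk_eq (i := 0) (j := 0 + 0) (a := (r * s) • ⟨vac, mem_liF_of_eq_zero rfl _⟩)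
      (b := ⟨mode (-1) (r • vac) (s • vac), _⟩) rfl ?_
    simp [mode_vac_left, mul_smul, smul_comm r s]
  commutes r := by
    rintro ⟨p, x⟩
    obtain ⟨a, rfl⟩ := symb_surjective p x
    refine gradedMk_eq (i := 0 + p) (j := p + 0) (a := ⟨mode (-1) (r • vac) (a : V), _⟩)
      (b := ⟨mode (-1) (a : V) (r • vac), _⟩) (add_comm 0 p) ?_
    simp [mode_vac_left, mode_neg_one_vac]
  smul_def r := by
    rintro ⟨p, x⟩
    obtain ⟨a, rfl⟩ := symb_surjective p x
    refine gradedMk_eq (i := p) (j := 0 + p) (a := r • a)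
      (b := ⟨mode (-1) (r • vac) (a : V), _⟩) (zero_add p).symm ?_
    simp [mode_vac_left]

variable (V) in
/-- The associated graded algebra `gr V = ⨁ F^p V / F^(p+1) V`. -/
abbrev Gr : Type _ := DirectSum ℕ (GrPiece V)

theorem of_symb_eq {i j : ℕ} (hij : i = j) {a : ↥(liF V i)} {b : ↥(liF V j)}
    (h : (a : V) = b) :
    DirectSum.of (GrPiece V) i (symb i a) = DirectSum.of (GrPiece V) j (symb j b) :=
  DirectSum.of_eq_of_gradedMonoid_eq (gradedMk_eq hij (by rw [h, sub_self]; exact zero_mem _))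

/-- The translation operator on homogeneous components, `σ a ↦ σ (T a)`. -/
noncomputable def grTPiece (p : ℕ) : GrPiece V p →ₗ[ℂ] GrPiece V (p + 1) :=
  grLift (symb (p + 1) ∘ₗ T.restrict fun _ ha => T_mem ha) fun _ ha =>
    symb_eq_zero (T_mem (p := p + 1) ha)

theorem of_mul_of_symb {p q : ℕ} (a : ↥(liF V p)) (b : ↥(liF V q)) :
    DirectSum.of (GrPiece V) p (symb p a) * DirectSum.of (GrPiece V) q (symb q b) =
      DirectSum.of (GrPiece V) (p + q)
        (symb (p + q) ⟨mode (-1) (a : V) (b : V), mode_mem (liBound_mul p q) a.2 b.2⟩) :=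
  DirectSum.of_mul_of _ _

variable (V) in
/-- The translation operator of `gr V` as a linear map. -/
noncomputable def grTLin : Gr V →ₗ[ℂ] Gr V :=
  DirectSum.toModule ℂ ℕ (Gr V) fun p => DirectSum.lof ℂ ℕ (GrPiece V) (p + 1) ∘ₗ grTPiece p

theorem grTLin_of {p : ℕ} (a : ↥(liF V p)) :
    grTLin V (DirectSum.of (GrPiece V) p (symb p a)) =
      DirectSum.of (GrPiece V) (p + 1) (symb (p + 1) ⟨T (a : V), T_mem a.2⟩) :=
  DirectSum.toModule_lof ℂ p _

theorem grTLin_mul (x y : Gr V) :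
    grTLin V (x * y) = x • grTLin V y + y • grTLin V x := by
  induction x using DirectSum.induction_on with
  | zero => simp
  | add x x' hx hx' =>
    rw [add_mul, map_add, hx, hx', map_add]
    simp only [smul_eq_mul]
    ring
  | of p x =>
    induction y using DirectSum.induction_on with
    | zero => simp
    | add y y' hy hy' =>
      rw [mul_add, map_add, hy, hy', map_add]
      simp only [smul_eq_mul]
      ring
    | of q y =>
      obtain ⟨a, rfl⟩ := symb_surjective p x
      obtain ⟨b, rfl⟩ := symb_surjective q y
      rw [smul_eq_mul, smul_eq_mul, mul_comm (DirectSum.of _ q _), grTLin_of, grTLin_of,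
        of_mul_of_symb, of_mul_of_symb, of_mul_of_symb, grTLin_of]
      have e : (⟨T (mode (-1) (a : V) (b : V)), T_mem (mode_mem (liBound_mul p q) a.2 b.2)⟩ :
          ↥(liF V (p + q + 1))) =
          ⟨mode (-1) (a : V) (T (b : V)), mode_mem (liBound_mul p (q + 1)) a.2 (T_mem b.2)⟩ +
          ⟨mode (-1) (T (a : V)) (b : V),
            mode_mem (by simp only [LiBound]; omega) (T_mem a.2) b.2⟩ := by
        ext
        change T (mode (-1) (a : V) (b : V)) =
          mode (-1) (a : V) (T (b : V)) + mode (-1) (T (a : V)) (b : V)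
        rw [T_mode, mode_neg_one_T]
        simp
      rw [e, map_add, map_add]
      congr 1
      exact of_symb_eq (by omega) rfl

variable (V) in
/-- The translation operator of `gr V`, a derivation. -/
noncomputable def grT : Derivation ℂ (Gr V) (Gr V) := Derivation.mk' (grTLin V) grTLin_mul

/-- The `n`-th product of the vertex Poisson algebra `gr V` on homogeneous components:
`(σ a)_(n) (σ b) = σ (a_(n) b)` in degree `p + q - n`, which is zero if `n > p + q`. -/
noncomputable def grProdPiece (n p q : ℕ) : GrPiece V p →ₗ[ℂ] GrPiece V q →ₗ[ℂ] Gr V :=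
  if h : n ≤ p + q then
    (grOp n p q (p + q - n) (by simp only [LiBound]; omega)).compr₂
      (DirectSum.lof ℂ ℕ (GrPiece V) (p + q - n))
  else 0

/-- The `n`-th product of the vertex Poisson algebra `gr V`, for `n ≥ 0`. -/
noncomputable def grProd (n : ℕ) : Gr V →ₗ[ℂ] Gr V →ₗ[ℂ] Gr V :=
  DirectSum.toModule ℂ ℕ _ fun p =>
    (DirectSum.toModule ℂ ℕ _ fun q => (grProdPiece n p q).flip).flip

theorem grProd_of {n p q : ℕ} (h : n ≤ p + q) (a : ↥(liF V p)) (b : ↥(liF V q)) :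
    grProd n (DirectSum.of (GrPiece V) p (symb p a)) (DirectSum.of (GrPiece V) q (symb q b)) =
      DirectSum.of (GrPiece V) (p + q - n) (symb (p + q - n)
        ⟨mode n (a : V) (b : V), mode_mem (by simp only [LiBound]; omega) a.2 b.2⟩) := by
  rw [← DirectSum.lof_eq_of ℂ, ← DirectSum.lof_eq_of ℂ, grProd, DirectSum.toModule_lof,
    LinearMap.flip_apply, DirectSum.toModule_lof, LinearMap.flip_apply, grProdPiece, dif_pos h]
  rfl

/-! ### Chiral Poisson cores and the singular support -/

/-- An ideal of `gr V` is chiral Poisson if it is stable under all `a_(n)`, `n ≥ 0`. -/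
def IsChiralPoisson (I : Ideal (Gr V)) : Prop :=
  ∀ (n : ℕ) (a x : Gr V), x ∈ I → grProd n a x ∈ I

/-- The chiral Poisson core of an ideal: the biggest chiral Poisson ideal contained in it. -/
noncomputable def chiralPoissonCore (I : Ideal (Gr V)) : Ideal (Gr V) :=
  sSup {J | IsChiralPoisson J ∧ J ≤ I}

theorem chiralPoissonCore_isGreatest (I : Ideal (Gr V)) :
    IsGreatest {J | IsChiralPoisson J ∧ J ≤ I} (chiralPoissonCore I) := by
  refine ⟨⟨?_, sSup_le fun J hJ => hJ.2⟩, fun J hJ => le_sSup hJ⟩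
  intro n a x hx
  rw [chiralPoissonCore, sSup_eq_iSup'] at hx
  induction hx using Submodule.iSup_induction' with
  | mem J x hx => exact (le_sSup J.2 : J.1 ≤ chiralPoissonCore I) (J.2.1 n a x hx)
  | zero => rw [map_zero]; exact zero_mem _
  | add x y _ _ hx hy => rw [map_add]; exact add_mem hx hy

variable (V) in
/-- The reduced singular support `SS(V) = Specm (gr V)`, with its Zariski topology. -/
abbrev SingularSupport : Type _ := MaximalSpectrum (Gr V)

/-- The chiral symplectic core of a point of `SS(V)`. -/
def chiralSymplecticCore (x : SingularSupport V) : Set (SingularSupport V) :=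
  {y | chiralPoissonCore y.asIdeal = chiralPoissonCore x.asIdeal}

/-! ### Zhu's `C₂`-algebra -/

variable (V) in
/-- `C₂(V)`, the span of the vectors `a_(-2) b`. -/
noncomputable def C2 : Submodule ℂ V :=
  Submodule.span ℂ {v | ∃ a b : V, v = mode (-2) a b}

theorem mode_mem_C2 (n : ℕ) : ∀ a b : V, mode (-(n : ℤ) - 2) a b ∈ C2 V := by
  induction n with
  | zero => exact fun a b => Submodule.subset_span ⟨a, b, rfl⟩
  | succ n ih =>
    intro a b
    have e := T_mode a b (-(n : ℤ) - 2)
    have e1 : T (mode (-(n : ℤ) - 2) a b) ∈ C2 V := by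
      rw [T_eq]
      exact Submodule.subset_span ⟨_, _, rfl⟩
    have e2 : (-(n : ℤ) - 2) • mode (-(n : ℤ) - 2 - 1) a b ∈ C2 V := by
      rw [eq_sub_iff_add_eq, ← eq_sub_iff_add_eq'] at e
      rw [e]
      exact sub_mem (ih a (T b)) e1
    have e3 : ((-(n : ℤ) - 2 : ℤ) : ℂ) ≠ 0 := by
      have : -(n : ℤ) - 2 ≠ 0 := by omega
      exact_mod_cast this
    rw [← Int.cast_smul_eq_zsmul ℂ] at e2
    have e4 := (Submodule.smul_mem_iff _ e3).1 e2
    rw [show -((n + 1 : ℕ) : ℤ) - 2 = -(n : ℤ) - 2 - 1 by push_cast; ring]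
    exact e4

theorem mode_neg_one_mem_C2 (u : V) {w : V} (hw : w ∈ C2 V) : mode (-1) u w ∈ C2 V := by
  induction hw using Submodule.span_induction with
  | mem x hx =>
    obtain ⟨a, b, rfl⟩ := hx
    obtain ⟨J, hJ⟩ := commutator_formula u a
    have e := hJ b (-1) (-2) J le_rfl
    rw [sub_eq_iff_eq_add] at e
    rw [e]
    refine add_mem (Submodule.sum_mem _ fun j _ => zsmul_mem ?_ _)
      (Submodule.subset_span ⟨_, _, rfl⟩)
    rw [show (-1 : ℤ) + -2 - j = -((j + 1 : ℕ) : ℤ) - 2 by push_cast; ring]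
    exact mode_mem_C2 _ _ _
  | zero => rw [map_zero]; exact zero_mem _
  | add x y _ _ hx hy => rw [map_add]; exact add_mem hx hy
  | smul r x _ hx => rw [map_smul]; exact Submodule.smul_mem _ _ hx

/-- `F^1 V = C₂(V)`. -/
theorem liF_one : liF V 1 = C2 V := by
  apply le_antisymm
  · rw [liF, Submodule.span_le]
    rintro v ⟨L, b, hL, rfl⟩
    induction L with
    | nil => simp at hL
    | cons x L ih =>
      obtain ⟨u, m⟩ := x
      rcases m with _ | m
      · exact mode_neg_one_mem_C2 u (ih (by simpa using hL))
      · have := mode_mem_C2 m u (L.foldr (fun x w => mode (-(x.2 : ℤ) - 1) x.1 w) b)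
        rw [show -(m : ℤ) - 2 = -((m + 1 : ℕ) : ℤ) - 1 by push_cast; ring] at this
        exact this
  · rw [C2, Submodule.span_le]
    rintro v ⟨a, b, rfl⟩
    exact Submodule.subset_span ⟨[(a, 1)], b, by simp, by simp⟩

variable (V) in
/-- Zhu's `C₂`-algebra `R_V = V / C₂(V)`. -/
def ZhuC2 : Type _ := V ⧸ C2 V

noncomputable instance : AddCommGroup (ZhuC2 V) := inferInstanceAs (AddCommGroup (V ⧸ C2 V))

noncomputable instance : Module ℂ (ZhuC2 V) := inferInstanceAs (Module ℂ (V ⧸ C2 V))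

/-- The class `ā` of `a` in `R_V`. -/
noncomputable def zhuMk : V →ₗ[ℂ] ZhuC2 V := (C2 V).mkQ

theorem zhuMk_surjective (x : ZhuC2 V) : ∃ a, zhuMk a = x := Submodule.mkQ_surjective _ x

theorem zhuMk_eq {a b : V} (h : a - b ∈ liF V 1) : zhuMk a = zhuMk b := by
  rw [liF_one] at h
  exact (Submodule.Quotient.eq _).2 h

theorem zhuMk_eq_zero {a : V} (h : a ∈ liF V 1) : zhuMk a = 0 := by
  rw [liF_one] at h
  exact (Submodule.Quotient.mk_eq_zero _).2 h

/-- Linear maps out of `R_V`. -/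
noncomputable def zhuLift {M : Type*} [AddCommGroup M] [Module ℂ M] (f : V →ₗ[ℂ] M)
    (hf : ∀ a ∈ liF V 1, f a = 0) : ZhuC2 V →ₗ[ℂ] M :=
  Submodule.liftQ (C2 V) f fun a ha => hf a (by rwa [liF_one])

/-- The operations `(ā, b̄) ↦ class of a_(n) b` on `R_V` for `n = -1` and `n = 0`. -/
noncomputable def zhuOp (n : ℤ) (hn : n = -1 ∨ n = 0) : ZhuC2 V →ₗ[ℂ] ZhuC2 V →ₗ[ℂ] ZhuC2 V :=
  zhuLift (zhuLift ((mode n).compr₂ zhuMk).flip fun b hb => by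
      ext a
      exact zhuMk_eq_zero (mode_mem (p := 0) (q := 1) (by simp only [LiBound]; omega)
        (mem_liF_of_eq_zero rfl _) hb)).flip fun a ha => by
    ext y
    obtain ⟨b, rfl⟩ := zhuMk_surjective y
    exact zhuMk_eq_zero (mode_mem (p := 1) (q := 0) (by simp only [LiBound]; omega) ha
      (mem_liF_of_eq_zero rfl _))

theorem zhuOp_mk (n : ℤ) (hn : n = -1 ∨ n = 0) (a b : V) :
    zhuOp n hn (zhuMk a) (zhuMk b) = zhuMk (mode n a b) := rfl

/-- `R_V` is a commutative ring under `ā · b̄ = class of a_(-1) b`, with unit the class of the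
vacuum. -/
noncomputable instance : CommRing (ZhuC2 V) where
  __ := (inferInstance : AddCommGroup (ZhuC2 V))
  mul x y := zhuOp (-1) (Or.inl rfl) x y
  one := zhuMk vac
  mul_comm x y := by
    obtain ⟨a, rfl⟩ := zhuMk_surjective x
    obtain ⟨b, rfl⟩ := zhuMk_surjective y
    exact zhuMk_eq (mul_comm_mem (p := 0) (q := 0) (mem_liF_of_eq_zero rfl a)
      (mem_liF_of_eq_zero rfl b))
  mul_assoc x y z := by
    obtain ⟨a, rfl⟩ := zhuMk_surjective x
    obtain ⟨b, rfl⟩ := zhuMk_surjective y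
    obtain ⟨c, rfl⟩ := zhuMk_surjective z
    exact zhuMk_eq (mul_assoc_mem (p := 0) (q := 0) (r := 0) (mem_liF_of_eq_zero rfl a)
      (mem_liF_of_eq_zero rfl b) (mem_liF_of_eq_zero rfl c))
  one_mul x := by
    obtain ⟨a, rfl⟩ := zhuMk_surjective x
    change zhuMk (mode (-1) vac a) = _
    simp [mode_vac_left]
  mul_one x := by
    obtain ⟨a, rfl⟩ := zhuMk_surjective x
    change zhuMk (mode (-1) a vac) = _
    rw [mode_neg_one_vac]
  left_distrib x y z := map_add (zhuOp _ _ x) y z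
  right_distrib x y z := by
    change zhuOp _ _ (x + y) z = _
    rw [map_add]
    rfl
  zero_mul x := by
    change zhuOp _ _ 0 x = _
    rw [map_zero]
    rfl
  mul_zero x := map_zero (zhuOp _ _ x)

noncomputable instance : Algebra ℂ (ZhuC2 V) :=
  Algebra.ofModule
    (fun r x y => by
      change zhuOp _ _ (r • x) y = _
      rw [map_smul]
      rfl)
    (fun r x y => map_smul (zhuOp _ _ x) r y)

/-- The Poisson bracket of `R_V`, `{ā, b̄} = class of a_(0) b`. -/
noncomputable def zhuBracket : ZhuC2 V →ₗ[ℂ] ZhuC2 V →ₗ[ℂ] ZhuC2 V := zhuOp 0 (Or.inr rfl)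

variable (V) in
/-- The inclusion of `R_V = F^0 V / F^1 V` into `gr V` as the component of degree zero. -/
noncomputable def zhuToGr : ZhuC2 V →ₐ[ℂ] Gr V :=
  AlgHom.ofLinearMap
    (DirectSum.lof ℂ ℕ (GrPiece V) 0 ∘ₗ
      zhuLift (symb 0 ∘ₗ LinearMap.codRestrict (liF V 0) LinearMap.id
        (fun v => mem_liF_of_eq_zero rfl v)) (fun _ hv => symb_eq_zero (p := 0) hv))
    rfl
    (by
      intro x y
      obtain ⟨a, rfl⟩ := zhuMk_surjective x
      obtain ⟨b, rfl⟩ := zhuMk_surjective y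
      exact (of_mul_of_symb (p := 0) (q := 0) ⟨a, mem_liF_of_eq_zero rfl a⟩
        ⟨b, mem_liF_of_eq_zero rfl b⟩).symm)

/-! ### Symplectic leaves and quasi-lisse vertex algebras -/

variable (V) in
/-- The points of the associated variety `X_V`. When `R_V` is finitely generated, these are the
maximal ideals of `R_V`. -/
abbrev AssocVariety : Type _ := ZhuC2 V →ₐ[ℂ] ℂ

/-- `γ` is, on the disc of radius `r`, an integral curve in `X_V` of the Hamiltonian vector field
`{h, ·}`: for every function `f`, `d/dz f(γ(z)) = {h, f}(γ(z))`. -/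
def IsHamiltonianCurve (h : ZhuC2 V) (r : ℝ) (γ : ℂ → AssocVariety V) : Prop :=
  ∀ z ∈ Metric.ball (0 : ℂ) r, ∀ f : ZhuC2 V,
    HasDerivAt (fun w => γ w f) (γ z (zhuBracket h f)) z

/-- Two points of `X_V` that lie on a common Hamiltonian integral curve. -/
def HamiltonianStep (x y : AssocVariety V) : Prop :=
  ∃ (h : ZhuC2 V) (r : ℝ) (γ : ℂ → AssocVariety V), IsHamiltonianCurve h r γ ∧
    γ 0 = x ∧ ∃ z ∈ Metric.ball (0 : ℂ) r, γ z = y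

variable (V) in
/-- The points of `X_V` are equivalent if one can travel from one to the other along finitely many
Hamiltonian integral curves. Since Hamiltonian flows preserve the singular locus of `X_V`, the
singular locus of the singular locus, and so on, the classes are the symplectic leaves of the
smooth strata of `X_V`. -/
def leafSetoid : Setoid (AssocVariety V) := Relation.EqvGen.setoid HamiltonianStep

variable (V) in
/-- The set of symplectic leaves of `X_V`. -/
abbrev SymplecticLeaf : Type _ := Quotient (leafSetoid V)

variable (V) in
/-- `V` is quasi-lisse if `X_V` has finitely many symplectic leaves. -/
def IsQuasiLisse : Prop := Finite (SymplecticLeaf V)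

end VertexAlgebra

/-! ### Arc spaces of affine schemes -/

section Arc

open MvPolynomial

variable (R : Type*) [CommRing R] [Algebra ℂ R]

/-- The derivation `T` of the polynomial ring in the variables `x_(a, j)`, `a ∈ R`, `j ≥ 0`, with
`T x_(a, j) = x_(a, j + 1)`. -/
noncomputable def arcT : Derivation ℂ (MvPolynomial (R × ℕ) ℂ) (MvPolynomial (R × ℕ) ℂ) :=
  mkDerivation ℂ fun x => X (x.1, x.2 + 1)

/-- The relations of the arc space: all `T^j f`, where `f` runs over the polynomial relations
between the elements of `R`. -/
noncomputable def arcIdeal : Ideal (MvPolynomial (R × ℕ) ℂ) :=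
  Ideal.span {g | ∃ (f : MvPolynomial R ℂ) (j : ℕ), aeval (id : R → R) f = 0 ∧
    g = (arcT R)^[j] (rename (fun a => (a, 0)) f)}

/-- The coordinate ring `J_∞ R` of the arc space of `Spec R`, presented on the generating set of all
elements of `R`; the class of `x_(a, j)` is `T^j a`. -/
abbrev ArcAlgebra : Type _ := MvPolynomial (R × ℕ) ℂ ⧸ arcIdeal R

/-- The arc space `J_∞ X`, `X = Spec R`, as a topological space: the maximal ideals of `J_∞ R` with
the Zariski topology. -/
abbrev ArcSpace : Type _ := MaximalSpectrum (ArcAlgebra R)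

variable {R}

/-- The homomorphism `J_∞ R → J_∞ S` induced by `φ : R → S`; it maps `T^j a` to `T^j (φ a)`. -/
noncomputable def arcMap {S : Type*} [CommRing S] [Algebra ℂ S] (φ : R →ₐ[ℂ] S) :
    ArcAlgebra R →ₐ[ℂ] ArcAlgebra S :=
  Ideal.quotientMapₐ (arcIdeal S) (rename (Prod.map φ id)) (by
    rw [arcIdeal, Ideal.span_le]
    rintro g ⟨f, j, hf, rfl⟩
    have hT : ∀ p, rename (Prod.map φ id) (arcT R p) = arcT S (rename (Prod.map φ id) p) := by
      intro p
      induction p using MvPolynomial.induction_on with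
      | C c => simp [← algebraMap_eq]
      | add p q hp hq => simp only [map_add, hp, hq]
      | mul_X p x hp =>
        rw [Derivation.leibniz, map_add, smul_eq_mul, smul_eq_mul, map_mul, map_mul, hp, map_mul,
          Derivation.leibniz, rename_X]
        simp only [arcT, mkDerivation_X, rename_X, smul_eq_mul]
        rfl
    have hTj : ∀ (j : ℕ) p, rename (Prod.map φ id) ((arcT R)^[j] p) =
        (arcT S)^[j] (rename (Prod.map φ id) p) := by
      intro j
      induction j with
      | zero => intro p; rfl
      | succ j ih => intro p; rw [Function.iterate_succ_apply, ih, hT, Function.iterate_succ_apply]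
    refine Ideal.subset_span ⟨rename φ f, j, ?_, ?_⟩
    · have : ∀ f : MvPolynomial R ℂ, aeval (id : S → S) (rename φ f) = φ (aeval (id : R → R) f) := by
        intro f
        rw [aeval_rename, ← AlgHom.comp_apply, comp_aeval]
        rfl
      rw [this, hf, map_zero]
    · change rename (Prod.map φ id) _ = _
      rw [hTj, rename_rename, rename_rename]
      rfl)

/-- The universal property of `J_∞ R`: a homomorphism `f` to an algebra with a derivation `d`
induces a homomorphism of differential algebras, which maps `T^j a` to `d^j (f a)`. -/
noncomputable def arcLift {A : Type*} [CommRing A] [Algebra ℂ A] (f : R →ₐ[ℂ] A)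
    (d : Derivation ℂ A A) : ArcAlgebra R →ₐ[ℂ] A :=
  Ideal.Quotient.liftₐ (arcIdeal R) (aeval fun x : R × ℕ => d^[x.2] (f x.1)) (by
    have hT : ∀ p, aeval (fun x : R × ℕ => d^[x.2] (f x.1)) (arcT R p) =
        d (aeval (fun x : R × ℕ => d^[x.2] (f x.1)) p) := by
      intro p
      induction p using MvPolynomial.induction_on with
      | C c => simp [← algebraMap_eq]
      | add p q hp hq => simp only [map_add, hp, hq]
      | mul_X p x hp =>
        rw [Derivation.leibniz, map_add, smul_eq_mul, smul_eq_mul, map_mul, map_mul, hp, map_mul,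
          Derivation.leibniz, aeval_X]
        simp only [arcT, mkDerivation_X, aeval_X, smul_eq_mul, Function.iterate_succ_apply']
    have hTj : ∀ (j : ℕ) p, aeval (fun x : R × ℕ => d^[x.2] (f x.1)) ((arcT R)^[j] p) =
        d^[j] (aeval (fun x : R × ℕ => d^[x.2] (f x.1)) p) := by
      intro j
      induction j with
      | zero => intro p; rfl
      | succ j ih => intro p; rw [Function.iterate_succ_apply, ih, hT, Function.iterate_succ_apply]
    intro a ha
    change a ∈ RingHom.ker (aeval fun x : R × ℕ => d^[x.2] (f x.1))
    revert a
    change arcIdeal R ≤ _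
    rw [arcIdeal, Ideal.span_le]
    rintro g ⟨p, j, hp, rfl⟩
    have e : aeval (fun x : R × ℕ => d^[x.2] (f x.1)) (rename (fun a => (a, 0)) p) = 0 := by
      rw [aeval_rename]
      have : aeval ((fun x : R × ℕ => d^[x.2] (f x.1)) ∘ fun a => (a, 0)) p =
          f (aeval (id : R → R) p) := by
        rw [← AlgHom.comp_apply, comp_aeval]
        rfl
      rw [this, hp, map_zero]
    change aeval _ _ = 0
    rw [hTj, e, Function.iterate_fixed (map_zero d)])

end Arc

namespace VertexAlgebra

variable (V : Type*) [AddCommGroup V] [Module ℂ V] [VertexAlgebra V]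

/-- The homomorphism of differential algebras `J_∞ R_V → gr V` induced by the identity of `R_V`. -/
noncomputable def arcToGr : ArcAlgebra (ZhuC2 V) →ₐ[ℂ] Gr V := arcLift (zhuToGr V) (grT V)

/-- The coordinate ring of the (reduced) associated variety `X_V`. -/
abbrev ZhuRed : Type _ := ZhuC2 V ⧸ nilradical (ZhuC2 V)

/-- The homomorphism `J_∞ R_V → ℂ[J_∞ X_V]` induced by `R_V → ℂ[X_V]`. -/
noncomputable def arcToRed : ArcAlgebra (ZhuC2 V) →ₐ[ℂ] ArcAlgebra (ZhuRed V) :=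
  arcMap (Ideal.Quotient.mkₐ ℂ (nilradical (ZhuC2 V)))

end VertexAlgebra

namespace VertexAlgebra

variable {V : Type*} [AddCommGroup V] [Module ℂ V] [VertexAlgebra V]

/-! ### The generation of `gr V` and its `n`-th products -/

/-! Since `a_(-m-1) b = (T^m a)_(-1) b / m!`, the differential algebra `gr V` is generated by `R_V`,
so `arcToGr` is surjective. Both homeomorphisms then reduce to a statement on kernels: what dies in
`gr V`, or in `J_∞ (R_V / √0)`, lies in every prime of `J_∞ R_V`. For the second ring this holds
because arcs take values in a domain `k[[t]]` (`ker_arcMap_nilradical_le`). For the first, and for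
the chiral cores, the tool is the modes `h_(n)`, `h ∈ R_V`: they are derivations of `gr V` with
`[h_(n), T] = n h_(n-1)`, and they suffice to detect chiral Poisson ideals
(`isChiralPoisson_of_grHam`).

Let `q` be a Poisson prime of `R_V` along which the Poisson tensor has rank `ρ`. Where a minor `det
{a_i, t_j}` of size `ρ` does not vanish, the `t_k` have dual vector fields `Y_k` in the span of the
Hamiltonian ones, and these commute (`PoissonChart`, `Y_comm`). Call the chart étale if its
functions are algebraic over the `t_k`. Then no nonzero proper ideal is stable under the `Y_k`,
derivations are determined by their values on the `t_k`, and arcs in the chart are described by the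
ring `S` of the chart with the derivatives of the `t_k` as free variables. The mode `h_(n+1)`
differentiates only in variables of order at least `n + 1`, with coefficient `(n+1)! {h, t_k}` at
order `n + 1`; inverting the matrix `{a_i, t_k}` gives all the partial derivatives of top order.
Hence this ring has no nonzero proper ideal stable under the modes
(`PoissonChart.IsEtale.arc_eq_top`).

This has two consequences. The kernel of `arcToGr` generates on the arcs of the chart a stable
ideal, which is proper since it vanishes on constant arcs, so it is zero and the restriction to the
chart factors through `gr V` (`arcRestrict_eq_zero`). And all points of `SS(V)` that lie on the arcs
of the chart have the same chiral Poisson core, the kernel of the restriction; they are dense in its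
zero set, which thus lies in the closure of one chiral symplectic core (`exists_subset_closure`).

These zero sets cover everything (`exists_arcRestrict_eq_zero`). A point of `J_∞ R_V` is an arc with
values in `k[[t]]`; take for `q` the Poisson core of the kernel of this arc. Ideals of minors are
Poisson, so some maximal minor along `q` does not vanish along the arc, and over the fraction field
of `k[[t]]` the arc lies in the chart.

The finiteness of the set of leaves gives étaleness and the finiteness of the set of Poisson primes.
The flow of the `Y_k` is a convergent exponential series, and a leaf meets each fibre of the
coordinates in a countable set (`countable_leaf_fiber`). With finitely many leaves the whole fibre
is countable, whereas by Chevalley's theorem a function transcendental over the coordinates would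
make some fibre uncountable (`isAlgebraic_adjoin_of_countable_fiber`). Finally, in an étale chart
`q` is the Poisson core of every point, and Poisson cores are constant along leaves
(`finite_isPrime_isPoissonIdeal`). -/

theorem expCoeff_neg_one (j : ℕ) : expCoeff (-1) j = 1 := by
  induction j with
  | zero => exact expCoeff_zero _
  | succ j ih =>
    have := expCoeff_mul (-1) j
    rw [ih] at this
    have h : ((j : ℤ) + 1) ≠ 0 := by omega
    exact mul_right_cancel₀ h (by linarith)

theorem expCoeff_neg_two (j : ℕ) : expCoeff (-2) j = j + 1 := by
  induction j with
  | zero => simp [expCoeff_zero]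
  | succ j ih =>
    have := expCoeff_mul (-2) j
    rw [ih] at this
    have h : ((j : ℤ) + 1) ≠ 0 := by omega
    exact mul_right_cancel₀ h (by push_cast; linarith)

/-- In the iterate formula for `T a = a_(-2)|0⟩` only the mode `-1` of the vacuum survives. It
occurs once: in the first sum if `k < 0`, in the second if `k > 0`, and in neither if `k = 0`. -/
theorem mode_T (k : ℤ) (a b : V) : mode k (T a) b = -k • mode (k - 1) a b := by
  obtain ⟨J₀, hJ⟩ := iterate_formula a vac b (-2) k
  rw [T_eq, hJ (J₀ + k.natAbs + 2) (by omega)]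
  simp only [mode_vac_left, expCoeff_neg_two]
  rcases lt_or_ge k 0 with hk | hk
  · obtain ⟨i, rfl⟩ : ∃ i : ℕ, k = -1 - i := ⟨(-1 - k).toNat, by omega⟩
    rw [Finset.sum_eq_single i, Finset.sum_eq_zero]
    · rw [if_pos (by ring), smul_zero, sub_zero]
      congr 2 <;> ring_nf
    · intro j _
      rw [if_neg (by omega), smul_zero]
    · intro j _ hj
      rw [if_neg (by omega), map_zero, smul_zero]
    · intro h
      simp only [Finset.mem_range] at h
      omega
  · rw [Finset.sum_eq_zero, zero_sub]
    · rcases eq_or_lt_of_le hk with rfl | hk'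
      · rw [Finset.sum_eq_zero]
        · simp
        · intro j _
          rw [if_neg (by omega), smul_zero]
      · obtain ⟨i, rfl⟩ : ∃ i : ℕ, k = i + 1 := ⟨(k - 1).toNat, by omega⟩
        rw [Finset.sum_eq_single i]
        · rw [if_pos (by ring), show (Int.negOnePow (-2)) = 1 from Int.negOnePow_even _ ⟨-1, rfl⟩,
            Units.val_one, one_smul, neg_smul]
          congr 2
          ring_nf
        · intro j _ hj
          rw [if_neg (by omega), smul_zero]
        · intro h
          simp only [Finset.mem_range] at h
          omega
    · intro j _
      rw [if_neg (by omega), map_zero, smul_zero]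

theorem factorial_smul_mode (m : ℕ) (a b : V) :
    (m.factorial : ℂ) • mode (-(m : ℤ) - 1) a b = mode (-1) (T^[m] a) b := by
  induction m generalizing a with
  | zero => simp
  | succ m ih =>
    rw [Function.iterate_succ_apply, ← ih, mode_T, Nat.factorial_succ, mul_comm, Nat.cast_mul,
      mul_smul, ← Int.cast_smul_eq_zsmul ℂ]
    congr 2
    · push_cast; ring
    · congr 2; push_cast; ring_nf

/-- This rewrites the words that span the Li filtration as iterated `(-1)`-products of derivatives,
which is the reason that `R_V` generates `gr V` differentially. -/
theorem mode_neg_eq (m : ℕ) (a b : V) :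
    mode (-(m : ℤ) - 1) a b = (m.factorial : ℂ)⁻¹ • mode (-1) (T^[m] a) b := by
  rw [← factorial_smul_mode, smul_smul, inv_mul_cancel₀, one_smul]
  exact_mod_cast m.factorial_ne_zero

theorem T_iterate_mem {p : ℕ} {a : V} (ha : a ∈ liF V p) (m : ℕ) : T^[m] a ∈ liF V (p + m) := by
  induction m with
  | zero => exact ha
  | succ m ih => rw [Function.iterate_succ_apply']; exact T_mem ih

open Classical in
/-- The symbol of `v` in degree `p`, as an element of `gr V`. -/
noncomputable def grSymb (p : ℕ) (v : V) : Gr V :=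
  -- The value outside `F^p V` is irrelevant; it allows degree and vector to be rewritten
  -- independently, without transport along equalities of degrees.
  if h : v ∈ liF V p then DirectSum.of (GrPiece V) p (symb p ⟨v, h⟩) else 0

theorem grSymb_of_mem {p : ℕ} {v : V} (h : v ∈ liF V p) :
    grSymb p v = DirectSum.of (GrPiece V) p (symb p ⟨v, h⟩) := dif_pos h

theorem grSymb_add {p : ℕ} {v w : V} (hv : v ∈ liF V p) (hw : w ∈ liF V p) :
    grSymb p (v + w) = grSymb p v + grSymb p w := by
  rw [grSymb_of_mem hv, grSymb_of_mem hw, grSymb_of_mem (add_mem hv hw), ← map_add, ← map_add]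
  rfl

theorem grSymb_smul {p : ℕ} {v : V} (hv : v ∈ liF V p) (c : ℂ) :
    grSymb p (c • v) = c • grSymb p v := by
  rw [grSymb_of_mem hv, grSymb_of_mem (Submodule.smul_mem _ c hv), ← DirectSum.lof_eq_of ℂ,
    ← DirectSum.lof_eq_of ℂ, ← map_smul, ← map_smul]
  rfl

theorem grSymb_eq_zero {p : ℕ} {v : V} (hv : v ∈ liF V (p + 1)) : grSymb p v = 0 := by
  rw [grSymb_of_mem (liF_anti (Nat.le_succ p) hv), symb_eq_zero (p := p) hv, map_zero]

theorem grSymb_zero (p : ℕ) : grSymb p (0 : V) = 0 := grSymb_eq_zero (zero_mem _)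

theorem grSymb_sum {ι : Type*} {p : ℕ} (s : Finset ι) (f : ι → V) (hf : ∀ i ∈ s, f i ∈ liF V p) :
    grSymb p (∑ i ∈ s, f i) = ∑ i ∈ s, grSymb p (f i) := by
  classical
  induction s using Finset.induction_on with
  | empty => simp [grSymb_zero]
  | insert i s hi ih =>
    rw [Finset.sum_insert hi, Finset.sum_insert hi, grSymb_add (hf i (Finset.mem_insert_self i s))
      (Submodule.sum_mem _ fun j hj => hf j (Finset.mem_insert_of_mem hj)),
      ih fun j hj => hf j (Finset.mem_insert_of_mem hj)]

theorem grSymb_mul {p q : ℕ} {v w : V} (hv : v ∈ liF V p) (hw : w ∈ liF V q) :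
    grSymb p v * grSymb q w = grSymb (p + q) (mode (-1) v w) := by
  rw [grSymb_of_mem hv, grSymb_of_mem hw, of_mul_of_symb,
    grSymb_of_mem (mode_mem (liBound_mul p q) hv hw)]

theorem grT_grSymb {p : ℕ} {v : V} (hv : v ∈ liF V p) :
    grT V (grSymb p v) = grSymb (p + 1) (T v) := by
  rw [grSymb_of_mem hv, grSymb_of_mem (T_mem hv)]
  exact grTLin_of _

theorem grT_iterate_grSymb {p : ℕ} {v : V} (hv : v ∈ liF V p) (m : ℕ) :
    (grT V)^[m] (grSymb p v) = grSymb (p + m) (T^[m] v) := by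
  induction m with
  | zero => rfl
  | succ m ih =>
    rw [Function.iterate_succ_apply', ih, grT_grSymb (T_iterate_mem hv m),
      Function.iterate_succ_apply']
    rfl

theorem grProd_grSymb {n p q : ℕ} (h : n ≤ p + q) {v w : V} (hv : v ∈ liF V p)
    (hw : w ∈ liF V q) :
    grProd n (grSymb p v) (grSymb q w) = grSymb (p + q - n) (mode n v w) := by
  rw [grSymb_of_mem hv, grSymb_of_mem hw, grProd_of h,
    grSymb_of_mem (mode_mem (p := p) (q := q) (by simp only [LiBound]; omega) hv hw)]

theorem grProd_grSymb_of_lt {n p q : ℕ} (h : p + q < n) {v w : V} (hv : v ∈ liF V p)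
    (hw : w ∈ liF V q) : grProd n (grSymb p v) (grSymb q w) = 0 := by
  rw [grSymb_of_mem hv, grSymb_of_mem hw, ← DirectSum.lof_eq_of ℂ, ← DirectSum.lof_eq_of ℂ, grProd,
    DirectSum.toModule_lof, LinearMap.flip_apply, DirectSum.toModule_lof, LinearMap.flip_apply,
    grProdPiece, dif_neg (by omega)]
  rfl

theorem gr_induction {P : Gr V → Prop} (h0 : P 0) (hs : ∀ p v, v ∈ liF V p → P (grSymb p v))
    (ha : ∀ x y, P x → P y → P (x + y)) (x : Gr V) : P x := by
  induction x using DirectSum.induction_on with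
  | zero => exact h0
  | add x y hx hy => exact ha x y hx hy
  | of p x =>
    obtain ⟨a, rfl⟩ := symb_surjective p x
    have := hs p a a.2
    rwa [grSymb_of_mem a.2] at this

theorem zhuToGr_mk (a : V) : zhuToGr V (zhuMk a) = grSymb 0 a := by
  rw [grSymb_of_mem (mem_liF_of_eq_zero rfl a)]
  rfl

theorem arcToGr_mk_X (a : ZhuC2 V) (n : ℕ) :
    arcToGr V (Ideal.Quotient.mk _ (MvPolynomial.X (a, n))) = (grT V)^[n] (zhuToGr V a) := by
  change MvPolynomial.aeval _ _ = _
  rw [MvPolynomial.aeval_X]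

/-- A spanning word whose weights add up to exactly `p` has as symbol a scalar multiple of a product
of elements `T^m u`; a word of larger weight has symbol zero in degree `p`. -/
theorem arcToGr_surjective : Function.Surjective (arcToGr V) := by
  have hT : ∀ (m : ℕ) (u : V), grSymb m (T^[m] u) ∈ (arcToGr V).range := by
    intro m u
    have := grT_iterate_grSymb (mem_liF_of_eq_zero rfl u) m
    rw [zero_add] at this
    rw [← this, ← zhuToGr_mk, ← arcToGr_mk_X]
    exact ⟨_, rfl⟩
  have hw : ∀ (L : List (V × ℕ)) (b : V),
      grSymb (L.map Prod.snd).sum (L.foldr (fun x w => mode (-(x.2 : ℤ) - 1) x.1 w) b) ∈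
        (arcToGr V).range := by
    intro L b
    induction L with
    | nil => exact hT 0 b
    | cons x L ih =>
      obtain ⟨u, m⟩ := x
      simp only [List.map_cons, List.sum_cons, List.foldr_cons]
      set w := L.foldr (fun x w => mode (-(x.2 : ℤ) - 1) x.1 w) b
      have hwm : w ∈ liF V (L.map Prod.snd).sum := Submodule.subset_span ⟨L, b, le_rfl, rfl⟩
      have hu : T^[m] u ∈ liF V m := by
        simpa using T_iterate_mem (mem_liF_of_eq_zero (p := 0) rfl u) m
      rw [mode_neg_eq, grSymb_smul (mode_mem (liBound_mul _ _) hu hwm), ← grSymb_mul hu hwm]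
      exact Subalgebra.smul_mem _ (mul_mem (hT m u) ih) _
  rw [← AlgHom.range_eq_top, eq_top_iff]
  intro x _
  induction x using gr_induction with
  | h0 => exact zero_mem _
  | ha x y hx hy => exact add_mem (hx trivial) (hy trivial)
  | hs p v hv =>
    have hv' := hv
    rw [liF] at hv'
    induction hv' using Submodule.span_induction with
    | mem x hx =>
      obtain ⟨L, b, hL, rfl⟩ := hx
      rcases eq_or_lt_of_le hL with rfl | hL
      · exact hw L b
      · rw [grSymb_eq_zero (Submodule.subset_span ⟨L, b, hL, rfl⟩)]
        exact zero_mem _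
    | zero => rw [grSymb_zero]; exact zero_mem _
    | add x y hx hy hx' hy' => rw [grSymb_add hx hy]; exact add_mem (hx' hx trivial) (hy' hy trivial)
    | smul r x hx hx' => rw [grSymb_smul hx]; exact Subalgebra.smul_mem _ (hx' hx trivial) _

/-- In `[h_(n), a_(-1)] = ∑ (n choose j) (h_(j) a)_(n-1-j)` the terms with `j > n` have coefficient
zero. Those with `j < n` involve a nonnegative mode, which lies one step deeper in the filtration
than the bound for negative modes. Only `j = n` contributes to the symbol. -/
theorem grProd_zhu_mul (n : ℕ) (h : ZhuC2 V) (x y : Gr V) :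
    grProd n (zhuToGr V h) (x * y) =
      x • grProd n (zhuToGr V h) y + y • grProd n (zhuToGr V h) x := by
  obtain ⟨h, rfl⟩ := zhuMk_surjective h
  rw [zhuToGr_mk]
  have hh : h ∈ liF V 0 := mem_liF_of_eq_zero rfl h
  simp only [smul_eq_mul]
  induction x using gr_induction with
  | h0 => simp
  | ha x x' hx hx' => rw [add_mul, map_add, hx, hx', map_add]; ring
  | hs p a ha =>
  induction y using gr_induction with
  | h0 => simp
  | ha y y' hy hy' => rw [mul_add, map_add, hy, hy', map_add]; ring
  | hs q b hb =>
  have hab := mode_mem (liBound_mul p q) ha hb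
  rw [grSymb_mul ha hb]
  rcases lt_or_ge (p + q) n with hn | hn
  · rw [grProd_grSymb_of_lt (by omega) hh hab, grProd_grSymb_of_lt (by omega) hh hb,
      grProd_grSymb_of_lt (by omega) hh ha]
    simp
  rw [grProd_grSymb (by omega) hh hab]
  simp only [zero_add]
  obtain ⟨J₀, hJ⟩ := commutator_formula h a
  have e := hJ b n (-1) (J₀ + n + 1) (by omega)
  rw [sub_eq_iff_eq_add] at e
  have hmem : ∀ j : ℕ, mode j h a ∈ liF V (p - j) := fun j => by
    by_cases hk : p - j = 0
    · exact mem_liF_of_eq_zero hk _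
    · exact mode_mem (p := 0) (q := p) (by simp only [LiBound]; omega) hh ha
  have hmem' : ∀ j : ℕ, mode j h b ∈ liF V (q - j) := fun j => by
    by_cases hk : q - j = 0
    · exact mem_liF_of_eq_zero hk _
    · exact mode_mem (p := 0) (q := q) (by simp only [LiBound]; omega) hh hb
  have m1 : ∀ j ∈ Finset.range (J₀ + n + 1), Ring.choose (n : ℤ) j •
      mode (n + -1 - j) (mode j h a) b ∈ liF V (p + q - n) := by
    intro j _
    rcases le_or_gt j n with hj | hj
    · exact zsmul_mem (mode_mem (p := p - j) (q := q) (by simp only [LiBound]; omega) (hmem j) hb) _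
    · rw [Ring.choose_natCast, Nat.choose_eq_zero_of_lt hj]
      simp
  have m2 : mode (-1) a (mode n h b) ∈ liF V (p + q - n) :=
    mode_mem (p := p) (q := q - n) (by simp only [LiBound]; omega) ha (hmem' n)
  rw [e, grSymb_add (Submodule.sum_mem _ m1) m2, grSymb_sum _ _ m1,
    Finset.sum_eq_single_of_mem n (by simp), add_comm]
  · congr 1
    · rcases le_or_gt n q with hq | hq
      · rw [grProd_grSymb (by omega) hh hb, grSymb_mul ha (by simpa using hmem' n)]
        congr 1
        omega
      -- For `n > q` the product in `gr V` is zero by convention; the corresponding vector is in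
      -- `F^p V`, and `p > p + q - n`, so its symbol vanishes too.
      · rw [grProd_grSymb_of_lt (by omega) hh hb, mul_zero]
        exact grSymb_eq_zero (mode_mem (p := p) (q := 0) (by simp only [LiBound]; omega) ha
          (mem_liF_of_eq_zero rfl _))
    · rw [Ring.choose_natCast, Nat.choose_self, Nat.cast_one, one_smul,
        show (n : ℤ) + -1 - n = -1 by ring]
      rcases le_or_gt n p with hp | hp
      · rw [grProd_grSymb (by omega) hh ha, mul_comm, grSymb_mul (by simpa using hmem n) hb]
        congr 1
        omega
      · rw [grProd_grSymb_of_lt (by omega) hh ha, mul_zero]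
        exact grSymb_eq_zero (mode_mem (p := 0) (q := q) (by simp only [LiBound]; omega)
          (mem_liF_of_eq_zero rfl _) hb)
  · intro j _ hj
    rcases lt_or_ge n j with hj' | hj'
    · rw [Ring.choose_natCast, Nat.choose_eq_zero_of_lt hj']
      simp [grSymb_zero]
    · refine grSymb_eq_zero (zsmul_mem (mode_mem (p := p - j) (q := q) ?_ (hmem j) hb) _)
      simp only [LiBound]
      omega

/-- The operator `h_(n)`, `h ∈ R_V`, as a derivation of `gr V`. -/
noncomputable def grHam (n : ℕ) (h : ZhuC2 V) : Derivation ℂ (Gr V) (Gr V) :=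
  Derivation.mk' (grProd n (zhuToGr V h)) (grProd_zhu_mul n h)

theorem grHam_apply (n : ℕ) (h : ZhuC2 V) (x : Gr V) :
    grHam n h x = grProd n (zhuToGr V h) x := rfl

/-- This is `[h_(n), T] = n h_(n-1)`. Together with the values on `R_V` it determines `h_(n)` on all
of `gr V`. The truncated `n - 1` is harmless at `n = 0`, where the factor `n` vanishes. -/
theorem grHam_grT (n : ℕ) (h : ZhuC2 V) (x : Gr V) :
    grHam n h (grT V x) = grT V (grHam n h x) + n • grHam (n - 1) h x := by
  obtain ⟨h, rfl⟩ := zhuMk_surjective h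
  have hh : h ∈ liF V 0 := mem_liF_of_eq_zero rfl h
  simp only [grHam_apply, zhuToGr_mk]
  induction x using gr_induction with
  | h0 => simp
  | ha x y hx hy => simp only [map_add, hx, hy, smul_add]; abel
  | hs q b hb =>
  have hmem : ∀ j : ℕ, mode j h b ∈ liF V (q - j) := fun j => by
    by_cases hk : q - j = 0
    · exact mem_liF_of_eq_zero hk _
    · exact mode_mem (p := 0) (q := q) (by simp only [LiBound]; omega) hh hb
  rw [grT_grSymb hb]
  rcases lt_or_ge (q + 1) n with hn | hn
  · rw [grProd_grSymb_of_lt (by omega) hh (T_mem hb), grProd_grSymb_of_lt (by omega) hh hb,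
      grProd_grSymb_of_lt (by omega) hh hb]
    simp
  rw [grProd_grSymb (by omega) hh (T_mem hb)]
  have e := T_mode h b n
  rw [eq_comm, sub_eq_iff_eq_add] at e
  rcases n with _ | n
  · rw [grProd_grSymb (by omega) hh hb, grT_grSymb (by simpa using hmem 0)]
    simp only [Nat.cast_zero, zero_smul, add_zero] at e ⊢
    rw [e]
    rfl
  · rw [grProd_grSymb (n := n + 1 - 1) (by omega) hh hb]
    have m1 : ((n + 1 : ℕ) : ℤ) • mode (((n + 1 : ℕ) : ℤ) - 1) h b ∈
        liF V (0 + (q + 1) - (n + 1)) := by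
      rw [show ((n + 1 : ℕ) : ℤ) - 1 = n by push_cast; ring]
      have := hmem n
      rw [show q - n = 0 + (q + 1) - (n + 1) by omega] at this
      exact zsmul_mem this _
    have m2 : T (mode (n + 1 : ℕ) h b) ∈ liF V (0 + (q + 1) - (n + 1)) := by
      rcases le_or_gt (n + 1) q with hq | hq
      · have := T_mem (hmem (n + 1))
        rwa [show q - (n + 1) + 1 = 0 + (q + 1) - (n + 1) by omega] at this
      · exact mem_liF_of_eq_zero (by omega) _
    rw [e, grSymb_add m2 m1]
    congr 1
    · rcases le_or_gt (n + 1) q with hq | hq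
      · rw [grProd_grSymb (by omega) hh hb, grT_grSymb (by simpa using hmem (n + 1))]
        congr 1
        omega
      · rw [grProd_grSymb_of_lt (by omega) hh hb, map_zero]
        refine grSymb_eq_zero ?_
        have := T_mem (mem_liF_of_eq_zero (p := 0) rfl (mode (n + 1 : ℕ) h b))
        rwa [show 0 + 1 = 0 + (q + 1) - (n + 1) + 1 by omega] at this
    · rw [← Int.cast_smul_eq_zsmul ℂ, grSymb_smul]
      · rw [Int.cast_natCast, Nat.cast_smul_eq_nsmul, show ((n + 1 : ℕ) : ℤ) - 1 = n by push_cast; ring]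
        congr 2
        omega
      · have := hmem n
        rwa [show q - n = 0 + (q + 1) - (n + 1) by omega,
          show ((n : ℕ) : ℤ) = ((n + 1 : ℕ) : ℤ) - 1 by push_cast; ring] at this

theorem grHam_zhuToGr_zero (h b : ZhuC2 V) :
    grHam 0 h (zhuToGr V b) = zhuToGr V (zhuBracket h b) := by
  obtain ⟨h, rfl⟩ := zhuMk_surjective h
  obtain ⟨b, rfl⟩ := zhuMk_surjective b
  rw [zhuBracket, zhuOp_mk, grHam_apply]
  simp only [zhuToGr_mk]
  rw [grProd_grSymb (by omega) (mem_liF_of_eq_zero rfl h) (mem_liF_of_eq_zero rfl b)]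
  rfl

theorem grHam_zhuToGr_of_pos {n : ℕ} (hn : 0 < n) (h b : ZhuC2 V) :
    grHam n h (zhuToGr V b) = 0 := by
  obtain ⟨h, rfl⟩ := zhuMk_surjective h
  obtain ⟨b, rfl⟩ := zhuMk_surjective b
  rw [grHam_apply]
  simp only [zhuToGr_mk]
  exact grProd_grSymb_of_lt (by omega) (mem_liF_of_eq_zero rfl h) (mem_liF_of_eq_zero rfl b)

theorem grProd_grT (n : ℕ) (a x : Gr V) :
    grProd n (grT V a) x = -((n : ℂ) • grProd (n - 1) a x) := by
  induction a using gr_induction with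
  | h0 => simp
  | ha a b ha hb => simp only [map_add, LinearMap.add_apply, ha, hb, smul_add]; abel
  | hs p a ha =>
  induction x using gr_induction with
  | h0 => simp
  | ha x y hx hy => simp only [map_add, hx, hy, smul_add]; abel
  | hs q b hb =>
  rw [grT_grSymb ha]
  rcases n with _ | n
  · rw [grProd_grSymb (by omega) (T_mem ha) hb, mode_T]
    simp [grSymb_zero]
  · rcases lt_or_ge (p + q) n with hn | hn
    · rw [grProd_grSymb_of_lt (by omega) (T_mem ha) hb, grProd_grSymb_of_lt (by omega) ha hb]
      simp
    · have hm : mode n a b ∈ liF V (p + q - n) :=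
        mode_mem (p := p) (q := q) (by simp only [LiBound]; omega) ha hb
      rw [grProd_grSymb (by omega) (T_mem ha) hb, grProd_grSymb (n := n + 1 - 1) (by omega) ha hb,
        mode_T, show p + 1 + q - (n + 1) = p + q - n by omega, ← Int.cast_smul_eq_zsmul ℂ,
        show ((n + 1 : ℕ) : ℤ) - 1 = n by push_cast; ring, grSymb_smul hm, Nat.add_sub_cancel]
      push_cast
      rw [← neg_smul]

/-- The symbol of the iterate formula for `(a_(-1) b)_(n)`. Both of its sums run up to `n + J`, but
in the second the first `n` terms carry a nonnegative mode of `b` and are of lower order; the shift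
by `n` of the others explains the two ranges. The bound has to hold for all large `J` so that the
finitely many bounds met in the induction can be combined. -/
theorem grProd_mul_left (n : ℕ) (a b x : Gr V) : ∃ J₀ : ℕ, ∀ J, J₀ ≤ J → grProd n (a * b) x =
    ∑ j ∈ Finset.range (n + J), (j.factorial : ℂ)⁻¹ • ((grT V)^[j] a * grProd (n + j) b x) +
      ∑ j ∈ Finset.range J, (j.factorial : ℂ)⁻¹ • ((grT V)^[j] b * grProd (n + j) a x) := by
  have hTa : ∀ (j : ℕ) (a b : Gr V), (grT V)^[j] (a + b) = (grT V)^[j] a + (grT V)^[j] b :=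
    fun j a b => iterate_map_add (grT V) j a b
  have hT0 : ∀ (j : ℕ), (grT V)^[j] 0 = 0 := fun j => iterate_map_zero (grT V) j
  induction a using gr_induction with
  | h0 => exact ⟨0, fun J _ => by simp [hT0]⟩
  | ha a a' h h' =>
    obtain ⟨J₁, h⟩ := h
    obtain ⟨J₂, h'⟩ := h'
    refine ⟨J₁ + J₂, fun J hJ => ?_⟩
    rw [add_mul, map_add, LinearMap.add_apply, h J (by omega), h' J (by omega)]
    simp only [hTa, map_add, LinearMap.add_apply, add_mul, mul_add, smul_add,
      Finset.sum_add_distrib]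
    abel
  | hs p a ha =>
  induction b using gr_induction with
  | h0 => exact ⟨0, fun J _ => by simp [hT0]⟩
  | ha b b' h h' =>
    obtain ⟨J₁, h⟩ := h
    obtain ⟨J₂, h'⟩ := h'
    refine ⟨J₁ + J₂, fun J hJ => ?_⟩
    rw [mul_add, map_add, LinearMap.add_apply, h J (by omega), h' J (by omega)]
    simp only [hTa, map_add, LinearMap.add_apply, add_mul, mul_add, smul_add,
      Finset.sum_add_distrib]
    abel
  | hs q b hb =>
  induction x using gr_induction with
  | h0 => exact ⟨0, fun J _ => by simp⟩
  | ha x x' h h' =>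
    obtain ⟨J₁, h⟩ := h
    obtain ⟨J₂, h'⟩ := h'
    refine ⟨J₁ + J₂, fun J hJ => ?_⟩
    rw [map_add, h J (by omega), h' J (by omega)]
    simp only [map_add, mul_add, smul_add, Finset.sum_add_distrib]
    abel
  | hs r c hc =>
  have hab := mode_mem (liBound_mul p q) ha hb
  rw [grSymb_mul ha hb]
  rcases lt_or_ge (p + q + r) n with hn | hn
  · refine ⟨0, fun J _ => ?_⟩
    rw [grProd_grSymb_of_lt (by omega) hab hc, Finset.sum_eq_zero, Finset.sum_eq_zero, add_zero]
    · intro j _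
      rw [grProd_grSymb_of_lt (by omega) ha hc, mul_zero, smul_zero]
    · intro j _
      rw [grProd_grSymb_of_lt (by omega) hb hc, mul_zero, smul_zero]
  have hmem : ∀ {p q : ℕ} {a b : V}, a ∈ liF V p → b ∈ liF V q → ∀ j : ℕ,
      mode j a b ∈ liF V (p + q - j) := by
    intro p q a b ha hb j
    by_cases hk : p + q - j = 0
    · exact mem_liF_of_eq_zero hk _
    · exact mode_mem (p := p) (q := q) (by simp only [LiBound]; omega) ha hb
  have main : ∀ {p q : ℕ} {a b : V}, n ≤ p + q + r → a ∈ liF V p → b ∈ liF V q → ∀ j : ℕ,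
      mode (-(j : ℤ) - 1) a (mode (n + j : ℕ) b c) ∈ liF V (p + q + r - n) ∧
      grSymb (p + q + r - n) (mode (-(j : ℤ) - 1) a (mode (n + j : ℕ) b c)) =
        (j.factorial : ℂ)⁻¹ • ((grT V)^[j] (grSymb p a) * grProd (n + j) (grSymb q b) (grSymb r c)) := by
    intro p q a b hn ha hb j
    have hmb := hmem hb hc (n + j)
    have hm : mode (-1) (T^[j] a) (mode (n + j : ℕ) b c) ∈ liF V (p + q + r - n) :=
      mode_mem (p := p + j) (q := q + r - (n + j)) (by simp only [LiBound]; omega)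
        (T_iterate_mem ha j) hmb
    rw [mode_neg_eq, grSymb_smul hm, grT_iterate_grSymb ha]
    refine ⟨Submodule.smul_mem _ _ hm, ?_⟩
    congr 1
    rcases le_or_gt (n + j) (q + r) with h | h
    · rw [grProd_grSymb h hb hc, grSymb_mul (T_iterate_mem ha j) hmb]
      congr 1
      omega
    · rw [grProd_grSymb_of_lt h hb hc, mul_zero]
      exact grSymb_eq_zero (mode_mem (p := p + j) (q := 0) (by simp only [LiBound]; omega)
        (T_iterate_mem ha j) (mem_liF_of_eq_zero rfl _))
  obtain ⟨J₀, hJ⟩ := iterate_formula a b c (-1) n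
  refine ⟨J₀, fun J hJ' => ?_⟩
  rw [grProd_grSymb hn hab hc, hJ (n + J) (by omega)]
  simp only [expCoeff_neg_one, one_smul, Int.negOnePow_neg, Int.negOnePow_one, Units.val_neg,
    Units.val_one, neg_smul, sub_neg_eq_add]
  have e1 : ∀ j : ℕ, mode (-1 - (j : ℤ)) a (mode ((n : ℤ) + j) b c) =
      mode (-(j : ℤ) - 1) a (mode (n + j : ℕ) b c) := by
    intro j
    congr 2
    ring_nf
  have e2 : ∀ j : ℕ, mode ((n : ℤ) + -1 - (n + j : ℕ)) b (mode (n + j : ℕ) a c) =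
      mode (-(j : ℤ) - 1) b (mode (n + j : ℕ) a c) := by
    intro j
    congr 2
    push_cast
    ring_nf
  have m1 : ∀ j ∈ Finset.range n, mode ((n : ℤ) + -1 - j) b (mode j a c) ∈
      liF V (p + q + r - n + 1) := by
    intro j hj
    rw [Finset.mem_range] at hj
    exact mode_mem (p := q) (q := p + r - j) (by simp only [LiBound]; omega) hb (hmem ha hc j)
  have hqp : q + p + r = p + q + r := by omega
  have main' := fun j => main (by omega) hb ha j
  rw [hqp] at main'
  rw [Finset.sum_range_add (fun j : ℕ => mode ((n : ℤ) + -1 - j) b (mode j a c)) n J]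
  simp only [e1, e2]
  rw [grSymb_add, grSymb_add, grSymb_eq_zero (Submodule.sum_mem _ m1), zero_add, grSymb_sum,
    grSymb_sum]
  · congr 1
    · exact Finset.sum_congr rfl fun j _ => (main hn ha hb j).2
    · exact Finset.sum_congr rfl fun j _ => (main' j).2
  · exact fun j _ => (main' j).1
  · exact fun j _ => (main hn ha hb j).1
  · exact liF_anti (Nat.le_succ _) (Submodule.sum_mem _ m1)
  · exact Submodule.sum_mem _ fun j _ => (main' j).1
  · exact Submodule.sum_mem _ fun j _ => (main hn ha hb j).1
  · exact add_mem (liF_anti (Nat.le_succ _) (Submodule.sum_mem _ m1))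
      (Submodule.sum_mem _ fun j _ => (main' j).1)

/-- An ideal stable under the operators `h_(n)`, `h ∈ R_V`, is chiral Poisson. -/
theorem isChiralPoisson_of_grHam {I : Ideal (Gr V)}
    (hI : ∀ (n : ℕ) (h : ZhuC2 V), ∀ x ∈ I, grHam n h x ∈ I) : IsChiralPoisson I := by
  have hX : ∀ (m : ℕ) (h : ZhuC2 V) (n : ℕ), ∀ x ∈ I, grProd n ((grT V)^[m] (zhuToGr V h)) x ∈ I := by
    intro m h
    induction m with
    | zero => exact fun n x hx => hI n h x hx
    | succ m ih =>
      intro n x hx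
      rw [Function.iterate_succ_apply', grProd_grT]
      exact neg_mem (Submodule.smul_of_tower_mem _ _ (ih _ x hx))
  suffices H : ∀ (f : MvPolynomial (ZhuC2 V × ℕ) ℂ) (n : ℕ), ∀ x ∈ I,
      grProd n (arcToGr V (Ideal.Quotient.mk _ f)) x ∈ I by
    intro n a x hx
    obtain ⟨f, rfl⟩ := arcToGr_surjective a
    obtain ⟨f, rfl⟩ := Ideal.Quotient.mk_surjective f
    exact H f n x hx
  intro f
  induction f using MvPolynomial.induction_on with
  | C c =>
    intro n x hx
    have e : arcToGr V (Ideal.Quotient.mk _ (MvPolynomial.C c)) = c • zhuToGr V 1 := by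
      rw [map_one, ← Algebra.algebraMap_eq_smul_one]
      exact (arcToGr V).commutes c
    rw [e, map_smul, LinearMap.smul_apply]
    exact Submodule.smul_of_tower_mem _ _ (hI n 1 x hx)
  | add f g hf hg =>
    intro n x hx
    rw [map_add, map_add, map_add, LinearMap.add_apply]
    exact add_mem (hf n x hx) (hg n x hx)
  | mul_X f y hf =>
    intro n x hx
    obtain ⟨h, m⟩ := y
    rw [map_mul, map_mul, arcToGr_mk_X]
    obtain ⟨J₀, hJ⟩ := grProd_mul_left n (arcToGr V (Ideal.Quotient.mk _ f))
      ((grT V)^[m] (zhuToGr V h)) x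
    rw [hJ J₀ le_rfl]
    refine add_mem (Submodule.sum_mem _ fun j _ => ?_) (Submodule.sum_mem _ fun j _ => ?_)
    · exact Submodule.smul_of_tower_mem _ _ (Ideal.mul_mem_left _ _ (hX m h _ x hx))
    · exact Submodule.smul_of_tower_mem _ _ (Ideal.mul_mem_left _ _ (hf _ x hx))

/-! ### The projection to degree zero and the Poisson structure of `R_V` -/

/-- The degree zero component, on homogeneous components. -/
noncomputable def grToZhuPiece : ∀ p : ℕ, GrPiece V p →ₗ[ℂ] ZhuC2 V
  | 0 => grLift (zhuMk ∘ₗ (liF V 0).subtype) fun _ ha => zhuMk_eq_zero ha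
  | _ + 1 => 0

variable (V) in
/-- The projection of `gr V` to its component of degree zero. -/
noncomputable def grToZhu : Gr V →ₐ[ℂ] ZhuC2 V :=
  DirectSum.toAlgebra ℂ (GrPiece V) grToZhuPiece rfl (by
    intro p q x y
    obtain ⟨a, rfl⟩ := symb_surjective p x
    obtain ⟨b, rfl⟩ := symb_surjective q y
    rcases p with _ | p
    · rcases q with _ | q
      · rfl
      · change (0 : _ →ₗ[ℂ] ZhuC2 V) _ = _ * (0 : _ →ₗ[ℂ] ZhuC2 V) _
        simp
    · have : ∀ (r : ℕ) (hr : r ≠ 0) (z : GrPiece V r), grToZhuPiece r z = 0 := by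
        intro r hr z
        obtain ⟨r, rfl⟩ := Nat.exists_eq_succ_of_ne_zero hr
        rfl
      rw [this _ (by omega)]
      change _ = (0 : _ →ₗ[ℂ] ZhuC2 V) _ * _
      simp)

theorem grToZhu_grSymb_zero (a : V) : grToZhu V (grSymb 0 a) = zhuMk a := by
  rw [grSymb_of_mem (mem_liF_of_eq_zero rfl a), ← DirectSum.lof_eq_of ℂ]
  exact DirectSum.toModule_lof ℂ _ _

theorem grToZhu_grSymb_succ (p : ℕ) (a : V) : grToZhu V (grSymb (p + 1) a) = 0 := by
  by_cases ha : a ∈ liF V (p + 1)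
  · rw [grSymb_of_mem ha, ← DirectSum.lof_eq_of ℂ]
    exact DirectSum.toModule_lof ℂ _ _
  · rw [grSymb, dif_neg ha, map_zero]

theorem grToZhu_zhuToGr (a : ZhuC2 V) : grToZhu V (zhuToGr V a) = a := by
  obtain ⟨a, rfl⟩ := zhuMk_surjective a
  rw [zhuToGr_mk, grToZhu_grSymb_zero]

theorem grToZhu_grT (x : Gr V) : grToZhu V (grT V x) = 0 := by
  induction x using gr_induction with
  | h0 => simp
  | ha x y hx hy => rw [map_add, map_add, hx, hy, add_zero]
  | hs p v hv => rw [grT_grSymb hv, grToZhu_grSymb_succ]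

/-- The Leibniz rule of `gr V` for the zero mode, seen through the retraction `grToZhu` onto degree
zero. -/
theorem zhuBracket_mul (h x y : ZhuC2 V) :
    zhuBracket h (x * y) = x • zhuBracket h y + y • zhuBracket h x := by
  have := congrArg (grToZhu V) (grProd_zhu_mul 0 h (zhuToGr V x) (zhuToGr V y))
  simpa only [← grHam_apply, ← map_mul, grHam_zhuToGr_zero, map_add, smul_eq_mul,
    grToZhu_zhuToGr] using this

variable (V) in
/-- The Hamiltonian derivations `{h, ·}` of `R_V`. -/
noncomputable def zhuHam : ZhuC2 V →ₗ[ℂ] Derivation ℂ (ZhuC2 V) (ZhuC2 V) where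
  toFun h := Derivation.mk' (zhuBracket h) (zhuBracket_mul h)
  map_add' x y := by ext z; simp
  map_smul' c x := by ext z; simp

theorem zhuHam_apply (h f : ZhuC2 V) : zhuHam V h f = zhuBracket h f := rfl

/-- The Jacobi identity, in the form in which the charts use it. In the commutator formula for two
zero modes only the term `j = 0` has a nonzero coefficient. -/
theorem zhuHam_lie (a b : ZhuC2 V) : zhuHam V (zhuHam V a b) = ⁅zhuHam V a, zhuHam V b⁆ := by
  ext c
  obtain ⟨a, rfl⟩ := zhuMk_surjective a
  obtain ⟨b, rfl⟩ := zhuMk_surjective b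
  obtain ⟨c, rfl⟩ := zhuMk_surjective c
  rw [Derivation.commutator_apply]
  simp only [zhuHam_apply, zhuBracket, zhuOp_mk]
  rw [← map_sub]
  obtain ⟨J₀, hJ⟩ := commutator_formula a b
  rw [hJ c 0 0 (J₀ + 1) (by omega), Finset.sum_range_succ', Finset.sum_eq_zero]
  · simp
  · intro j _
    simp [Ring.choose_zero_succ]

end VertexAlgebra

/-! ### Derivations -/

section DerivationTools

open TrivSqZeroExt

variable {A : Type*} [CommRing A] [Algebra ℂ A]

/-- A section of the algebra of dual numbers over `A` is a derivation of `A`. -/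
def derivationOfSection (g : A →ₐ[ℂ] TrivSqZeroExt A A) (hg : ∀ a, (g a).fst = a) :
    Derivation ℂ A A :=
  Derivation.mk' ((sndHom A A).restrictScalars ℂ ∘ₗ g.toLinearMap) fun a b => by
    change (g (a * b)).snd = _
    rw [map_mul, snd_mul, hg, hg, op_smul_eq_smul]
    rfl

/-- A derivation along an algebra homomorphism, as a homomorphism to the dual numbers. -/
def sectionOfDerivation {B : Type*} [CommRing B] [Algebra ℂ B] (φ : B →ₐ[ℂ] A)
    (δ : B →ₗ[ℂ] A) (hδ : ∀ a b, δ (a * b) = φ a * δ b + φ b * δ a) :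
    B →ₐ[ℂ] TrivSqZeroExt A A :=
  AlgHom.ofLinearMap
    { toFun := fun b => inl (φ b) + inr (δ b)
      map_add' := fun a b => by ext <;> simp
      map_smul' := fun c a => by ext <;> simp }
    (by
      have h := hδ 1 1
      simp only [mul_one, map_one, one_mul] at h
      have h1 : δ 1 = 0 := by linear_combination -h
      ext <;> simp [h1])
    (by
      intro a b
      ext
      · simp
      · simp [hδ, mul_comm])

theorem fst_sectionOfDerivation {B : Type*} [CommRing B] [Algebra ℂ B] (φ : B →ₐ[ℂ] A)
    (δ : B →ₗ[ℂ] A) (hδ) (b : B) : (sectionOfDerivation φ δ hδ b).fst = φ b := by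
  change (inl (φ b) + inr (δ b) : TrivSqZeroExt A A).fst = _
  simp

theorem snd_sectionOfDerivation {B : Type*} [CommRing B] [Algebra ℂ B] (φ : B →ₐ[ℂ] A)
    (δ : B →ₗ[ℂ] A) (hδ) (b : B) : (sectionOfDerivation φ δ hδ b).snd = δ b := by
  change (inl (φ b) + inr (δ b) : TrivSqZeroExt A A).snd = _
  simp

/-- The derivation induced on the image of a surjective homomorphism. -/
noncomputable def derivationOfSurjective {B : Type*} [CommRing B] [Algebra ℂ B] (π : B →ₐ[ℂ] A)
    (D : Derivation ℂ B B) (hπ : Function.Surjective π) (hD : ∀ b, π b = 0 → π (D b) = 0) :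
    Derivation ℂ A A :=
  have key : ∀ b, π (D (Function.surjInv hπ (π b))) = π (D b) := fun b => by
    rw [← sub_eq_zero, ← map_sub, ← map_sub]
    apply hD
    rw [map_sub, Function.surjInv_eq hπ, sub_self]
  Derivation.mk'
    { toFun := fun a => π (D (Function.surjInv hπ a))
      map_add' := fun a b => by
        obtain ⟨a, rfl⟩ := hπ a
        obtain ⟨b, rfl⟩ := hπ b
        rw [← map_add, key, key, key, map_add, map_add]
      map_smul' := fun c a => by
        obtain ⟨a, rfl⟩ := hπ a
        rw [← map_smul, key, key, D.map_smul, map_smul, RingHom.id_apply] } fun a b => by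
      change π (D (Function.surjInv hπ (a * b))) = a * π (D (Function.surjInv hπ b)) +
        b * π (D (Function.surjInv hπ a))
      obtain ⟨a, rfl⟩ := hπ a
      obtain ⟨b, rfl⟩ := hπ b
      rw [← map_mul, key, key, key, Derivation.leibniz, map_add, smul_eq_mul, smul_eq_mul, map_mul,
        map_mul]

theorem derivationOfSurjective_apply {B : Type*} [CommRing B] [Algebra ℂ B] (π : B →ₐ[ℂ] A)
    (D : Derivation ℂ B B) (hπ : Function.Surjective π) (hD : ∀ b, π b = 0 → π (D b) = 0) (b : B) :
    derivationOfSurjective π D hπ hD (π b) = π (D b) := by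
  change π (D (Function.surjInv hπ (π b))) = π (D b)
  rw [← sub_eq_zero, ← map_sub, ← map_sub]
  apply hD
  rw [map_sub, Function.surjInv_eq hπ, sub_self]

theorem Derivation.iterate_mul (D : Derivation ℂ A A) (n : ℕ) (f g : A) :
    D^[n] (f * g) = ∑ ij ∈ Finset.HasAntidiagonal.antidiagonal n, n.choose ij.1 • (D^[ij.1] f * D^[ij.2] g) := by
  induction n with
  | zero => simp
  | succ n ih =>
    rw [Function.iterate_succ_apply', ih, map_sum,
      Finset.sum_antidiagonal_choose_succ_nsmul (fun i j => D^[i] f * D^[j] g) n,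
      ← Finset.sum_add_distrib]
    refine Finset.sum_congr rfl fun ij hij => ?_
    rw [← Finset.HasAntidiagonal.mem_antidiagonal.1 hij, Nat.choose_symm_add, map_nsmul, Derivation.leibniz,
      smul_add, Function.iterate_succ_apply', Function.iterate_succ_apply', smul_eq_mul, smul_eq_mul,
      mul_comm (D^[ij.2] g)]

theorem Derivation.iterate_mul_factorial (D : Derivation ℂ A A) (n : ℕ) (f g : A) :
    (n.factorial : ℂ)⁻¹ • D^[n] (f * g) = ∑ ij ∈ Finset.HasAntidiagonal.antidiagonal n,
      ((ij.1.factorial : ℂ)⁻¹ • D^[ij.1] f) * ((ij.2.factorial : ℂ)⁻¹ • D^[ij.2] g) := by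
  rw [D.iterate_mul, Finset.smul_sum]
  refine Finset.sum_congr rfl fun ij hij => ?_
  rw [← Finset.HasAntidiagonal.mem_antidiagonal.1 hij, smul_mul_smul_comm, ← Nat.cast_smul_eq_nsmul ℂ, smul_smul]
  congr 1
  have h1 : (ij.1.factorial : ℂ) ≠ 0 := by exact_mod_cast ij.1.factorial_ne_zero
  have h2 : (ij.2.factorial : ℂ) ≠ 0 := by exact_mod_cast ij.2.factorial_ne_zero
  have h3 : ((ij.1 + ij.2).factorial : ℂ) ≠ 0 := by exact_mod_cast (ij.1 + ij.2).factorial_ne_zero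
  have h4 : ((ij.1 + ij.2).choose ij.1 : ℂ) * ij.1.factorial * ij.2.factorial =
      (ij.1 + ij.2).factorial := by
    rw [Nat.choose_symm_add]
    exact_mod_cast (Nat.add_choose_mul_factorial_mul_factorial ij.1 ij.2)
  field_simp
  linear_combination h4

theorem Derivation.iterate_add (D : Derivation ℂ A A) (n : ℕ) (f g : A) :
    D^[n] (f + g) = D^[n] f + D^[n] g := iterate_map_add D n f g

theorem Derivation.iterate_smul (D : Derivation ℂ A A) (n : ℕ) (c : ℂ) (f : A) :
    D^[n] (c • f) = c • D^[n] f := by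
  induction n with
  | zero => rfl
  | succ n ih => rw [Function.iterate_succ_apply', Function.iterate_succ_apply', ih, map_smul]

theorem Derivation.iterate_one (D : Derivation ℂ A A) {n : ℕ} (hn : n ≠ 0) :
    D^[n] (1 : A) = 0 := by
  obtain ⟨n, rfl⟩ := Nat.exists_eq_succ_of_ne_zero hn
  rw [Function.iterate_succ_apply, D.map_one_eq_zero]
  exact iterate_map_zero D n

/-- The homomorphism `f ↦ ∑ ψ(Dⁿ f) tⁿ / n!`. -/
noncomputable def taylorHom {k : Type*} [CommRing k] [Algebra ℂ k] (D : Derivation ℂ A A)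
    (ψ : A →ₐ[ℂ] k) : A →ₐ[ℂ] PowerSeries k :=
  AlgHom.ofLinearMap
    { toFun := fun f => PowerSeries.mk fun n => ψ ((n.factorial : ℂ)⁻¹ • D^[n] f)
      map_add' := fun f g => by ext n; simp [D.iterate_add]
      map_smul' := fun c f => by
        ext n
        rw [RingHom.id_apply, PowerSeries.coeff_smul, PowerSeries.coeff_mk, PowerSeries.coeff_mk,
          D.iterate_smul, smul_comm, map_smul] }
    (by
      ext n
      change PowerSeries.coeff n (PowerSeries.mk fun n => ψ ((n.factorial : ℂ)⁻¹ • D^[n] 1)) = _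
      rw [PowerSeries.coeff_mk, PowerSeries.coeff_one]
      split_ifs with h
      · subst h; simp
      · rw [D.iterate_one h, smul_zero, map_zero])
    (by
      intro f g
      ext n
      change PowerSeries.coeff n (PowerSeries.mk fun n => ψ ((n.factorial : ℂ)⁻¹ • D^[n] (f * g))) =
        PowerSeries.coeff n ((PowerSeries.mk fun n => ψ ((n.factorial : ℂ)⁻¹ • D^[n] f)) *
          PowerSeries.mk fun n => ψ ((n.factorial : ℂ)⁻¹ • D^[n] g))
      rw [PowerSeries.coeff_mk, PowerSeries.coeff_mul, D.iterate_mul_factorial, map_sum]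
      simp only [PowerSeries.coeff_mk, map_mul])

theorem coeff_taylorHom {k : Type*} [CommRing k] [Algebra ℂ k] (D : Derivation ℂ A A)
    (ψ : A →ₐ[ℂ] k) (f : A) (n : ℕ) :
    PowerSeries.coeff n (taylorHom D ψ f) = ψ ((n.factorial : ℂ)⁻¹ • D^[n] f) := by
  change PowerSeries.coeff n (PowerSeries.mk fun n => ψ ((n.factorial : ℂ)⁻¹ • D^[n] f)) = _
  rw [PowerSeries.coeff_mk]

/-- `d/dt` as a `ℂ`-linear derivation. -/
noncomputable def powerSeriesD (k : Type*) [CommRing k] [Algebra ℂ k] :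
    Derivation ℂ (PowerSeries k) (PowerSeries k) :=
  (PowerSeries.derivative k).restrictScalars ℂ

/-- Taylor expansion turns a point of a differential algebra into an arc: `D` becomes `d/dt`, and
the point is recovered as the constant term. -/
theorem powerSeriesD_taylorHom {k : Type*} [CommRing k] [Algebra ℂ k] (D : Derivation ℂ A A)
    (ψ : A →ₐ[ℂ] k) (f : A) : powerSeriesD k (taylorHom D ψ f) = taylorHom D ψ (D f) := by
  ext n
  change PowerSeries.coeff n (PowerSeries.derivative k _) = _
  rw [PowerSeries.coeff_derivative, coeff_taylorHom, coeff_taylorHom, Function.iterate_succ_apply,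
    map_smul, map_smul, Nat.factorial_succ, Nat.cast_mul, mul_inv, mul_comm, mul_smul]
  have h : ((n : k) + 1) = algebraMap ℂ k (n + 1) := by simp
  have h' : ((n : ℂ) + 1) ≠ 0 := by exact_mod_cast n.succ_ne_zero
  rw [h, ← Algebra.smul_def, smul_smul]
  push_cast
  rw [mul_inv_cancel₀ h', one_smul]

theorem powerSeriesD_iterate_taylorHom {k : Type*} [CommRing k] [Algebra ℂ k]
    (D : Derivation ℂ A A) (ψ : A →ₐ[ℂ] k) (f : A) (n : ℕ) :
    (powerSeriesD k)^[n] (taylorHom D ψ f) = taylorHom D ψ (D^[n] f) := by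
  induction n with
  | zero => rfl
  | succ n ih =>
    rw [Function.iterate_succ_apply', ih, powerSeriesD_taylorHom, Function.iterate_succ_apply']

theorem constantCoeff_taylorHom {k : Type*} [CommRing k] [Algebra ℂ k] (D : Derivation ℂ A A)
    (ψ : A →ₐ[ℂ] k) (f : A) : PowerSeries.coeff 0 (taylorHom D ψ f) = ψ f := by
  rw [coeff_taylorHom]
  simp

end DerivationTools

/-! ### The arc algebra as a differential algebra -/

section ArcTools

open MvPolynomial

variable (R : Type*) [CommRing R] [Algebra ℂ R]

theorem arcT_mem {f : MvPolynomial (R × ℕ) ℂ} (hf : f ∈ arcIdeal R) : arcT R f ∈ arcIdeal R := by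
  rw [arcIdeal] at hf
  induction hf using Submodule.span_induction with
  | mem x hx =>
    obtain ⟨f, j, hf, rfl⟩ := hx
    rw [← Function.iterate_succ_apply' (arcT R)]
    exact Ideal.subset_span ⟨f, j + 1, hf, rfl⟩
  | zero => rw [map_zero]; exact zero_mem _
  | add x y _ _ hx hy => rw [map_add]; exact add_mem hx hy
  | smul r x hx hx' =>
    rw [smul_eq_mul, Derivation.leibniz]
    exact add_mem (Ideal.mul_mem_left _ _ hx') (Ideal.mul_mem_right _ _ hx)

/-- The derivation of `J_∞ R`. -/
noncomputable def arcD : Derivation ℂ (ArcAlgebra R) (ArcAlgebra R) :=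
  derivationOfSurjective (Ideal.Quotient.mkₐ ℂ (arcIdeal R)) (arcT R)
    (Ideal.Quotient.mkₐ_surjective ℂ _) fun f hf => by
      exact Ideal.Quotient.eq_zero_iff_mem.2 (arcT_mem R (Ideal.Quotient.eq_zero_iff_mem.1 hf))

theorem arcD_mk (f : MvPolynomial (R × ℕ) ℂ) :
    arcD R (Ideal.Quotient.mk _ f) = Ideal.Quotient.mk _ (arcT R f) :=
  derivationOfSurjective_apply _ _ _ _ f

variable {R}

theorem arc_relation {f : MvPolynomial R ℂ} (hf : aeval (id : R → R) f = 0) :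
    Ideal.Quotient.mk (arcIdeal R) (rename (fun a => (a, 0)) f) = 0 :=
  Ideal.Quotient.eq_zero_iff_mem.2 (Ideal.subset_span ⟨f, 0, hf, rfl⟩)

variable (R) in
/-- The homomorphism `R → J_∞ R`. -/
noncomputable def arcOf : R →ₐ[ℂ] ArcAlgebra R :=
  AlgHom.ofLinearMap
    { toFun := fun a => Ideal.Quotient.mk _ (X (a, 0))
      map_add' := fun a b => by
        have := arc_relation (f := X (a + b) - X a - X b) (by simp)
        simpa [sub_sub, sub_eq_zero] using this
      map_smul' := fun c a => by
        have := arc_relation (f := X (c • a) - c • X a) (by simp)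
        rw [map_sub, map_sub, map_smul, sub_eq_zero, rename_X, rename_X] at this
        exact this }
    (by
      have := arc_relation (f := X (1 : R) - 1) (by simp)
      change Ideal.Quotient.mk _ _ = 1
      simpa [sub_eq_zero] using this)
    (by
      intro a b
      have := arc_relation (f := X (a * b) - X a * X b) (by simp)
      change Ideal.Quotient.mk _ _ = Ideal.Quotient.mk _ _ * Ideal.Quotient.mk _ _
      simpa [sub_eq_zero] using this)

theorem arcD_iterate_arcOf (a : R) (n : ℕ) :
    (arcD R)^[n] (arcOf R a) = Ideal.Quotient.mk _ (X (a, n)) := by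
  induction n with
  | zero => rfl
  | succ n ih =>
    rw [Function.iterate_succ_apply', ih, arcD_mk, arcT, mkDerivation_X]

theorem arcLift_mk_X {A : Type*} [CommRing A] [Algebra ℂ A] (f : R →ₐ[ℂ] A)
    (d : Derivation ℂ A A) (a : R) (n : ℕ) :
    arcLift f d (Ideal.Quotient.mk _ (X (a, n))) = d^[n] (f a) := by
  change aeval _ _ = _
  rw [aeval_X]

theorem arcAlgebra_hom_ext {A : Type*} [CommRing A] [Algebra ℂ A] {f g : ArcAlgebra R →ₐ[ℂ] A}
    (h : ∀ a n, f (Ideal.Quotient.mk _ (X (a, n))) = g (Ideal.Quotient.mk _ (X (a, n)))) :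
    f = g := by
  apply Ideal.Quotient.algHom_ext
  apply MvPolynomial.algHom_ext
  rintro ⟨a, n⟩
  exact h a n

theorem arcMap_mk_X {S : Type*} [CommRing S] [Algebra ℂ S] (φ : R →ₐ[ℂ] S) (a : R) (n : ℕ) :
    arcMap φ (Ideal.Quotient.mk _ (X (a, n))) = Ideal.Quotient.mk _ (X (φ a, n)) := by
  change Ideal.Quotient.mk _ (rename _ _) = _
  rw [rename_X]
  rfl

theorem arcMap_surjective {S : Type*} [CommRing S] [Algebra ℂ S] {φ : R →ₐ[ℂ] S}
    (hφ : Function.Surjective φ) : Function.Surjective (arcMap φ) := by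
  rw [← AlgHom.range_eq_top, eq_top_iff]
  rintro x -
  obtain ⟨f, rfl⟩ := Ideal.Quotient.mk_surjective x
  induction f using MvPolynomial.induction_on with
  | C c => exact ⟨algebraMap ℂ _ c, (arcMap φ).commutes c⟩
  | add f g hf hg => rw [map_add]; exact add_mem hf hg
  | mul_X f y hf =>
    rw [map_mul]
    refine mul_mem hf ?_
    obtain ⟨s, n⟩ := y
    obtain ⟨a, rfl⟩ := hφ s
    exact ⟨_, arcMap_mk_X φ a n⟩

/-- Points of `J_∞ R` are points of `J_∞ (R / √0)`. -/
theorem eq_zero_of_arcMap_nilradical {k : Type*} [CommRing k] [Algebra ℂ k] [IsDomain k]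
    (ψ : ArcAlgebra R →ₐ[ℂ] k) {f : ArcAlgebra R}
    (hf : arcMap (Ideal.Quotient.mkₐ ℂ (nilradical R)) f = 0) : ψ f = 0 := by
  -- The arc through `ψ` takes values in the domain `k[[t]]`, so it kills nilpotents and factors
  -- through `R / √0`; by the universal property so does the whole Taylor homomorphism, and `ψ` is
  -- its constant term.
  have hα : ∀ a ∈ nilradical R, (taylorHom (arcD R) ψ).comp (arcOf R) a = 0 := by
    intro a ha
    obtain ⟨n, hn⟩ := mem_nilradical.1 ha
    apply pow_eq_zero_iff (n := n + 1) (by omega) |>.1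
    rw [← map_pow, pow_succ, hn, zero_mul, map_zero]
  have e : (arcLift (Ideal.Quotient.liftₐ (nilradical R) _ hα) (powerSeriesD _)).comp
      (arcMap (Ideal.Quotient.mkₐ ℂ (nilradical R))) = taylorHom (arcD R) ψ := by
    apply arcAlgebra_hom_ext
    intro a n
    rw [AlgHom.comp_apply, arcMap_mk_X, arcLift_mk_X, ← arcD_iterate_arcOf,
      ← powerSeriesD_iterate_taylorHom]
    rfl
  rw [← constantCoeff_taylorHom (arcD R), ← e, AlgHom.comp_apply, hf, map_zero, map_zero]

theorem ker_arcMap_nilradical_le (y : Ideal (ArcAlgebra R)) [hy : y.IsPrime] :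
    RingHom.ker (arcMap (Ideal.Quotient.mkₐ ℂ (nilradical R))) ≤ y := by
  intro f hf
  rw [← Ideal.Quotient.eq_zero_iff_mem]
  exact eq_zero_of_arcMap_nilradical (k := ArcAlgebra R ⧸ y) (Ideal.Quotient.mkₐ ℂ y) hf

end ArcTools

/-- A surjective homomorphism whose kernel lies in all maximal ideals induces a homeomorphism of
maximal spectra. -/
theorem exists_homeomorph_maximalSpectrum {A B : Type*} [CommRing A] [CommRing B] [Algebra ℂ A]
    [Algebra ℂ B] (g : B →ₐ[ℂ] A) (hg : Function.Surjective g)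
    (hk : ∀ y : MaximalSpectrum B, RingHom.ker g ≤ y.asIdeal) :
    ∃ e : MaximalSpectrum A ≃ₜ MaximalSpectrum B, ∀ x, (e x).asIdeal = x.asIdeal.comap g := by
  let F : MaximalSpectrum A → MaximalSpectrum B := fun x =>
    ⟨x.asIdeal.comap g, have := x.isMaximal; Ideal.comap_isMaximal_of_surjective g hg⟩
  have hF : Function.Bijective F := by
    constructor
    · intro x x' h
      have := congrArg MaximalSpectrum.asIdeal h
      exact MaximalSpectrum.ext (Ideal.comap_injective_of_surjective g hg this)
    · intro y
      have hy := y.isMaximal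
      have e : (y.asIdeal.map g).comap g = y.asIdeal := by
        rw [Ideal.comap_map_of_surjective g hg, sup_eq_left]
        exact hk y
      have hm : (y.asIdeal.map g).IsMaximal := by
        refine (Ideal.map_eq_top_or_isMaximal_of_surjective (f := g) hg hy).resolve_left fun h => ?_
        rw [h, Ideal.comap_top] at e
        exact hy.ne_top e.symm
      exact ⟨⟨_, hm⟩, MaximalSpectrum.ext e⟩
  have hind : Topology.IsInducing F := by
    have h1 : Topology.IsInducing (MaximalSpectrum.toPrimeSpectrum (R := B)) := ⟨rfl⟩
    have h2 : Topology.IsInducing (MaximalSpectrum.toPrimeSpectrum (R := A)) := ⟨rfl⟩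
    rw [← h1.of_comp_iff]
    exact (PrimeSpectrum.isClosedEmbedding_comap_of_surjective A g.toRingHom hg).isInducing.comp h2
  exact ⟨(Equiv.ofBijective F hF).toHomeomorphOfIsInducing hind, fun _ => rfl⟩

/-! ### Poisson ideals -/

section PoissonIdeal

variable {R : Type*} [CommRing R] [Algebra ℂ R]

/-- The largest ideal contained in `p` that is stable under a derivation. -/
def derivationCore (D : Derivation ℂ R R) (p : Ideal R) : Ideal R where
  carrier := {f | ∀ i, D^[i] f ∈ p}
  zero_mem' := fun i => by rw [iterate_map_zero]; exact zero_mem _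
  add_mem' := fun ha hb i => by rw [D.iterate_add]; exact add_mem (ha i) (hb i)
  smul_mem' := fun c a ha i => by
    rw [smul_eq_mul, D.iterate_mul]
    exact Submodule.sum_mem _ fun ij _ => nsmul_mem (Ideal.mul_mem_left _ _ (ha _)) _

theorem derivationCore_le (D : Derivation ℂ R R) (p : Ideal R) : derivationCore D p ≤ p :=
  fun _ hf => hf 0

theorem le_derivationCore {D : Derivation ℂ R R} {n p : Ideal R} (hn : ∀ f ∈ n, D f ∈ n)
    (hnp : n ≤ p) : n ≤ derivationCore D p := by
  intro f hf i
  apply hnp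
  induction i with
  | zero => exact hf
  | succ i ih => rw [Function.iterate_succ_apply']; exact hn _ ih

theorem apply_mem_derivationCore {D : Derivation ℂ R R} {p : Ideal R} {f : R}
    (hf : f ∈ derivationCore D p) : D f ∈ derivationCore D p := by
  intro i
  have := hf (i + 1)
  rwa [Function.iterate_succ_apply] at this

/-- If `i` and `j` are minimal with `D^i f ∉ p` and `D^j g ∉ p`, then in `D^(i+j) (f g)` all terms
but `(i+j choose i) D^i f · D^j g` are in `p`. The binomial coefficient is invertible in
characteristic zero. -/
instance derivationCore_isPrime (D : Derivation ℂ R R) (p : Ideal R) [hp : p.IsPrime] :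
    (derivationCore D p).IsPrime := by
  classical
  refine ⟨fun h => hp.ne_top (top_le_iff.1 (h ▸ derivationCore_le D p)), ?_⟩
  intro f g hfg
  by_contra! hcon
  obtain ⟨hf, hg⟩ := hcon
  have hf' : ∃ i, D^[i] f ∉ p := by by_contra! h; exact hf h
  have hg' : ∃ i, D^[i] g ∉ p := by by_contra! h; exact hg h
  set i := Nat.find hf'
  set j := Nat.find hg'
  have h := hfg (i + j)
  rw [D.iterate_mul, Finset.sum_eq_add_sum_sdiff_singleton_of_mem (i := (i, j)) (by simp)] at h
  have h2 := (Submodule.add_mem_iff_left p ?_).1 h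
  · rw [← Nat.cast_smul_eq_nsmul ℂ] at h2
    have h3 : ((((i + j).choose i : ℕ) : ℂ)) ≠ 0 := by
      exact_mod_cast (Nat.choose_pos (Nat.le_add_right i j)).ne'
    have h4 := Submodule.smul_of_tower_mem p ((((i + j).choose i : ℕ) : ℂ))⁻¹ h2
    rw [smul_smul, inv_mul_cancel₀ h3, one_smul] at h4
    exact (hp.mem_or_mem h4).elim (Nat.find_spec hf') (Nat.find_spec hg')
  · refine Submodule.sum_mem _ fun kl hkl => nsmul_mem ?_ _
    simp only [Finset.mem_sdiff, Finset.HasAntidiagonal.mem_antidiagonal, Finset.mem_singleton] at hkl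
    rcases lt_or_ge kl.1 i with hi | hi
    · exact Ideal.mul_mem_right _ _ (not_not.1 (Nat.find_min hf' hi))
    · refine Ideal.mul_mem_left _ _ (not_not.1 (Nat.find_min hg' (m := kl.2) ?_))
      by_contra hj
      exact hkl.2 (Prod.ext (by simp; omega) (by simp; omega))

variable (X : R →ₗ[ℂ] Derivation ℂ R R)

/-- Ideals stable under all Hamiltonian derivations. -/
def IsPoissonIdeal (n : Ideal R) : Prop := ∀ h, ∀ f ∈ n, X h f ∈ n

/-- The largest Poisson ideal contained in an ideal. -/
def poissonCore (q : Ideal R) : Ideal R := sSup {n | IsPoissonIdeal X n ∧ n ≤ q}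

theorem poissonCore_le (q : Ideal R) : poissonCore X q ≤ q := sSup_le fun _ h => h.2

variable {X} in
theorem le_poissonCore {n q : Ideal R} (hn : IsPoissonIdeal X n) (h : n ≤ q) :
    n ≤ poissonCore X q := le_sSup ⟨hn, h⟩

theorem isPoissonIdeal_poissonCore (q : Ideal R) : IsPoissonIdeal X (poissonCore X q) := by
  intro h f hf
  rw [poissonCore, sSup_eq_iSup'] at hf
  induction hf using Submodule.iSup_induction' with
  | mem J x hx => exact le_poissonCore J.2.1 J.2.2 (J.2.1 h x hx)
  | zero => rw [map_zero]; exact zero_mem _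
  | add x y _ _ hx hy => rw [map_add]; exact add_mem hx hy

/-- Let `p ≤ q` be a minimal prime over the core. For each `h` the derivation core of `p` is a prime
between the Poisson core and `p`, so it equals `p` by minimality. Thus `p` is Poisson and coincides
with the core. -/
instance poissonCore_isPrime (q : Ideal R) [q.IsPrime] : (poissonCore X q).IsPrime := by
  obtain ⟨p, hp, hpq⟩ := Ideal.exists_minimalPrimes_le (poissonCore_le X q)
  have hp' : p.IsPrime := hp.1.1
  have hP : IsPoissonIdeal X p := by
    intro h f hf
    have h1 : poissonCore X q ≤ derivationCore (X h) p :=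
      le_derivationCore (isPoissonIdeal_poissonCore X q h) hp.1.2
    have h2 := hp.2 ⟨derivationCore_isPrime (X h) p, h1⟩ (derivationCore_le _ _)
    exact derivationCore_le _ _ (apply_mem_derivationCore (h2 hf))
  rwa [le_antisymm (poissonCore_le X q |> fun _ => hp.1.2) (le_poissonCore hP hpq)]

end PoissonIdeal

/-! ### Minors of the Poisson tensor -/

theorem Derivation.leibniz_finset_prod {A ι : Type*} [CommRing A] [Algebra ℂ A] [DecidableEq ι]
    (D : Derivation ℂ A A) (s : Finset ι) (f : ι → A) :
    D (∏ i ∈ s, f i) = ∑ i ∈ s, (∏ j ∈ s.erase i, f j) * D (f i) := by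
  induction s using Finset.induction_on with
  | empty => simp
  | insert a s ha ih =>
    rw [Finset.prod_insert ha, D.leibniz, ih, Finset.sum_insert ha, Finset.erase_insert ha,
      smul_eq_mul, smul_eq_mul, Finset.mul_sum, add_comm]
    congr 1
    refine Finset.sum_congr rfl fun i hi => ?_
    have hia : a ≠ i := fun h => ha (h ▸ hi)
    rw [Finset.erase_insert_of_ne hia, Finset.prod_insert (fun h => ha (Finset.mem_of_mem_erase h)),
      mul_assoc]

theorem Derivation.map_det {A n : Type*} [CommRing A] [Algebra ℂ A] [DecidableEq n] [Fintype n]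
    (D : Derivation ℂ A A) (M : Matrix n n A) :
    D M.det = ∑ i, (M.updateCol i fun k => D (M k i)).det := by
  simp only [Matrix.det_apply']
  rw [map_sum, Finset.sum_comm]
  refine Finset.sum_congr rfl fun σ _ => ?_
  rw [D.leibniz, D.map_intCast, smul_zero, add_zero, smul_eq_mul, D.leibniz_finset_prod,
    Finset.mul_sum]
  refine Finset.sum_congr rfl fun i _ => ?_
  rw [← Finset.prod_erase_mul _ _ (Finset.mem_univ i), Matrix.updateCol_self]
  congr 2
  refine Finset.prod_congr rfl fun j hj => ?_
  rw [Matrix.updateCol_ne (Finset.ne_of_mem_erase hj)]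

/-- Both sides are the trace of `adj M · N`, by Cramer's rule. The Jacobi identity splits the
derivative of a bracket matrix into a part natural for columns and a part natural for rows, and the
second has to be converted. -/
theorem Matrix.sum_det_updateCol_eq_sum_det_updateRow {A n : Type*} [CommRing A] [DecidableEq n]
    [Fintype n] (M N : Matrix n n A) :
    ∑ i, (M.updateCol i fun k => N k i).det = ∑ k, (M.updateRow k (N k)).det := by
  have h1 : ∀ (M N : Matrix n n A) (i : n), (M.updateCol i fun k => N k i).det =
      ∑ k, M.adjugate i k * N k i := by
    intro M N i
    rw [← Matrix.cramer_apply, Matrix.cramer_eq_adjugate_mulVec]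
    rfl
  have h2 : ∀ k, (M.updateRow k (N k)).det = ∑ i, M.adjugate i k * N k i := by
    intro k
    rw [← Matrix.det_transpose, ← Matrix.updateCol_transpose]
    have := h1 M.transpose N.transpose k
    rw [← Matrix.adjugate_transpose] at this
    exact this
  simp only [h1, h2]
  exact Finset.sum_comm

section Minors

variable {R : Type*} [CommRing R] [Algebra ℂ R] (X : R →ₗ[ℂ] Derivation ℂ R R)

/-- The matrix of brackets `{a_i, t_j}`. -/
def bracketMatrix {ρ : ℕ} (a t : Fin ρ → R) : Matrix (Fin ρ) (Fin ρ) R :=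
  Matrix.of fun i j => X (a i) (t j)

/-- The ideal of `ρ × ρ` minors of the Poisson tensor. -/
def minorIdeal (ρ : ℕ) : Ideal R :=
  Ideal.span {d | ∃ a t : Fin ρ → R, d = (bracketMatrix X a t).det}

variable {X}

theorem det_mem_minorIdeal {ρ : ℕ} (a t : Fin ρ → R) :
    (bracketMatrix X a t).det ∈ minorIdeal X ρ := Ideal.subset_span ⟨a, t, rfl⟩

/-- By Jacobi `{h, {a_k, t_i}} = {{h, a_k}, t_i} + {a_k, {h, t_i}}`. The first summand replaces one
`a_k` and the second one `t_i`, so the derivative of a minor is a sum of minors of the same size. -/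
theorem isPoissonIdeal_minorIdeal (hX : ∀ a b, X (X a b) = ⁅X a, X b⁆) (ρ : ℕ) :
    IsPoissonIdeal X (minorIdeal X ρ) := by
  intro h f hf
  rw [minorIdeal] at hf
  induction hf using Submodule.span_induction with
  | mem x hx =>
    obtain ⟨a, t, rfl⟩ := hx
    have e : ∀ i k, X h (bracketMatrix X a t k i) = X (X h (a k)) (t i) + X (a k) (X h (t i)) := by
      intro i k
      rw [hX, Derivation.commutator_apply]
      exact (sub_add_cancel _ _).symm
    rw [Derivation.map_det]
    simp only [e]
    have e2 : ∀ i, ((bracketMatrix X a t).updateCol i fun k =>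
        X (X h (a k)) (t i) + X (a k) (X h (t i))).det =
        ((bracketMatrix X a t).updateCol i fun k => X (X h (a k)) (t i)).det +
        ((bracketMatrix X a t).updateCol i fun k => X (a k) (X h (t i))).det :=
      fun i => Matrix.det_updateCol_add _ _ _ _
    simp only [e2]
    rw [Finset.sum_add_distrib]
    refine add_mem ?_ (Submodule.sum_mem _ fun i _ => ?_)
    · have e3 := Matrix.sum_det_updateCol_eq_sum_det_updateRow (bracketMatrix X a t)
        (Matrix.of fun k i => X (X h (a k)) (t i))
      simp only [Matrix.of_apply] at e3
      rw [e3]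
      refine Submodule.sum_mem _ fun k _ => ?_
      convert det_mem_minorIdeal (X := X) (Function.update a k (X h (a k))) t using 2
      ext i j
      rw [Matrix.updateRow_apply]
      simp only [bracketMatrix, Matrix.of_apply, Function.update_apply]
      split_ifs <;> rfl
    · convert det_mem_minorIdeal (X := X) a (Function.update t i (X h (t i))) using 2
      ext k j
      rw [Matrix.updateCol_apply]
      simp only [bracketMatrix, Matrix.of_apply, Function.update_apply]
      split_ifs <;> rfl
  | zero => rw [map_zero]; exact zero_mem _
  | add x y _ _ hx hy => rw [map_add]; exact add_mem hx hy
  | smul r x hx hx' =>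
    rw [smul_eq_mul, Derivation.leibniz]
    exact add_mem (Ideal.mul_mem_left _ _ hx') (Ideal.mul_mem_right _ _ hx)

theorem minorIdeal_zero : minorIdeal X 0 = ⊤ := by
  rw [Ideal.eq_top_iff_one]
  have := det_mem_minorIdeal (X := X) (ρ := 0) ![] ![]
  rwa [Matrix.det_fin_zero] at this

theorem Derivation.map_aeval_mvPolynomial {A σ : Type*} [CommRing A] [Algebra ℂ A] [Fintype σ]
    (D : Derivation ℂ A A) (g : σ → A) (p : MvPolynomial σ ℂ) :
    D (MvPolynomial.aeval g p) =
      ∑ i, MvPolynomial.aeval g (MvPolynomial.pderiv i p) * D (g i) := by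
  classical
  induction p using MvPolynomial.induction_on with
  | C c => simp [← MvPolynomial.algebraMap_eq]
  | add p q hp hq => simp only [map_add, hp, hq, add_mul, Finset.sum_add_distrib]
  | mul_X p j hp =>
    simp only [map_mul, MvPolynomial.aeval_X, D.leibniz, hp, Derivation.leibniz, map_add,
      smul_eq_mul, add_mul, Finset.sum_add_distrib, MvPolynomial.pderiv_X]
    congr 1
    · rw [Finset.sum_eq_single j]
      · simp
      · intro i _ hi
        simp [Ne.symm hi]
      · simp
    · rw [Finset.mul_sum]
      exact Finset.sum_congr rfl fun i _ => by ring

theorem exists_minorIdeal_eq_bot [Algebra.FiniteType ℂ R] : ∃ s, minorIdeal X s = ⊥ := by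
  obtain ⟨s, f, hf⟩ := Algebra.FiniteType.iff_quotient_mvPolynomial''.1
    (inferInstance : Algebra.FiniteType ℂ R)
  -- Padding the generators with `0` makes the factorisation of the bracket matrix through the
  -- generators square, with a zero column; no Cauchy–Binet formula for rectangular matrices is
  -- needed.
  let g : Fin (s + 1) → R := Fin.snoc (fun i => f (MvPolynomial.X i)) 0
  have hg : ∀ r : R, ∃ p : MvPolynomial (Fin (s + 1)) ℂ, MvPolynomial.aeval g p = r := by
    intro r
    obtain ⟨p, rfl⟩ := hf r
    refine ⟨MvPolynomial.rename Fin.castSucc p, ?_⟩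
    rw [MvPolynomial.aeval_rename]
    congr 1
    apply MvPolynomial.algHom_ext
    intro i
    simp [g]
  refine ⟨s + 1, ?_⟩
  rw [minorIdeal, Ideal.span_eq_bot]
  rintro _ ⟨a, t, rfl⟩
  choose p hp using fun j => hg (t j)
  have e : bracketMatrix X a t = (Matrix.of fun i k => X (a i) (g k)) *
      (Matrix.of fun k j => MvPolynomial.aeval g (MvPolynomial.pderiv k (p j))) := by
    ext i j
    rw [Matrix.mul_apply, bracketMatrix, Matrix.of_apply, ← hp j,
      Derivation.map_aeval_mvPolynomial]
    exact Finset.sum_congr rfl fun k _ => mul_comm _ _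
  rw [e, Matrix.det_mul, Matrix.det_eq_zero_of_column_eq_zero (Fin.last s), zero_mul]
  intro i
  simp [g]

variable (X) in
/-- Half of the dimension of a neighbourhood: the rank of the Poisson tensor along an ideal. -/
theorem exists_rank [Algebra.FiniteType ℂ R] {q : Ideal R} (hq : q ≠ ⊤) :
    ∃ ρ, ¬ minorIdeal X ρ ≤ q ∧ minorIdeal X (ρ + 1) ≤ q := by
  classical
  have h : ∃ s, minorIdeal X s ≤ q := by
    obtain ⟨s, hs⟩ := exists_minorIdeal_eq_bot (X := X)
    exact ⟨s, hs ▸ bot_le⟩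
  obtain ⟨ρ, hρ⟩ : ∃ ρ, Nat.find h = ρ + 1 := by
    refine Nat.exists_eq_succ_of_ne_zero fun h0 => ?_
    have := Nat.find_spec h
    rw [h0, minorIdeal_zero, top_le_iff] at this
    exact hq this
  exact ⟨ρ, Nat.find_min h (by omega), hρ ▸ Nat.find_spec h⟩

theorem exists_det_notMem {q : Ideal R} {ρ : ℕ} (h : ¬ minorIdeal X ρ ≤ q) :
    ∃ a t : Fin ρ → R, (bracketMatrix X a t).det ∉ q := by
  by_contra! hc
  apply h
  rw [minorIdeal, Ideal.span_le]
  rintro _ ⟨a, t, rfl⟩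
  exact hc a t

end Minors

/-! ### Darboux charts -/

/-- Coordinates on the open set `Δ ≠ 0` of the zero set of a Poisson ideal `q` on which the Poisson
tensor has the constant rank `ρ`; the ring of functions is `S`. -/
structure PoissonChart {R : Type*} [CommRing R] [Algebra ℂ R] (X : R →ₗ[ℂ] Derivation ℂ R R)
    (q : Ideal R) (ρ : ℕ) (S : Type*) [CommRing S] [Algebra ℂ S] where
  ι : R →ₐ[ℂ] S
  Δ : R
  a : Fin ρ → R
  t : Fin ρ → R
  c : Fin ρ → Fin ρ → S
  isPoisson : IsPoissonIdeal X q
  eq_zero_iff : ∀ f, ι f = 0 ↔ f ∈ q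
  isUnit : IsUnit (ι Δ)
  exists_mul : ∀ s, ∃ (N : ℕ) (f : R), ι Δ ^ N * s = ι f
  sum_c : ∀ k j, ∑ i, c k i * ι (X (a i) (t j)) = if k = j then 1 else 0
  rank : ∀ h f, ι (X h f) = ∑ k, ι (X h (t k)) * ∑ i, c k i * ι (X (a i) f)

/-- The Schur complement: the bordered determinant is `det M · (d - u C v)`. It turns the vanishing
of the minors of size `ρ + 1` into the relation `PoissonChart.rank`. -/
theorem Matrix.sum_mul_inverse_of_det_eq_zero {S : Type*} [CommRing S] {ρ : ℕ}
    {M C : Matrix (Fin ρ) (Fin ρ) S} (hC : C * M = 1) (u v : Fin ρ → S) (d : S)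
    (h : (Matrix.fromBlocks M (Matrix.of fun i (_ : Fin 1) => v i)
      (Matrix.of fun (_ : Fin 1) j => u j) (Matrix.of fun (_ _ : Fin 1) => d)).det = 0) :
    d = ∑ k, u k * ∑ i, C k i * v i := by
  let _ : Invertible M := ⟨C, hC, mul_eq_one_comm.1 hC⟩
  have hu : IsUnit M.det := (Matrix.isUnit_iff_isUnit_det M).1 (isUnit_of_invertible M)
  rw [Matrix.det_fromBlocks₁₁, hu.mul_right_eq_zero, Matrix.det_unique, Matrix.sub_apply,
    sub_eq_zero, Matrix.mul_assoc, Matrix.mul_apply] at h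
  refine h.trans (Finset.sum_congr rfl fun k _ => ?_)
  rw [Matrix.mul_apply]
  rfl

section ChartExistence

variable {R : Type*} [CommRing R] [Algebra ℂ R] {X : R →ₗ[ℂ] Derivation ℂ R R} {q : Ideal R}
  {ρ : ℕ}

/-- The chart defined by `a` and `t`. -/
noncomputable def chartOf {S : Type*} [CommRing S] [Algebra ℂ S] (hq : IsPoissonIdeal X q)
    (a t : Fin ρ → R) (hρ : minorIdeal X (ρ + 1) ≤ q) (ι : R →ₐ[ℂ] S) (hz : ∀ f, ι f = 0 ↔ f ∈ q)
    (hu : IsUnit (ι (bracketMatrix X a t).det))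
    (hs : ∀ s, ∃ (N : ℕ) (f : R), ι (bracketMatrix X a t).det ^ N * s = ι f) :
    PoissonChart X q ρ S :=
  have hM : IsUnit ((bracketMatrix X a t).map ι).det := by
    have : ((bracketMatrix X a t).map ι).det = ι (bracketMatrix X a t).det := (AlgHom.map_det ι _).symm
    rwa [this]
  { ι := ι
    Δ := (bracketMatrix X a t).det
    a := a
    t := t
    c := fun i j => ((bracketMatrix X a t).map ι)⁻¹ i j
    isPoisson := hq
    eq_zero_iff := hz
    isUnit := hu
    exists_mul := hs
    sum_c := fun k j => by
      have := congrFun (congrFun (Matrix.nonsing_inv_mul _ hM) k) j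
      rw [Matrix.mul_apply, Matrix.one_apply] at this
      exact this
    rank := fun h f => by
      refine Matrix.sum_mul_inverse_of_det_eq_zero (Matrix.nonsing_inv_mul _ hM) _ _ _ ?_
      -- Bordering by `h` and `f` gives a minor of size `ρ + 1`, which is in `q`.
      have e : Matrix.fromBlocks ((bracketMatrix X a t).map ι)
          (Matrix.of fun i (_ : Fin 1) => ι (X (a i) f))
          (Matrix.of fun (_ : Fin 1) j => ι (X h (t j))) (Matrix.of fun (_ _ : Fin 1) => ι (X h f)) =
          ((bracketMatrix X (Fin.snoc a h) (Fin.snoc t f)).map ι).submatrix finSumFinEquiv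
            finSumFinEquiv := by
        ext i j
        rcases i with i | i <;> rcases j with j | j <;>
        simp [bracketMatrix, Fin.snoc]
      rw [e, Matrix.det_submatrix_equiv_self]
      have e' : ((bracketMatrix X (Fin.snoc a h) (Fin.snoc t f)).map ι).det =
        ι (bracketMatrix X (Fin.snoc a h) (Fin.snoc t f)).det := (AlgHom.map_det ι _).symm
      rw [e', hz]
      exact hρ (det_mem_minorIdeal _ _) }

theorem exists_chartRing (q : Ideal R) [q.IsPrime] {Δ : R} (hΔ : Δ ∉ q) :
    ∃ ι : R →ₐ[ℂ] Localization.Away (Ideal.Quotient.mk q Δ), (∀ f, ι f = 0 ↔ f ∈ q) ∧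
      IsUnit (ι Δ) ∧ ∀ s, ∃ (N : ℕ) (f : R), ι Δ ^ N * s = ι f := by
  have hinj : Function.Injective
      (algebraMap (R ⧸ q) (Localization.Away (Ideal.Quotient.mk q Δ))) :=
    IsLocalization.injective (M := Submonoid.powers (Ideal.Quotient.mk q Δ))
      _ (powers_le_nonZeroDivisors_of_noZeroDivisors
        (fun h => hΔ (Ideal.Quotient.eq_zero_iff_mem.1 h)))
  refine ⟨{ (algebraMap (R ⧸ q) (Localization.Away (Ideal.Quotient.mk q Δ))).comp
      (Ideal.Quotient.mk q) with commutes' := fun r => rfl }, fun f => ?_, ?_, fun s => ?_⟩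
  · rw [← Ideal.Quotient.eq_zero_iff_mem]
    exact map_eq_zero_iff _ hinj
  · exact IsLocalization.Away.algebraMap_isUnit (Ideal.Quotient.mk q Δ)
  · obtain ⟨n, f, h⟩ := IsLocalization.Away.surj (Ideal.Quotient.mk q Δ) s
    obtain ⟨f, rfl⟩ := Ideal.Quotient.mk_surjective f
    exact ⟨n, f, by rw [mul_comm]; exact h⟩

/-- A chart of the zero set of a Poisson prime exists where some minor does not vanish. -/
theorem exists_chart (hq : IsPoissonIdeal X q) [q.IsPrime] (a t : Fin ρ → R)
    (hΔ : (bracketMatrix X a t).det ∉ q) (hρ : minorIdeal X (ρ + 1) ≤ q) :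
    ∃ χ : PoissonChart X q ρ (Localization.Away (Ideal.Quotient.mk q (bracketMatrix X a t).det)),
      χ.a = a ∧ χ.t = t ∧ χ.Δ = (bracketMatrix X a t).det := by
  obtain ⟨ι, h1, h2, h3⟩ := exists_chartRing q hΔ
  exact ⟨chartOf hq a t hρ ι h1 h2 h3, rfl, rfl, rfl⟩

end ChartExistence

theorem Derivation.sum_smul_apply {k S σ : Type*} [CommRing k] [CommRing S] [Algebra k S]
    (s : Finset σ) (c : σ → S) (D : σ → Derivation k S S) (x : S) :
    (∑ i ∈ s, c i • D i) x = ∑ i ∈ s, c i * D i x := by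
  classical
  induction s using Finset.induction_on with
  | empty => simp
  | insert a s ha ih =>
    rw [Finset.sum_insert ha, Finset.sum_insert ha, Derivation.add_apply, ih, Derivation.smul_apply,
      smul_eq_mul]

namespace PoissonChart

variable {R : Type*} [CommRing R] [Algebra ℂ R] {X : R →ₗ[ℂ] Derivation ℂ R R} {q : Ideal R}
  {ρ : ℕ} {S : Type*} [CommRing S] [Algebra ℂ S] (χ : PoissonChart X q ρ S)

theorem isDomain (χ : PoissonChart X q ρ S) [hq : q.IsPrime] : IsDomain S := by
  have key : ∀ s : S, s ≠ 0 → ∃ f u, f ∉ q ∧ IsUnit u ∧ u * s = χ.ι f := by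
    intro s hs
    obtain ⟨N, f, h⟩ := χ.exists_mul s
    refine ⟨f, _, fun hf => hs ?_, χ.isUnit.pow N, h⟩
    rw [(χ.eq_zero_iff f).2 hf] at h
    exact (χ.isUnit.pow N).mul_right_eq_zero.1 h
  have : Nontrivial S := by
    refine ⟨⟨0, 1, fun h => hq.ne_top ((Ideal.eq_top_iff_one _).2 ?_)⟩⟩
    rw [← χ.eq_zero_iff, map_one, h]
  have : NoZeroDivisors S := by
    refine ⟨fun {s s'} h => ?_⟩
    by_contra! hc
    obtain ⟨f, u, hf, hu, e⟩ := key s hc.1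
    obtain ⟨f', u', hf', hu', e'⟩ := key s' hc.2
    have : f * f' ∈ q := by
      rw [← χ.eq_zero_iff, map_mul, ← e, ← e']
      linear_combination u * u' * h
    exact (hq.mem_or_mem this).elim hf hf'
  exact NoZeroDivisors.to_isDomain S

theorem algHom_ext {W : Type*} [CommRing W] [Algebra ℂ W] {φ ψ : S →ₐ[ℂ] W}
    (h : ∀ f, φ (χ.ι f) = ψ (χ.ι f)) : φ = ψ := by
  ext s
  obtain ⟨N, f, e⟩ := χ.exists_mul s
  have h1 := congrArg φ e
  have h2 := congrArg ψ e
  rw [map_mul, map_pow, h] at h1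
  rw [map_mul, map_pow, ← h f, ← h1] at h2
  exact ((χ.isUnit.map ψ).pow N).mul_left_cancel h2.symm

theorem derivation_ext {D D' : Derivation ℂ S S} (h : ∀ f, D (χ.ι f) = D' (χ.ι f)) : D = D' := by
  ext s
  obtain ⟨N, f, e⟩ := χ.exists_mul s
  have h1 := h f
  have h2 := h (χ.Δ ^ N)
  rw [← e, D.leibniz, D'.leibniz, ← map_pow, h2, add_left_inj, map_pow, smul_eq_mul,
    smul_eq_mul] at h1
  exact (χ.isUnit.pow N).mul_left_cancel h1

/-- The universal property of localisation, derived from the axioms of a chart alone: with `v` the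
inverse of `φ Δ`, the fraction `ι f / ι Δ^N` goes to `v^N φ f`, and `key` is the independence of the
fraction. -/
theorem exists_lift {W : Type*} [CommRing W] [Algebra ℂ W] (φ : R →ₐ[ℂ] W) (hφ : ∀ f ∈ q, φ f = 0)
    (hΔ : IsUnit (φ χ.Δ)) : ∃ ψ : S →ₐ[ℂ] W, ∀ f, ψ (χ.ι f) = φ f := by
  have hcong : ∀ f g, χ.ι f = χ.ι g → φ f = φ g := by
    intro f g h
    rw [← sub_eq_zero, ← map_sub]
    apply hφ
    rw [← χ.eq_zero_iff, map_sub, h, sub_self]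
  obtain ⟨v, hv⟩ := hΔ.exists_right_inv
  choose N f hf using χ.exists_mul
  have key : ∀ s n g, χ.ι χ.Δ ^ n * s = χ.ι g → v ^ N s * φ (f s) = v ^ n * φ g := by
    intro s n g h
    have h1 : φ (χ.Δ ^ n * f s) = φ (χ.Δ ^ N s * g) := by
      apply hcong
      rw [map_mul, map_mul, map_pow, map_pow, ← hf, ← h]
      ring
    rw [map_mul, map_mul, map_pow, map_pow] at h1
    have h2 : ∀ m, φ χ.Δ ^ m * v ^ m = 1 := fun m => by rw [← mul_pow, hv, one_pow]
    linear_combination (v ^ N s * v ^ n) * h1 - v ^ N s * φ (f s) * h2 n + v ^ n * φ g * h2 (N s)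
  refine ⟨AlgHom.ofLinearMap
    { toFun := fun s => v ^ N s * φ (f s)
      map_add' := fun s s' => ?_
      map_smul' := fun r s => ?_ } ?_ fun s s' => ?_, fun g => ?_⟩
  · have e := key (s + s') (N s + N s') (χ.Δ ^ N s' * f s + χ.Δ ^ N s * f s') (by
      rw [map_add, map_mul, map_mul, map_pow, map_pow, ← hf, ← hf]
      ring)
    rw [e, map_add, map_mul, map_mul, map_pow, map_pow]
    have h2 : ∀ m, φ χ.Δ ^ m * v ^ m = 1 := fun m => by rw [← mul_pow, hv, one_pow]
    linear_combination v ^ N s * φ (f s) * h2 (N s') + v ^ N s' * φ (f s') * h2 (N s)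
  · have e := key (r • s) (N s) (r • f s) (by rw [map_smul, ← hf, mul_smul_comm])
    rw [e, map_smul, mul_smul_comm, RingHom.id_apply]
  · have e := key 1 0 1 (by simp)
    simpa using e
  · have e := key (s * s') (N s + N s') (f s * f s') (by
      rw [map_mul, ← hf, ← hf]
      ring)
    change v ^ N (s * s') * φ (f (s * s')) = v ^ N s * φ (f s) * (v ^ N s' * φ (f s'))
    rw [e, map_mul]
    ring
  · have e := key (χ.ι g) 0 g (by simp)
    simpa using e

/-- Derivations of `S` are sections of the dual numbers over `S`, so extending a Hamiltonian field
to the localisation is a case of `exists_lift`. The field descends to the zero set of `q` because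
`q` is Poisson. -/
theorem exists_ham (h : R) : ∃ D : Derivation ℂ S S, ∀ f, D (χ.ι f) = χ.ι (X h f) := by
  obtain ⟨g, hg⟩ := χ.exists_lift (sectionOfDerivation χ.ι (χ.ι.toLinearMap ∘ₗ (X h).toLinearMap)
    fun a b => by
      change χ.ι (X h (a * b)) = χ.ι a * χ.ι (X h b) + χ.ι b * χ.ι (X h a)
      rw [Derivation.leibniz, map_add, smul_eq_mul, smul_eq_mul, map_mul, map_mul]) (fun f hf => by
      ext
      · rw [fst_sectionOfDerivation, (χ.eq_zero_iff f).2 hf]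
        rfl
      · rw [snd_sectionOfDerivation]
        exact (χ.eq_zero_iff _).2 (χ.isPoisson h f hf)) (by
    rw [TrivSqZeroExt.isUnit_iff_isUnit_fst, fst_sectionOfDerivation]
    exact χ.isUnit)
  have hfst : (TrivSqZeroExt.fstHom ℂ S S).comp g = AlgHom.id ℂ S := by
    apply χ.algHom_ext
    intro f
    have := congrArg TrivSqZeroExt.fst (hg f)
    rwa [fst_sectionOfDerivation] at this
  refine ⟨derivationOfSection g fun s => DFunLike.congr_fun hfst s, fun f => ?_⟩
  have := congrArg TrivSqZeroExt.snd (hg f)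
  rwa [snd_sectionOfDerivation] at this

/-- The Hamiltonian vector field of `h` on a chart. -/
noncomputable def ham (h : R) : Derivation ℂ S S := (χ.exists_ham h).choose

theorem ham_ι (h f : R) : χ.ham h (χ.ι f) = χ.ι (X h f) := (χ.exists_ham h).choose_spec f

/-- The coordinate vector fields of a chart. -/
noncomputable def Y (k : Fin ρ) : Derivation ℂ S S := ∑ i, χ.c k i • χ.ham (χ.a i)

theorem Y_apply (k : Fin ρ) (s : S) : χ.Y k s = ∑ i, χ.c k i * χ.ham (χ.a i) s :=
  Derivation.sum_smul_apply _ _ _ _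

theorem Y_t (k j : Fin ρ) : χ.Y k (χ.ι (χ.t j)) = if k = j then 1 else 0 := by
  rw [Y_apply, ← χ.sum_c]
  simp only [ham_ι]

theorem ham_eq (h : R) : χ.ham h = ∑ k, χ.ι (X h (χ.t k)) • χ.Y k := by
  apply χ.derivation_ext
  intro f
  rw [ham_ι, Derivation.sum_smul_apply, χ.rank]
  simp only [Y_apply, ham_ι]

/-- The span `P` of the Hamiltonian fields is closed under brackets, by Jacobi and the Leibniz rule.
By the rank condition a field `D` in `P` equals `∑ D(t_j) Y_j`. The bracket of `Y_k` and `Y_l` is in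
`P` and kills each `t_j`, since `Y_k t_j` is constant, so it is zero. -/
theorem Y_comm (hX : ∀ a b, X (X a b) = ⁅X a, X b⁆) (k l : Fin ρ) (s : S) :
    χ.Y k (χ.Y l s) = χ.Y l (χ.Y k s) := by
  set P : Submodule S (Derivation ℂ S S) := Submodule.span S (Set.range χ.ham) with hP
  have hsmul : ∀ (c : S) (D D' : Derivation ℂ S S), ⁅D, c • D'⁆ = c • ⁅D, D'⁆ + D c • D' := by
    intro c D D'
    ext x
    simp only [Derivation.commutator_apply, Derivation.smul_apply, Derivation.add_apply,
      Derivation.leibniz, smul_eq_mul]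
    ring
  have h1 : ∀ h, ∀ D ∈ P, ⁅χ.ham h, D⁆ ∈ P := by
    intro h D hD
    induction hD using Submodule.span_induction with
    | mem x hx =>
      obtain ⟨g, rfl⟩ := hx
      have : ⁅χ.ham h, χ.ham g⁆ = χ.ham (X h g) := by
        apply χ.derivation_ext
        intro f
        rw [Derivation.commutator_apply, ham_ι, ham_ι, ham_ι, ham_ι, ham_ι, hX,
          Derivation.commutator_apply, map_sub]
      rw [this]
      exact Submodule.subset_span ⟨_, rfl⟩
    | zero => rw [lie_zero]; exact zero_mem _
    | add x y _ _ hx hy => rw [lie_add]; exact add_mem hx hy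
    | smul c x hx hx' =>
      rw [hsmul]
      exact add_mem (P.smul_mem _ hx') (P.smul_mem _ hx)
  have h2 : ∀ D ∈ P, ∀ D' ∈ P, ⁅D, D'⁆ ∈ P := by
    intro D hD D' hD'
    induction hD using Submodule.span_induction with
    | mem x hx =>
      obtain ⟨g, rfl⟩ := hx
      exact h1 g D' hD'
    | zero => rw [zero_lie]; exact zero_mem _
    | add x y _ _ hx hy => rw [add_lie]; exact add_mem hx hy
    | smul c x hx hx' =>
      rw [← lie_skew, hsmul, ← lie_skew D', smul_neg]
      exact neg_mem (add_mem (neg_mem (P.smul_mem _ hx')) (P.smul_mem _ hx))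
  have h3 : ∀ D ∈ P, ∀ s, D s = ∑ j, D (χ.ι (χ.t j)) * χ.Y j s := by
    intro D hD s
    induction hD using Submodule.span_induction with
    | mem x hx =>
      obtain ⟨g, rfl⟩ := hx
      conv_lhs => rw [ham_eq, Derivation.sum_smul_apply]
      simp only [ham_ι]
    | zero => simp
    | add x y _ _ hx hy =>
      simp only [Derivation.add_apply, add_mul, Finset.sum_add_distrib]
      rw [hx, hy]
    | smul c x hx hx' =>
      simp only [Derivation.smul_apply, smul_eq_mul, mul_assoc]
      rw [hx', Finset.mul_sum]
  have hY : ∀ k, χ.Y k ∈ P := fun k =>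
    Submodule.sum_mem _ fun i _ => P.smul_mem _ (Submodule.subset_span ⟨_, rfl⟩)
  have h4 := h3 _ (h2 _ (hY k) _ (hY l)) s
  rw [Derivation.commutator_apply] at h4
  rw [← sub_eq_zero, h4]
  refine Finset.sum_eq_zero fun j _ => ?_
  rw [Derivation.commutator_apply, Y_t, Y_t]
  split_ifs <;> simp

end PoissonChart

/-! ### Algebraic dependence on the coordinates -/

namespace MvPolynomial

theorem eq_C_of_pderiv_eq_zero {σ A : Type*} [CommRing A] [IsDomain A] [CharZero A]
    {p : MvPolynomial σ A} (h : ∀ i, pderiv i p = 0) : p = C (coeff 0 p) := by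
  classical
  ext m
  rw [coeff_C]
  split_ifs with hm
  · rw [hm]
  · obtain ⟨i, hi⟩ : ∃ i, m i ≠ 0 := by
      by_contra! hc
      exact hm (Finsupp.ext fun i => (hc i).symm)
    have h1 := coeff_pderiv (i := i) p (m - Finsupp.single i 1)
    rw [h i, coeff_zero, tsub_add_cancel_of_le (Finsupp.single_le_iff.2 (by omega))] at h1
    refine (mul_eq_zero.1 h1.symm).resolve_right ?_
    exact_mod_cast Nat.succ_ne_zero ((m - (Finsupp.single i 1 : σ →₀ ℕ)) i)

theorem totalDegree_pderiv_lt {σ A : Type*} [CommRing A] {p : MvPolynomial σ A} {i : σ}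
    (h : pderiv i p ≠ 0) : (pderiv i p).totalDegree < p.totalDegree := by
  have key : ∀ m ∈ (pderiv i p).support, (m.sum fun _ e => e) + 1 ≤ p.totalDegree := by
    intro m hm
    rw [mem_support_iff, coeff_pderiv] at hm
    have h1 := le_totalDegree (mem_support_iff.2 (left_ne_zero_of_mul hm))
    rwa [Finsupp.sum_add_index' (fun _ => rfl) (fun _ _ _ => rfl), Finsupp.sum_single_index rfl] at h1
  obtain ⟨m, hm⟩ := support_nonempty.2 h
  rw [totalDegree, Finset.sup_lt_iff (by have := key m hm; rw [bot_eq_zero]; omega)]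
  exact fun m hm => key m hm

end MvPolynomial

/-- Take a nonzero annihilating polynomial of least degree; in characteristic zero its derivative is
nonzero of smaller degree. -/
theorem IsAlgebraic.exists_aeval_derivative_ne_zero {A S : Type*} [CommRing A] [CommRing S]
    [IsDomain S] [CharZero S] [Algebra A S] (hinj : Function.Injective (algebraMap A S)) {x : S}
    (hx : IsAlgebraic A x) : ∃ P : Polynomial A, Polynomial.aeval x P = 0 ∧
      Polynomial.aeval x (Polynomial.derivative P) ≠ 0 := by
  classical
  have hA : IsDomain A := hinj.isDomain
  have hA0 : CharZero A := ⟨fun m n h => by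
    have := congrArg (algebraMap A S) h
    rw [map_natCast, map_natCast] at this
    exact_mod_cast this⟩
  obtain ⟨P, hP, hPx⟩ := hx
  have hex : ∃ n, ∃ P : Polynomial A, P ≠ 0 ∧ Polynomial.aeval x P = 0 ∧ P.natDegree = n :=
    ⟨_, P, hP, hPx, rfl⟩
  obtain ⟨P, hP, hPx, hn⟩ := Nat.find_spec hex
  refine ⟨P, hPx, fun h => ?_⟩
  have hdeg : P.natDegree ≠ 0 := by
    intro h0
    rw [Polynomial.eq_C_of_natDegree_eq_zero h0] at hPx hP
    rw [Polynomial.aeval_C, map_eq_zero_iff _ hinj] at hPx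
    rw [hPx, map_zero] at hP
    exact hP rfl
  have hder : Polynomial.derivative P ≠ 0 := fun h0 =>
    hdeg (Polynomial.derivative_eq_zero.1 h0)
  exact Nat.find_min hex (m := (Polynomial.derivative P).natDegree)
    (by rw [← hn]; exact Polynomial.natDegree_derivative_lt hdeg) ⟨_, hder, h, rfl⟩

section Along

variable {S K : Type*} [CommRing S] [Algebra ℂ S] [CommRing K] [Algebra ℂ K] {ψ : S →ₐ[ℂ] K}
  {δ : S →ₗ[ℂ] K}

theorem eq_zero_algebraMap_of_along
    (hδ : ∀ a b, δ (a * b) = ψ a * δ b + ψ b * δ a) (c : ℂ) : δ (algebraMap ℂ S c) = 0 := by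
  have h := hδ 1 1
  simp only [mul_one, map_one, one_mul] at h
  have h1 : δ 1 = 0 := by linear_combination -h
  rw [Algebra.algebraMap_eq_smul_one, map_smul, h1, smul_zero]

theorem eq_zero_of_mem_adjoin_of_along
    (hδ : ∀ a b, δ (a * b) = ψ a * δ b + ψ b * δ a) {s : Set S} (hs : ∀ x ∈ s, δ x = 0) {x : S}
    (hx : x ∈ Algebra.adjoin ℂ s) : δ x = 0 := by
  induction hx using Algebra.adjoin_induction with
  | mem x hx => exact hs x hx
  | algebraMap c => exact eq_zero_algebraMap_of_along hδ c
  | add x y _ _ hx hy => rw [map_add, hx, hy, add_zero]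
  | mul x y _ _ hx hy => rw [hδ, hx, hy, mul_zero, mul_zero, add_zero]

theorem aeval_of_along (hδ : ∀ a b, δ (a * b) = ψ a * δ b + ψ b * δ a)
    {A : Subalgebra ℂ S} (hA : ∀ x ∈ A, δ x = 0) (x : S) (P : Polynomial A) :
    δ (Polynomial.aeval x P) = ψ (Polynomial.aeval x (Polynomial.derivative P)) * δ x := by
  have hpow : ∀ n : ℕ, δ (x ^ n) = ψ (n * x ^ (n - 1)) * δ x := by
    intro n
    induction n with
    | zero =>
      rw [pow_zero, hA 1 (one_mem _)]
      simp
    | succ n ih =>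
      rw [pow_succ, hδ, ih]
      rcases n with _ | n
      · simp
      · simp only [map_mul, map_pow, map_natCast, Nat.add_sub_cancel]
        push_cast
        ring
  induction P using Polynomial.induction_on' with
  | add P Q hP hQ => simp only [map_add, hP, hQ, add_mul]
  | monomial n a =>
    rw [Polynomial.derivative_monomial, Polynomial.aeval_monomial, Polynomial.aeval_monomial, hδ,
      hpow]
    have : δ (algebraMap A S a) = 0 := hA _ a.2
    rw [this]
    simp only [map_mul, map_pow, map_natCast]
    ring

end Along

namespace PoissonChart

variable {R : Type*} [CommRing R] [Algebra ℂ R] {X : R →ₗ[ℂ] Derivation ℂ R R} {q : Ideal R}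
  {ρ : ℕ} {S : Type*} [CommRing S] [Algebra ℂ S] (χ : PoissonChart X q ρ S)

/-- The functions on the chart are algebraic over the coordinates. -/
def IsEtale : Prop :=
  ∀ s : S, IsAlgebraic (Algebra.adjoin ℂ (Set.range fun k => χ.ι (χ.t k))) s

variable {χ}

/-- By algebraicity a nonzero element of `I` divides a nonzero polynomial in the coordinates. On
such polynomials `Y_k` acts as `∂/∂t_k`, so one of least degree that evaluates into `I` is a nonzero
constant. -/
theorem IsEtale.eq_top_of_stable (hχ : χ.IsEtale) [q.IsPrime] {I : Ideal S} (hI : I ≠ ⊥)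
    (hY : ∀ k, ∀ s ∈ I, χ.Y k s ∈ I) : I = ⊤ := by
  classical
  have := χ.isDomain
  obtain ⟨s, hs, hs0⟩ := Submodule.exists_mem_ne_zero_of_ne_bot hI
  obtain ⟨r, hr0, hr⟩ := (hχ s).exists_nonzero_dvd (mem_nonZeroDivisors_of_ne_zero hs0)
  have hrI : (r : S) ∈ I := I.mem_of_dvd hr hs
  let g : Fin ρ → S := fun k => χ.ι (χ.t k)
  obtain ⟨p, hp⟩ : ∃ p : MvPolynomial (Fin ρ) ℂ, MvPolynomial.aeval g p = (r : S) := by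
    have h : (r : S) ∈ (MvPolynomial.aeval g : MvPolynomial (Fin ρ) ℂ →ₐ[ℂ] S).range :=
      (Algebra.adjoin_range_eq_range_aeval ℂ g).le r.2
    exact h
  have hex : ∃ n, ∃ p : MvPolynomial (Fin ρ) ℂ, p ≠ 0 ∧ MvPolynomial.aeval g p ∈ I ∧
      p.totalDegree = n := by
    refine ⟨_, p, ?_, hp ▸ hrI, rfl⟩
    rintro rfl
    exact hr0 (Subtype.ext (by rw [← hp, map_zero]; rfl))
  obtain ⟨p, hp0, hpI, hn⟩ := Nat.find_spec hex
  have hder : ∀ k, MvPolynomial.pderiv k p = 0 := by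
    intro k
    by_contra hk
    refine Nat.find_min hex (m := (MvPolynomial.pderiv k p).totalDegree)
      (hn ▸ MvPolynomial.totalDegree_pderiv_lt hk) ⟨_, hk, ?_, rfl⟩
    have h1 := hY k _ hpI
    rw [Derivation.map_aeval_mvPolynomial, Finset.sum_eq_single k] at h1
    · rwa [χ.Y_t, if_pos rfl, mul_one] at h1
    · intro j _ hj
      rw [χ.Y_t, if_neg hj.symm, mul_zero]
    · simp
  have hc := MvPolynomial.eq_C_of_pderiv_eq_zero hder
  have hc0 : MvPolynomial.coeff 0 p ≠ 0 := by
    intro h0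
    rw [h0, map_zero] at hc
    exact hp0 hc
  rw [hc, ← MvPolynomial.algebraMap_eq, AlgHom.commutes] at hpI
  exact Ideal.eq_top_of_isUnit_mem _ hpI ((isUnit_iff_ne_zero.2 hc0).map (algebraMap ℂ S))

universe v

/-- The chain rule gives `0 = δ (P(x)) = ψ (P'(x)) δ x`, so `c = P'(x)` works, and it does not
depend on `K`, `ψ` or `δ`. -/
theorem IsEtale.exists_annihilator (hχ : χ.IsEtale) [q.IsPrime] (x : S) : ∃ c : S, c ≠ 0 ∧
    ∀ (K : Type v) [CommRing K] [Algebra ℂ K] (ψ : S →ₐ[ℂ] K) (δ : S →ₗ[ℂ] K),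
      (∀ a b, δ (a * b) = ψ a * δ b + ψ b * δ a) → (∀ k, δ (χ.ι (χ.t k)) = 0) →
      ψ c * δ x = 0 := by
  have := χ.isDomain
  have : CharZero S := charZero_of_injective_algebraMap (algebraMap ℂ S).injective
  obtain ⟨P, hP, hP'⟩ := (hχ x).exists_aeval_derivative_ne_zero Subtype.val_injective
  refine ⟨_, hP', fun K _ _ ψ δ hδ ht => ?_⟩
  rw [← aeval_of_along hδ (fun y hy => eq_zero_of_mem_adjoin_of_along hδ ?_ hy), hP, map_zero]
  rintro _ ⟨k, rfl⟩
  exact ht k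

variable (χ) in
/-- The functions that annihilate all vector fields, along any homomorphism, that are relative to
the coordinates. -/
def relAnnihilator : Ideal S where
  carrier := {c | ∀ (K : Type v) [CommRing K] [Algebra ℂ K] (ψ : S →ₐ[ℂ] K) (δ : S →ₗ[ℂ] K),
    (∀ a b, δ (a * b) = ψ a * δ b + ψ b * δ a) → (∀ k, δ (χ.ι (χ.t k)) = 0) → ∀ x, ψ c * δ x = 0}
  add_mem' := fun {a b} ha hb K _ _ ψ δ h1 h2 x => by
    rw [map_add, add_mul, ha K ψ δ h1 h2, hb K ψ δ h1 h2, add_zero]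
  zero_mem' := fun K _ _ ψ δ h1 h2 x => by rw [map_zero, zero_mul]
  smul_mem' := fun c a ha K _ _ ψ δ h1 h2 x => by
    rw [smul_eq_mul, map_mul, mul_assoc, ha K ψ δ h1 h2, mul_zero]

theorem along_eq_zero_of_generators {K : Type*} [CommRing K] [Algebra ℂ K] {ψ : S →ₐ[ℂ] K}
    {δ : S →ₗ[ℂ] K} (hδ : ∀ a b, δ (a * b) = ψ a * δ b + ψ b * δ a) {G : Set R}
    (hG : Algebra.adjoin ℂ G = ⊤) {b : S} (hb : ∀ x ∈ G, ψ b * δ (χ.ι x) = 0) (x : S) :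
    ψ b * δ x = 0 := by
  have hR : ∀ f : R, ψ b * δ (χ.ι f) = 0 := by
    intro f
    have hf : f ∈ Algebra.adjoin ℂ G := hG ▸ Algebra.mem_top
    induction hf using Algebra.adjoin_induction with
    | mem x hx => exact hb x hx
    | algebraMap r => rw [AlgHom.commutes, eq_zero_algebraMap_of_along hδ, mul_zero]
    | add x y _ _ hx hy => rw [map_add, map_add, mul_add, hx, hy, add_zero]
    | mul x y _ _ hx hy =>
      rw [map_mul, hδ]
      linear_combination ψ (χ.ι x) * hy + ψ (χ.ι y) * hx
  obtain ⟨N, f, e⟩ := χ.exists_mul x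
  have h3 := hR f
  have h4 := hR (χ.Δ ^ N)
  rw [← e, hδ] at h3
  rw [map_pow] at h4
  apply ((χ.isUnit.pow N).map ψ).mul_left_cancel
  linear_combination h3 - ψ x * h4

/-- A derivation along `ψ` is controlled by finitely many generators of `R`; the product of their
annihilators is nonzero in the domain `S`. -/
theorem IsEtale.relAnnihilator_ne_bot (hχ : χ.IsEtale) [q.IsPrime] [Algebra.FiniteType ℂ R] :
    relAnnihilator.{v} χ ≠ ⊥ := by
  classical
  have := χ.isDomain
  obtain ⟨G, hG⟩ := Algebra.FiniteType.out (R := ℂ) (A := R)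
  choose c hc0 hc using fun x => IsEtale.exists_annihilator.{v} hχ (χ.ι x)
  have hprod : ∏ x ∈ G, c x ≠ 0 := Finset.prod_ne_zero_iff.2 fun x _ => hc0 x
  refine fun hbot => hprod ?_
  rw [← Submodule.mem_bot S, ← hbot]
  intro K _ _ ψ δ h1 h2
  refine along_eq_zero_of_generators (χ := χ) h1 hG fun x hx => ?_
  rw [← Finset.mul_prod_erase _ _ hx, map_mul]
  linear_combination ψ (∏ x ∈ G.erase x, c x) * hc x K ψ δ h1 h2

/-- Deform `ψ` and `δ` along `Y_k` to `ψ + ε ψ Y_k` and `δ + ε δ Y_k` over `K[ε]`. The new pair is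
of the same kind because `Y_k t_j` is constant, and the `ε`-part of its annihilation relation is the
claim. This is why the annihilator is defined with all rings `K` at once. -/
theorem Y_mem_relAnnihilator (k : Fin ρ) {c : S} (hc : c ∈ relAnnihilator.{v} χ) :
    χ.Y k c ∈ relAnnihilator.{v} χ := by
  intro K _ _ ψ δ h1 h2 x
  let ψ' : S →ₐ[ℂ] TrivSqZeroExt K K :=
    sectionOfDerivation ψ (ψ.toLinearMap ∘ₗ (χ.Y k).toLinearMap) fun a b => by
      change ψ (χ.Y k (a * b)) = ψ a * ψ (χ.Y k b) + ψ b * ψ (χ.Y k a)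
      rw [Derivation.leibniz, map_add, smul_eq_mul, smul_eq_mul, map_mul, map_mul]
  let δ' : S →ₗ[ℂ] TrivSqZeroExt K K :=
    { toFun := fun s => TrivSqZeroExt.inl (δ s) + TrivSqZeroExt.inr (δ (χ.Y k s))
      map_add' := fun a b => by ext <;> simp
      map_smul' := fun r a => by ext <;> simp }
  have f1 : ∀ s, (ψ' s).fst = ψ s := fun s => fst_sectionOfDerivation _ _ _ s
  have f2 : ∀ s, (ψ' s).snd = ψ (χ.Y k s) := fun s => snd_sectionOfDerivation _ _ _ s
  have f3 : ∀ s, (δ' s).fst = δ s := fun s => by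
    change (TrivSqZeroExt.inl (δ s) + TrivSqZeroExt.inr (δ (χ.Y k s)) : TrivSqZeroExt K K).fst = _
    simp
  have f4 : ∀ s, (δ' s).snd = δ (χ.Y k s) := fun s => by
    change (TrivSqZeroExt.inl (δ s) + TrivSqZeroExt.inr (δ (χ.Y k s)) : TrivSqZeroExt K K).snd = _
    simp
  have h := hc (TrivSqZeroExt K K) ψ' δ' ?_ ?_ x
  · have h' := congrArg TrivSqZeroExt.snd h
    have h0 := hc K ψ δ h1 h2 (χ.Y k x)
    rw [TrivSqZeroExt.snd_mul, f1, f2, f3, f4, smul_eq_mul, h0, zero_add, op_smul_eq_smul,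
      smul_eq_mul, TrivSqZeroExt.snd_zero, mul_comm] at h'
    rw [← h', mul_comm]
  · intro a b
    ext
    · rw [f3, h1, TrivSqZeroExt.fst_add, TrivSqZeroExt.fst_mul, TrivSqZeroExt.fst_mul, f1, f1, f3,
        f3]
    · rw [f4, Derivation.leibniz, map_add, smul_eq_mul, smul_eq_mul, h1, h1, TrivSqZeroExt.snd_add,
        TrivSqZeroExt.snd_mul, TrivSqZeroExt.snd_mul, f1, f1, f2, f2, f3, f3, f4, f4,
        op_smul_eq_smul, op_smul_eq_smul]
      simp only [smul_eq_mul]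
      ring
  · intro j
    have : δ (χ.Y k (χ.ι (χ.t j))) = 0 := by
      rw [χ.Y_t]
      split_ifs
      · simpa using eq_zero_algebraMap_of_along h1 1
      · exact map_zero δ
    ext
    · rw [f3, h2]; rfl
    · rw [f4, this]; rfl

/-- Vector fields, along any homomorphism, that annihilate the coordinates vanish. -/
theorem IsEtale.eq_zero_of_along (hχ : χ.IsEtale) [q.IsPrime] [Algebra.FiniteType ℂ R]
    {K : Type v} [CommRing K] [Algebra ℂ K] (ψ : S →ₐ[ℂ] K) (δ : S →ₗ[ℂ] K)
    (hδ : ∀ a b, δ (a * b) = ψ a * δ b + ψ b * δ a) (ht : ∀ k, δ (χ.ι (χ.t k)) = 0) (s : S) :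
    δ s = 0 := by
  have h1 : (1 : S) ∈ relAnnihilator.{v} χ :=
    hχ.eq_top_of_stable hχ.relAnnihilator_ne_bot (fun k s hs => Y_mem_relAnnihilator k hs) ▸
      Submodule.mem_top
  have h2 := h1 K ψ δ hδ ht s
  rwa [map_one, one_mul] at h2

end PoissonChart

/-! ### Derivations of polynomial rings -/

namespace MvPolynomial

variable {σ S : Type*} [CommRing S] [Algebra ℂ S]

theorem derivation_ext' {D D' : Derivation ℂ (MvPolynomial σ S) (MvPolynomial σ S)}
    (hC : ∀ s, D (C s) = D' (C s)) (hX : ∀ i, D (X i) = D' (X i)) : D = D' := by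
  refine Derivation.ext fun p => ?_
  induction p using MvPolynomial.induction_on with
  | C s => exact hC s
  | add p q hp hq => rw [map_add, map_add, hp, hq]
  | mul_X p i hp => rw [D.leibniz, D'.leibniz, hp, hX]

theorem exists_derivation (δ : S →ₗ[ℂ] MvPolynomial σ S)
    (hδ : ∀ a b, δ (a * b) = C a * δ b + C b * δ a) (v : σ → MvPolynomial σ S) :
    ∃ D : Derivation ℂ (MvPolynomial σ S) (MvPolynomial σ S), (∀ s, D (C s) = δ s) ∧
      ∀ i, D (X i) = v i := by
  let g0 : S →ₐ[ℂ] TrivSqZeroExt (MvPolynomial σ S) (MvPolynomial σ S) :=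
    sectionOfDerivation (IsScalarTower.toAlgHom ℂ S (MvPolynomial σ S)) δ hδ
  let g1 : MvPolynomial σ S →+* TrivSqZeroExt (MvPolynomial σ S) (MvPolynomial σ S) :=
    eval₂Hom g0.toRingHom fun i => TrivSqZeroExt.inl (X i) + TrivSqZeroExt.inr (v i)
  have hC : ∀ s, g1 (C s) = g0 s := fun s => eval₂Hom_C _ _ _
  have hX : ∀ i, g1 (X i) = TrivSqZeroExt.inl (X i) + TrivSqZeroExt.inr (v i) :=
    fun i => eval₂Hom_X' _ _ _
  let g : MvPolynomial σ S →ₐ[ℂ] TrivSqZeroExt (MvPolynomial σ S) (MvPolynomial σ S) :=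
    { g1 with
      commutes' := fun r => by
        have : algebraMap ℂ (MvPolynomial σ S) r = C (algebraMap ℂ S r) := rfl
        rw [this]
        exact (hC _).trans (g0.commutes r) }
  have hfst : ∀ p, (g p).fst = p := by
    intro p
    change (g1 p).fst = p
    induction p using MvPolynomial.induction_on with
    | C s => rw [hC]; exact fst_sectionOfDerivation _ _ _ s
    | add p q hp hq => rw [map_add, TrivSqZeroExt.fst_add, hp, hq]
    | mul_X p i hp => rw [map_mul, TrivSqZeroExt.fst_mul, hp, hX]; simp
  refine ⟨derivationOfSection g hfst, fun s => ?_, fun i => ?_⟩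
  · change (g1 (C s)).snd = _
    rw [hC]
    exact snd_sectionOfDerivation _ _ _ s
  · change (g1 (X i)).snd = _
    rw [hX]
    simp

theorem pderiv_ne_zero_of_mem_vars {σ S : Type*} [CommRing S] [IsDomain S] [CharZero S]
    {p : MvPolynomial σ S} {i : σ}
    (h : i ∈ p.vars) : pderiv i p ≠ 0 := by
  classical
  obtain ⟨m, hm, hi⟩ := (mem_vars_iff_mem_support i).1 h
  intro h0
  have h1 := coeff_pderiv (i := i) p (m - Finsupp.single i 1)
  rw [h0, coeff_zero, tsub_add_cancel_of_le (Finsupp.single_le_iff.2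
    (Nat.one_le_iff_ne_zero.2 (Finsupp.mem_support_iff.1 hi)))] at h1
  refine (mul_ne_zero (mem_support_iff.1 hm) ?_) h1.symm
  exact_mod_cast Nat.succ_ne_zero ((m - (Finsupp.single i 1 : σ →₀ ℕ)) i)

/-- Meant for the modes of order `n + 1`, which kill the functions on the chart and the variables of
index below `n`: on a polynomial of order at most `n` only the partial derivatives of top order
remain. -/
theorem derivation_eq_sum_pderiv {κ : Type*} [Fintype κ]
    {D : Derivation ℂ (MvPolynomial (κ × ℕ) S) (MvPolynomial (κ × ℕ) S)} (hC : ∀ s, D (C s) = 0)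
    {n : ℕ} (hX : ∀ k m, m < n → D (X (k, m)) = 0) {p : MvPolynomial (κ × ℕ) S}
    (hp : ∀ v ∈ p.vars, v.2 ≤ n) : D p = ∑ k, D (X (k, n)) * pderiv (k, n) p := by
  classical
  have h1 : D = (mkDerivation S fun v => D (X v)).restrictScalars ℂ := by
    apply derivation_ext'
    · intro s
      rw [hC]
      exact ((mkDerivation S fun v => D (X v)).map_algebraMap s).symm
    · intro i
      exact (mkDerivation_X S (fun v => D (X v)) i).symm
  let D₁ : Derivation S (MvPolynomial (κ × ℕ) S) (MvPolynomial (κ × ℕ) S) :=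
    mkDerivation S fun v => D (X v)
  let D₂ : Derivation S (MvPolynomial (κ × ℕ) S) (MvPolynomial (κ × ℕ) S) :=
    ∑ k, D (X (k, n)) • pderiv (k, n)
  have h2 : Set.EqOn (D₁ ∘ X) (D₂ ∘ X) {v : κ × ℕ | v.2 ≤ n} := by
    rintro ⟨k, m⟩ hm
    simp only [D₁, D₂, Function.comp_apply, mkDerivation_X, Derivation.sum_smul_apply, pderiv_X]
    rcases lt_or_eq_of_le (show m ≤ n from hm) with h | rfl
    · rw [hX k m h, Finset.sum_eq_zero]
      intro j _
      rw [Pi.single_eq_of_ne (by simp [h.ne]), mul_zero]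
    · rw [Finset.sum_eq_single k]
      · simp
      · intro j _ hj
        rw [Pi.single_eq_of_ne (by simp [hj.symm]), mul_zero]
      · simp
  conv_lhs => rw [h1]
  refine (derivation_eqOn_supported h2 (f := p) ?_).trans ?_
  · rw [mem_supported]
    exact fun v hv => hp v hv
  · simp only [D₂, Derivation.sum_smul_apply]

end MvPolynomial

/-- The commutation relation with a derivation `T` determines `H_n` on the iterates of `T`. -/
theorem Derivation.iterate_of_commutator {A : Type*} [CommRing A] [Algebra ℂ A]
    {T : Derivation ℂ A A} {H : ℕ → Derivation ℂ A A}
    (hH : ∀ n x, H n (T x) = T (H n x) + n • H (n - 1) x) {x : A} (hx : ∀ n, 0 < n → H n x = 0)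
    (l n : ℕ) : H n (T^[l] x) = l.descFactorial n • T^[l - n] (H 0 x) := by
  induction l generalizing n with
  | zero =>
    rcases n with _ | n
    · simp
    · simp [hx]
  | succ l ih =>
    rw [Function.iterate_succ_apply', hH, ih]
    rcases n with _ | n
    · simp [ih, Function.iterate_succ_apply' T]
    · rw [ih, Nat.add_sub_cancel, Nat.succ_sub_succ, Nat.succ_descFactorial_succ, smul_smul,
        map_nsmul]
      rcases le_or_gt (n + 1) l with h | h
      · rw [← Function.iterate_succ_apply' T, show (l - (n + 1)).succ = l - n by omega, ← add_smul]
        congr 1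
        rw [Nat.descFactorial_succ]
        obtain ⟨d, rfl⟩ := Nat.exists_eq_add_of_le h
        rw [show n + 1 + d - n = d + 1 by omega]
        ring
      · rw [Nat.descFactorial_eq_zero_iff_lt.2 h, zero_smul, zero_add]
        rcases lt_or_eq_of_le (Nat.lt_succ_iff.1 h) with h' | rfl
        · rw [Nat.descFactorial_eq_zero_iff_lt.2 h', mul_zero, mul_zero]
        · rfl

/-! ### The arc space of a chart and the modes of Hamiltonians on it. -/

namespace PoissonChart

open MvPolynomial

variable {R : Type*} [CommRing R] [Algebra ℂ R] {X : R →ₗ[ℂ] Derivation ℂ R R} {q : Ideal R}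
  {ρ : ℕ} {S : Type*} [CommRing S] [Algebra ℂ S] (χ : PoissonChart X q ρ S)

theorem exists_arcT : ∃ T : Derivation ℂ (MvPolynomial (Fin ρ × ℕ) S) (MvPolynomial (Fin ρ × ℕ) S),
    (∀ s, T (C s) = ∑ k, C (χ.Y k s) * MvPolynomial.X (k, 0)) ∧
    ∀ v, T (MvPolynomial.X v) = MvPolynomial.X (v.1, v.2 + 1) := by
  let δ : S →ₗ[ℂ] MvPolynomial (Fin ρ × ℕ) S :=
    ∑ k, (LinearMap.mulRight ℂ (MvPolynomial.X (k, 0))) ∘ₗ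
      (IsScalarTower.toAlgHom ℂ S (MvPolynomial (Fin ρ × ℕ) S)).toLinearMap ∘ₗ (χ.Y k).toLinearMap
  have e : ∀ s, δ s = ∑ k, C (χ.Y k s) * MvPolynomial.X (k, 0) := fun s => by
    rw [LinearMap.sum_apply]
    rfl
  obtain ⟨T, h1, h2⟩ := exists_derivation δ (fun a b => by
    simp only [e, Derivation.leibniz, smul_eq_mul, map_add, map_mul, add_mul,
      Finset.sum_add_distrib, Finset.mul_sum, mul_assoc]) fun v => MvPolynomial.X (v.1, v.2 + 1)
  exact ⟨T, fun s => (h1 s).trans (e s), h2⟩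

/-- The derivation of the arc space of a chart; the variable `(k, n)` is the derivative of order
`n + 1` of the `k`-th coordinate. -/
noncomputable def arcT : Derivation ℂ (MvPolynomial (Fin ρ × ℕ) S) (MvPolynomial (Fin ρ × ℕ) S) :=
  χ.exists_arcT.choose

theorem arcT_C (s : S) : χ.arcT (C s) = ∑ k, C (χ.Y k s) * MvPolynomial.X (k, 0) :=
  χ.exists_arcT.choose_spec.1 s

theorem arcT_X (v : Fin ρ × ℕ) : χ.arcT (MvPolynomial.X v) = MvPolynomial.X (v.1, v.2 + 1) :=
  χ.exists_arcT.choose_spec.2 v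

theorem arcT_iterate_t (k : Fin ρ) (n : ℕ) :
    χ.arcT^[n + 1] (C (χ.ι (χ.t k))) = MvPolynomial.X (k, n) := by
  induction n with
  | zero =>
    rw [Function.iterate_one, arcT_C, Finset.sum_eq_single k]
    · rw [χ.Y_t, if_pos rfl, map_one, one_mul]
    · intro j _ hj
      rw [χ.Y_t, if_neg hj, map_zero, zero_mul]
    · simp
  | succ n ih => rw [Function.iterate_succ_apply', ih, arcT_X]

/-- The values are forced by `Derivation.iterate_of_commutator`, because the variable `(k, n)`
stands for `T^(n+1) t_k`; freeness of the variables makes them admissible. -/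
theorem exists_arcHam (n : ℕ) (h : R) :
    ∃ H : Derivation ℂ (MvPolynomial (Fin ρ × ℕ) S) (MvPolynomial (Fin ρ × ℕ) S),
      (∀ s, H (C s) = if n = 0 then C (χ.ham h s) else 0) ∧
      ∀ v, H (MvPolynomial.X v) =
        (v.2 + 1).descFactorial n • χ.arcT^[v.2 + 1 - n] (C (χ.ι (X h (χ.t v.1)))) := by
  let δ : S →ₗ[ℂ] MvPolynomial (Fin ρ × ℕ) S :=
    if n = 0 then (IsScalarTower.toAlgHom ℂ S (MvPolynomial (Fin ρ × ℕ) S)).toLinearMap ∘ₗ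
      (χ.ham h).toLinearMap else 0
  have e : ∀ s, δ s = if n = 0 then C (χ.ham h s) else 0 := fun s => by
    simp only [δ]
    split_ifs <;> rfl
  obtain ⟨T, h1, h2⟩ := exists_derivation δ (fun a b => by
    simp only [e]
    split_ifs
    · simp only [Derivation.leibniz, smul_eq_mul, map_add, map_mul]
    · simp) fun v =>
      (v.2 + 1).descFactorial n • χ.arcT^[v.2 + 1 - n] (C (χ.ι (X h (χ.t v.1))))
  exact ⟨T, fun s => (h1 s).trans (e s), h2⟩

/-- The `n`-th mode of the Hamiltonian `h` on the arc space of a chart. -/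
noncomputable def arcHam (n : ℕ) (h : R) :
    Derivation ℂ (MvPolynomial (Fin ρ × ℕ) S) (MvPolynomial (Fin ρ × ℕ) S) :=
  (χ.exists_arcHam n h).choose

theorem arcHam_C_zero (h : R) (s : S) : χ.arcHam 0 h (C s) = C (χ.ham h s) :=
  ((χ.exists_arcHam 0 h).choose_spec.1 s).trans (if_pos rfl)

theorem arcHam_C {n : ℕ} (hn : 0 < n) (h : R) (s : S) : χ.arcHam n h (C s) = 0 :=
  ((χ.exists_arcHam n h).choose_spec.1 s).trans (if_neg hn.ne')

theorem arcHam_X (n : ℕ) (h : R) (v : Fin ρ × ℕ) : χ.arcHam n h (MvPolynomial.X v) =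
    (v.2 + 1).descFactorial n • χ.arcT^[v.2 + 1 - n] (C (χ.ι (X h (χ.t v.1)))) :=
  (χ.exists_arcHam n h).choose_spec.2 v

theorem ham_apply (h : R) (s : S) : χ.ham h s = ∑ k, χ.ι (X h (χ.t k)) * χ.Y k s := by
  conv_lhs => rw [χ.ham_eq, Derivation.sum_smul_apply]

/-- Both sides are derivations in `x`, so generators suffice. On functions the case `n = 0` is the
commutation of the `Y_k`, the case `n = 1` is the expansion of the Hamiltonian field in the `Y_k`,
and for `n ≥ 2` everything vanishes. On variables it is an identity of falling factorials. -/
theorem arcHam_arcT (hX : ∀ a b, X (X a b) = ⁅X a, X b⁆) (n : ℕ) (h : R)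
    (x : MvPolynomial (Fin ρ × ℕ) S) :
    χ.arcHam n h (χ.arcT x) = χ.arcT (χ.arcHam n h x) + n • χ.arcHam (n - 1) h x := by
  have key : ⁅χ.arcHam n h, χ.arcT⁆ = (n : ℂ) • χ.arcHam (n - 1) h := by
    apply derivation_ext'
    · intro s
      rw [Derivation.commutator_apply, Derivation.smul_apply, Nat.cast_smul_eq_nsmul, arcT_C, map_sum]
      rcases n with _ | _ | n
      · simp only [arcHam_C_zero, Derivation.leibniz, arcHam_X, arcT_C, smul_eq_mul,
          Nat.descFactorial_zero, one_smul, zero_add, Nat.sub_zero, Function.iterate_one,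
          Finset.sum_add_distrib, Finset.mul_sum, zero_smul]
        rw [Finset.sum_comm, ← Finset.sum_add_distrib, ← Finset.sum_sub_distrib]
        refine Finset.sum_eq_zero fun j _ => ?_
        rw [χ.ham_apply h (χ.Y j s), χ.ham_apply h s, map_sum]
        simp only [Derivation.leibniz, χ.Y_comm hX j, smul_eq_mul, map_sum, map_add, map_mul,
          Finset.sum_mul, Finset.mul_sum]
        rw [← Finset.sum_add_distrib, ← Finset.sum_sub_distrib]
        refine Finset.sum_eq_zero fun k _ => ?_
        ring
      · simp only [zero_add, χ.arcHam_C Nat.one_pos, Derivation.leibniz, arcHam_X, smul_eq_mul,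
          mul_zero, add_zero, map_zero, sub_zero, Nat.descFactorial_one, one_smul,
          Nat.sub_self, Function.iterate_zero_apply, arcHam_C_zero]
        rw [χ.ham_apply, map_sum]
        exact Finset.sum_congr rfl fun k _ => by rw [map_mul, mul_comm]
      · rw [χ.arcHam_C (by omega), χ.arcHam_C (by omega), map_zero, smul_zero, sub_zero]
        refine Finset.sum_eq_zero fun k _ => ?_
        rw [Derivation.leibniz, χ.arcHam_C (by omega), arcHam_X,
          Nat.descFactorial_eq_zero_iff_lt.2 (by simp), zero_smul, smul_zero, smul_zero, add_zero]
    · intro v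
      rw [Derivation.commutator_apply, Derivation.smul_apply, Nat.cast_smul_eq_nsmul, arcT_X,
        arcHam_X, arcHam_X, arcHam_X, sub_eq_iff_eq_add]
      simp only
      set u := (C (χ.ι (X h (χ.t v.1))) : MvPolynomial (Fin ρ × ℕ) S)
      generalize v.2 + 1 = l
      rcases n with _ | n
      · simp [Function.iterate_succ_apply' χ.arcT]
      · rw [Nat.add_sub_cancel, Nat.succ_sub_succ, Nat.succ_descFactorial_succ, smul_smul,
          map_nsmul]
        rcases le_or_gt (n + 1) l with h | h
        · rw [← Function.iterate_succ_apply' χ.arcT, show (l - (n + 1)).succ = l - n by omega,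
            ← add_smul]
          congr 1
          rw [Nat.descFactorial_succ]
          obtain ⟨d, rfl⟩ := Nat.exists_eq_add_of_le h
          rw [show n + 1 + d - n = d + 1 by omega]
          ring
        · rw [Nat.descFactorial_eq_zero_iff_lt.2 h, zero_smul, add_zero]
          rcases lt_or_eq_of_le (Nat.lt_succ_iff.1 h) with h' | rfl
          · rw [Nat.descFactorial_eq_zero_iff_lt.2 h', mul_zero, mul_zero]
          · rfl
  have := DFunLike.congr_fun key x
  rw [Derivation.commutator_apply, Derivation.smul_apply, Nat.cast_smul_eq_nsmul,
    sub_eq_iff_eq_add'] at this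
  exact this

/-- The arc space of an étale chart has no proper chiral Poisson subscheme. -/
theorem IsEtale.arc_eq_top {χ : PoissonChart X q ρ S} (hχ : χ.IsEtale) [q.IsPrime]
    {I : Ideal (MvPolynomial (Fin ρ × ℕ) S)} (hI : I ≠ ⊥)
    (hH : ∀ n i, ∀ f ∈ I, χ.arcHam n (χ.a i) f ∈ I) : I = ⊤ := by
  classical
  have := χ.isDomain
  have : CharZero S := charZero_of_injective_algebraMap (algebraMap ℂ S).injective
  obtain ⟨f, hf, hf0⟩ := Submodule.exists_mem_ne_zero_of_ne_bot hI
  have hex : ∃ d, ∃ p ∈ I, p ≠ 0 ∧ p.totalDegree = d := ⟨_, f, hf, hf0, rfl⟩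
  obtain ⟨p, hpI, hp0, hd⟩ := Nat.find_spec hex
  have hvars : p.vars = ∅ := by
    by_contra hne
    obtain ⟨⟨k₀, n⟩, hv, hmax⟩ :=
      Finset.exists_max_image p.vars Prod.snd (Finset.nonempty_iff_ne_empty.2 hne)
    refine Nat.find_min hex (m := (pderiv (k₀, n) p).totalDegree)
      (hd ▸ totalDegree_pderiv_lt (pderiv_ne_zero_of_mem_vars hv))
      ⟨_, ?_, pderiv_ne_zero_of_mem_vars hv, rfl⟩
    -- The mode of order `n + 1` sends the top variable `(k, n)` to `(n+1)! {a_i, t_k}`. Summing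
    -- against the inverse matrix `c` isolates one partial derivative of `p`, which has smaller
    -- degree and is nonzero.
    have h1 : ∀ i, ∑ k, χ.arcHam (n + 1) (χ.a i) (MvPolynomial.X (k, n)) * pderiv (k, n) p ∈ I := by
      intro i
      rw [← derivation_eq_sum_pderiv (fun s => χ.arcHam_C n.succ_pos _ s) _ hmax]
      · exact hH _ i p hpI
      · intro k m hm
        rw [arcHam_X, Nat.descFactorial_eq_zero_iff_lt.2 (by simpa using hm), zero_smul]
    have h2 : ((n + 1).factorial : MvPolynomial (Fin ρ × ℕ) S) * pderiv (k₀, n) p ∈ I := by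
      have h3 : ∑ i, C (χ.c k₀ i) * ∑ k, χ.arcHam (n + 1) (χ.a i) (MvPolynomial.X (k, n)) *
          pderiv (k, n) p ∈ I := Submodule.sum_mem _ fun i _ => Ideal.mul_mem_left _ _ (h1 i)
      convert h3 using 1
      simp only [arcHam_X, Nat.sub_self, Nat.descFactorial_self, Function.iterate_zero_apply,
        Finset.mul_sum]
      rw [Finset.sum_comm, Finset.sum_eq_single k₀]
      · have := congrArg (C (σ := Fin ρ × ℕ)) (χ.sum_c k₀ k₀)
        rw [if_pos rfl, map_sum, map_one] at this
        calc _ = 1 * (((n + 1).factorial : MvPolynomial (Fin ρ × ℕ) S) * pderiv (k₀, n) p) := by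
              rw [one_mul]
          _ = _ := by
            rw [← this, Finset.sum_mul]
            refine Finset.sum_congr rfl fun i _ => ?_
            rw [map_mul, nsmul_eq_mul]
            ring
      · intro k _ hk
        have := congrArg (C (σ := Fin ρ × ℕ)) (χ.sum_c k₀ k)
        rw [if_neg hk.symm, map_sum, map_zero] at this
        calc _ = (∑ i, C (χ.c k₀ i * χ.ι (X (χ.a i) (χ.t k)))) *
              (((n + 1).factorial : MvPolynomial (Fin ρ × ℕ) S) * pderiv (k, n) p) := by
              rw [Finset.sum_mul]
              refine Finset.sum_congr rfl fun i _ => ?_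
              rw [map_mul, nsmul_eq_mul]
              ring
          _ = 0 := by rw [this, zero_mul]
      · simp
    have hu : IsUnit ((n + 1).factorial : MvPolynomial (Fin ρ × ℕ) S) := by
      have : IsUnit (((n + 1).factorial : ℂ)) :=
        isUnit_iff_ne_zero.2 (by exact_mod_cast Nat.factorial_ne_zero _)
      have := this.map (algebraMap ℂ (MvPolynomial (Fin ρ × ℕ) S))
      rwa [map_natCast] at this
    exact (Ideal.unit_mul_mem_iff_mem I hu).1 h2
  obtain ⟨s, rfl⟩ : ∃ s, p = C s := by
    refine ⟨_, eq_C_of_pderiv_eq_zero fun i => pderiv_eq_zero_of_notMem_vars ?_⟩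
    rw [hvars]
    exact Finset.notMem_empty i
  -- The element of least degree is now a function on the chart itself, where zero modes act as
  -- Hamiltonian fields and the étale case of ideals of `S` applies.
  have hJ : I.comap (C (σ := Fin ρ × ℕ)) = ⊤ := by
    apply hχ.eq_top_of_stable
    · intro h
      have : s ∈ I.comap (C (σ := Fin ρ × ℕ)) := hpI
      rw [h, Submodule.mem_bot] at this
      exact hp0 (by rw [this, map_zero])
    · intro k s hs
      rw [Y_apply]
      refine Submodule.sum_mem _ fun i _ => Ideal.mul_mem_left _ _ ?_
      rw [Ideal.mem_comap, ← arcHam_C_zero]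
      exact hH 0 i _ hs
  exact Ideal.comap_eq_top_iff.1 hJ

end PoissonChart

/-- A derivation extends to the field of fractions. -/
theorem exists_derivation_fractionRing {B : Type*} [CommRing B] [IsDomain B] [Algebra ℂ B]
    (D : Derivation ℂ B B) : ∃ D' : Derivation ℂ (FractionRing B) (FractionRing B),
      ∀ b, D' (algebraMap B _ b) = algebraMap B _ (D b) := by
  let i : B →ₐ[ℂ] FractionRing B := IsScalarTower.toAlgHom ℂ B (FractionRing B)
  let g0 : B →ₐ[ℂ] TrivSqZeroExt (FractionRing B) (FractionRing B) :=
    sectionOfDerivation i (i.toLinearMap ∘ₗ D.toLinearMap) fun a b => by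
      change i (D (a * b)) = i a * i (D b) + i b * i (D a)
      rw [D.leibniz, map_add, smul_eq_mul, smul_eq_mul, map_mul, map_mul]
  have hf : ∀ b, (g0 b).fst = algebraMap B _ b := fun b => fst_sectionOfDerivation _ _ _ b
  have hs : ∀ b, (g0 b).snd = algebraMap B _ (D b) := fun b => snd_sectionOfDerivation _ _ _ b
  have hu : ∀ y : nonZeroDivisors B, IsUnit ((g0 : B →+* TrivSqZeroExt (FractionRing B) (FractionRing B)) y) := fun y => by
    rw [TrivSqZeroExt.isUnit_iff_isUnit_fst]
    change IsUnit (g0 (y : B)).fst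
    rw [hf]
    exact IsLocalization.map_units _ y
  let g1 := IsLocalization.lift (S := FractionRing B) hu
  have hg1 : ∀ b, g1 (algebraMap B _ b) = g0 b := fun b => IsLocalization.lift_eq hu b
  let g : FractionRing B →ₐ[ℂ] TrivSqZeroExt (FractionRing B) (FractionRing B) :=
    { g1 with
      commutes' := fun r => by
        rw [IsScalarTower.algebraMap_apply ℂ B (FractionRing B)]
        exact (hg1 _).trans (g0.commutes r) }
  have hfst : ∀ x, (g x).fst = x := by
    have : (TrivSqZeroExt.fstHom ℂ (FractionRing B) (FractionRing B)).toRingHom.comp g1 =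
        RingHom.id _ := by
      apply IsLocalization.ringHom_ext (nonZeroDivisors B)
      ext b
      change (g1 (algebraMap B _ b)).fst = algebraMap B _ b
      rw [hg1, hf]
    exact fun x => DFunLike.congr_fun this x
  refine ⟨derivationOfSection g hfst, fun b => ?_⟩
  change (g1 (algebraMap B _ b)).snd = _
  rw [hg1, hs]

namespace PoissonChart

open MvPolynomial

variable {R : Type*} [CommRing R] [Algebra ℂ R] {X : R →ₗ[ℂ] Derivation ℂ R R} {q : Ideal R}
  {ρ : ℕ} {S : Type*} [CommRing S] [Algebra ℂ S] (χ : PoissonChart X q ρ S)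

/-- The homomorphism from the arc algebra to the functions on the arc space of a chart. -/
noncomputable def arcRestrict : ArcAlgebra R →ₐ[ℂ] MvPolynomial (Fin ρ × ℕ) S :=
  arcLift ((IsScalarTower.toAlgHom ℂ S (MvPolynomial (Fin ρ × ℕ) S)).comp χ.ι) χ.arcT

theorem arcRestrict_mk_X (a : R) (n : ℕ) :
    χ.arcRestrict (Ideal.Quotient.mk _ (MvPolynomial.X (a, n))) = χ.arcT^[n] (C (χ.ι a)) :=
  arcLift_mk_X _ _ _ _

variable (ρ S) in
/-- The constant arcs. -/
noncomputable def constArc : MvPolynomial (Fin ρ × ℕ) S →ₐ[ℂ] S :=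
  (aeval fun _ => (0 : S)).restrictScalars ℂ

theorem constArc_C (s : S) : constArc ρ S (C s) = s := aeval_C _ s

theorem constArc_X (v : Fin ρ × ℕ) : constArc ρ S (MvPolynomial.X v) = 0 := aeval_X _ v

theorem constArc_arcT (f : MvPolynomial (Fin ρ × ℕ) S) : constArc ρ S (χ.arcT f) = 0 := by
  induction f using MvPolynomial.induction_on with
  | C s =>
    rw [arcT_C, map_sum]
    exact Finset.sum_eq_zero fun k _ => by rw [map_mul, constArc_X, mul_zero]
  | add p q hp hq => rw [map_add, map_add, hp, hq, add_zero]
  | mul_X p v hp =>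
    rw [Derivation.leibniz, map_add, smul_eq_mul, smul_eq_mul, map_mul, map_mul, hp, arcT_X,
      constArc_X, mul_zero, mul_zero, add_zero]

/-- An ideal that vanishes on constant arcs cannot contain `1`. -/
theorem IsEtale.eq_bot_of_stable {χ : PoissonChart X q ρ S} (hχ : χ.IsEtale) [q.IsPrime]
    {I : Ideal (MvPolynomial (Fin ρ × ℕ) S)} (hI : ∀ f ∈ I, constArc ρ S f = 0)
    (hH : ∀ n i, ∀ f ∈ I, χ.arcHam n (χ.a i) f ∈ I) : I = ⊥ := by
  have := χ.isDomain
  by_contra h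
  have h1 := hI 1 (hχ.arc_eq_top h hH ▸ Submodule.mem_top)
  rw [map_one] at h1
  exact one_ne_zero h1

/-- A homomorphism from the chart to a differential field extends to the arcs. -/
theorem IsEtale.exists_arcEval {χ : PoissonChart X q ρ S} (hχ : χ.IsEtale) [q.IsPrime]
    [Algebra.FiniteType ℂ R] {K : Type*} [CommRing K] [Algebra ℂ K] (D : Derivation ℂ K K)
    (ψ : S →ₐ[ℂ] K) : ∃ g : MvPolynomial (Fin ρ × ℕ) S →ₐ[ℂ] K, (∀ s, g (C s) = ψ s) ∧
      ∀ x, g (χ.arcT x) = D (g x) := by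
  let g0 : MvPolynomial (Fin ρ × ℕ) S →+* K :=
    eval₂Hom ψ.toRingHom fun v => D^[v.2 + 1] (ψ (χ.ι (χ.t v.1)))
  have hC : ∀ s, g0 (C s) = ψ s := fun s => eval₂Hom_C _ _ _
  have hX : ∀ v, g0 (MvPolynomial.X v) = D^[v.2 + 1] (ψ (χ.ι (χ.t v.1))) :=
    fun v => eval₂Hom_X' _ _ _
  refine ⟨{ g0 with commutes' := fun r => (hC _).trans (ψ.commutes r) }, hC, fun x => ?_⟩
  change g0 (χ.arcT x) = D (g0 x)
  -- `δ` measures the failure of the chain rule `D ψ(s) = ∑ D(ψ t_k) ψ(Y_k s)`. It is a derivation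
  -- along `ψ` that kills the coordinates, so it vanishes on an étale chart, and this is
  -- compatibility with the derivations on functions.
  let δ : S →ₗ[ℂ] K := D.toLinearMap ∘ₗ ψ.toLinearMap -
    ∑ k, LinearMap.mulLeft ℂ (D (ψ (χ.ι (χ.t k)))) ∘ₗ ψ.toLinearMap ∘ₗ (χ.Y k).toLinearMap
  have e : ∀ s, δ s = D (ψ s) - ∑ k, D (ψ (χ.ι (χ.t k))) * ψ (χ.Y k s) := fun s => by
    simp only [δ, LinearMap.sub_apply, LinearMap.sum_apply]
    rfl
  have h0 : ∀ s, δ s = 0 := by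
    refine hχ.eq_zero_of_along ψ δ (fun a b => ?_) fun j => ?_
    · simp only [e, map_mul, Derivation.leibniz, map_add, smul_eq_mul, mul_add,
        Finset.sum_add_distrib, mul_sub, Finset.mul_sum]
      have e1 : ∀ k, D (ψ (χ.ι (χ.t k))) * (ψ a * ψ (χ.Y k b)) =
        ψ a * (D (ψ (χ.ι (χ.t k))) * ψ (χ.Y k b)) := fun k => by ring
      have e2 : ∀ k, D (ψ (χ.ι (χ.t k))) * (ψ b * ψ (χ.Y k a)) =
        ψ b * (D (ψ (χ.ι (χ.t k))) * ψ (χ.Y k a)) := fun k => by ring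
      simp only [e1, e2]
      ring
    · rw [e, Finset.sum_eq_single j]
      · rw [χ.Y_t, if_pos rfl, map_one, mul_one, sub_self]
      · intro k _ hk
        rw [χ.Y_t, if_neg hk, map_zero, mul_zero]
      · simp
  induction x using MvPolynomial.induction_on with
  | C s =>
    have := h0 s
    rw [e, sub_eq_zero] at this
    rw [hC, arcT_C, map_sum, this]
    exact Finset.sum_congr rfl fun k _ => by
      rw [map_mul, hC, hX, mul_comm, zero_add, Function.iterate_one]
  | add p q hp hq => simp only [map_add, hp, hq]
  | mul_X p v hp =>
    rw [Derivation.leibniz, map_add, smul_eq_mul, smul_eq_mul, map_mul, map_mul, hp, arcT_X, hX,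
      map_mul, Derivation.leibniz, hX, smul_eq_mul, smul_eq_mul, ← Function.iterate_succ_apply' D]

theorem arcEval_arcRestrict {K : Type*} [CommRing K] [Algebra ℂ K] {D : Derivation ℂ K K}
    {g : MvPolynomial (Fin ρ × ℕ) S →ₐ[ℂ] K} (hg : ∀ x, g (χ.arcT x) = D (g x)) (a : R) (n : ℕ) :
    g (χ.arcRestrict (Ideal.Quotient.mk _ (MvPolynomial.X (a, n)))) = D^[n] (g (C (χ.ι a))) := by
  rw [arcRestrict_mk_X]
  induction n with
  | zero => rfl
  | succ n ih => rw [Function.iterate_succ_apply', hg, ih, Function.iterate_succ_apply']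

end PoissonChart

/-! ### Restriction of `gr V` to the arc space of an étale chart. -/

namespace VertexAlgebra

open MvPolynomial

variable {V : Type*} [AddCommGroup V] [Module ℂ V] [VertexAlgebra V]

section ChartOfGr

variable {q : Ideal (ZhuC2 V)} {ρ : ℕ} {S : Type*} [CommRing S] [Algebra ℂ S]
  (χ : PoissonChart (zhuHam V) q ρ S)

theorem arcRestrict_stable (n : ℕ) (h : ZhuC2 V) (x : ArcAlgebra (ZhuC2 V)) :
    ∃ y, arcToGr V y = grHam n h (arcToGr V x) ∧
      χ.arcRestrict y = χ.arcHam n h (χ.arcRestrict x) := by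
  obtain ⟨f, rfl⟩ := Ideal.Quotient.mk_surjective x
  induction f using MvPolynomial.induction_on with
  | C c =>
    have : Ideal.Quotient.mk (arcIdeal (ZhuC2 V)) (C c) = algebraMap ℂ _ c := rfl
    refine ⟨0, ?_, ?_⟩
    · rw [this, AlgHom.commutes, Derivation.map_algebraMap, map_zero]
    · rw [this, AlgHom.commutes, Derivation.map_algebraMap, map_zero]
  | add f g hf hg =>
    obtain ⟨y, h1, h2⟩ := hf
    obtain ⟨y', h1', h2'⟩ := hg
    exact ⟨y + y', by simp only [map_add, h1, h1'], by simp only [map_add, h2, h2']⟩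
  | mul_X f v hf =>
    obtain ⟨y, h1, h2⟩ := hf
    obtain ⟨a, l⟩ := v
    obtain ⟨y', h1', h2'⟩ : ∃ y, arcToGr V y =
        grHam n h (arcToGr V (Ideal.Quotient.mk _ (MvPolynomial.X (a, l)))) ∧ χ.arcRestrict y =
        χ.arcHam n h (χ.arcRestrict (Ideal.Quotient.mk _ (MvPolynomial.X (a, l)))) := by
      refine ⟨l.descFactorial n • Ideal.Quotient.mk _ (MvPolynomial.X (zhuHam V h a, l - n)), ?_, ?_⟩
      · rw [map_nsmul, arcToGr_mk_X, arcToGr_mk_X,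
          Derivation.iterate_of_commutator (H := fun n => grHam n h) (fun n x => grHam_grT n h x)
            (fun n hn => grHam_zhuToGr_of_pos hn h a), grHam_zhuToGr_zero]
        rfl
      · rw [map_nsmul, χ.arcRestrict_mk_X, χ.arcRestrict_mk_X,
          Derivation.iterate_of_commutator (H := fun n => χ.arcHam n h)
            (fun n x => χ.arcHam_arcT zhuHam_lie n h x) (fun n hn => χ.arcHam_C hn h _),
          χ.arcHam_C_zero, χ.ham_ι]
    refine ⟨Ideal.Quotient.mk _ f * y' + Ideal.Quotient.mk _ (MvPolynomial.X (a, l)) * y, ?_, ?_⟩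
    · rw [map_add, map_mul, map_mul, h1, h1', map_mul, map_mul, Derivation.leibniz]
      rfl
    · rw [map_add, map_mul, map_mul, h2, h2', map_mul, map_mul, Derivation.leibniz]
      rfl

/-- Both sides agree on `R_V` and kill its derivatives. Hence functions on constant arcs depend only
on the component of degree zero of `gr V`. -/
theorem constArc_arcRestrict (x : ArcAlgebra (ZhuC2 V)) :
    PoissonChart.constArc ρ S (χ.arcRestrict x) = χ.ι (grToZhu V (arcToGr V x)) := by
  have : (PoissonChart.constArc ρ S).comp χ.arcRestrict =
      (χ.ι.comp (grToZhu V)).comp (arcToGr V) := by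
    apply arcAlgebra_hom_ext
    intro a n
    simp only [AlgHom.comp_apply]
    rw [χ.arcRestrict_mk_X, arcToGr_mk_X]
    rcases n with _ | n
    · simp only [Function.iterate_zero_apply]
      rw [PoissonChart.constArc_C, grToZhu_zhuToGr]
    · rw [Function.iterate_succ_apply', Function.iterate_succ_apply', χ.constArc_arcT,
        grToZhu_grT, map_zero]
  exact DFunLike.congr_fun this x

variable {χ}

/-- The image of the kernel generates an ideal that is stable under the modes, by
`arcRestrict_stable`, and that vanishes on constant arcs, because there the restriction factors
through `gr V`. Such an ideal is zero. -/
theorem arcRestrict_eq_zero (hχ : χ.IsEtale) [q.IsPrime] {x : ArcAlgebra (ZhuC2 V)}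
    (hx : arcToGr V x = 0) : χ.arcRestrict x = 0 := by
  set I : Ideal (MvPolynomial (Fin ρ × ℕ) S) :=
    Ideal.span {f | ∃ x, arcToGr V x = 0 ∧ χ.arcRestrict x = f} with hI
  have hb : I = ⊥ := by
    refine hχ.eq_bot_of_stable (fun f hf => ?_) fun n i f hf => ?_
    · have : I ≤ RingHom.ker (PoissonChart.constArc ρ S) := by
        rw [hI, Ideal.span_le]
        rintro _ ⟨x, hx, rfl⟩
        change PoissonChart.constArc ρ S (χ.arcRestrict x) = 0
        rw [constArc_arcRestrict, hx, map_zero, map_zero]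
      exact this hf
    · rw [hI] at hf
      induction hf using Submodule.span_induction with
      | mem f hf =>
        obtain ⟨x, hx, rfl⟩ := hf
        obtain ⟨y, h1, h2⟩ := arcRestrict_stable χ n (χ.a i) x
        rw [hx, map_zero] at h1
        exact Ideal.subset_span ⟨y, h1, h2⟩
      | zero => rw [map_zero]; exact zero_mem _
      | add x y _ _ hx hy => rw [map_add]; exact add_mem hx hy
      | smul r x hx hx' =>
        rw [smul_eq_mul, Derivation.leibniz]
        exact add_mem (Ideal.mul_mem_left _ _ hx') (Ideal.mul_mem_right _ _ hx)
  rw [← Submodule.mem_bot (MvPolynomial (Fin ρ × ℕ) S), ← hb]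
  exact Ideal.subset_span ⟨x, hx, rfl⟩

theorem exists_grRestrict (hχ : χ.IsEtale) [q.IsPrime] :
    ∃ Θ : Gr V →ₐ[ℂ] MvPolynomial (Fin ρ × ℕ) S, ∀ x, Θ (arcToGr V x) = χ.arcRestrict x :=
  ⟨(Ideal.Quotient.liftₐ (RingHom.ker (arcToGr V)) χ.arcRestrict
    fun _ hx => arcRestrict_eq_zero hχ hx).comp
      (Ideal.quotientKerAlgEquivOfSurjective arcToGr_surjective).symm.toAlgHom, fun x => by
    have : (Ideal.quotientKerAlgEquivOfSurjective (arcToGr_surjective (V := V))).symm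
        (arcToGr V x) = Ideal.Quotient.mk _ x := by
      rw [AlgEquiv.symm_apply_eq]
      rfl
    exact congrArg (Ideal.Quotient.liftₐ (RingHom.ker (arcToGr V)) χ.arcRestrict
      fun _ hx => arcRestrict_eq_zero hχ hx) this⟩

/-- The restriction of functions on `SS(V)` to the arc space of a chart. -/
noncomputable def grRestrict (hχ : χ.IsEtale) [q.IsPrime] :
    Gr V →ₐ[ℂ] MvPolynomial (Fin ρ × ℕ) S := (exists_grRestrict hχ).choose

theorem grRestrict_arcToGr (hχ : χ.IsEtale) [q.IsPrime] (x : ArcAlgebra (ZhuC2 V)) :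
    grRestrict hχ (arcToGr V x) = χ.arcRestrict x := (exists_grRestrict hχ).choose_spec x

theorem grRestrict_grHam (hχ : χ.IsEtale) [q.IsPrime] (n : ℕ) (h : ZhuC2 V) (x : Gr V) :
    grRestrict hχ (grHam n h x) = χ.arcHam n h (grRestrict hχ x) := by
  obtain ⟨x, rfl⟩ := arcToGr_surjective x
  obtain ⟨y, h1, h2⟩ := arcRestrict_stable χ n h x
  rw [← h1, grRestrict_arcToGr, grRestrict_arcToGr, h2]

theorem constArc_grRestrict (hχ : χ.IsEtale) [q.IsPrime] (x : Gr V) :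
    PoissonChart.constArc ρ S (grRestrict hχ x) = χ.ι (grToZhu V x) := by
  obtain ⟨x, rfl⟩ := arcToGr_surjective x
  rw [grRestrict_arcToGr, constArc_arcRestrict]

theorem grRestrict_zhuToGr (hχ : χ.IsEtale) [q.IsPrime] (a : ZhuC2 V) :
    grRestrict hχ (zhuToGr V a) = C (χ.ι a) := by
  have := grRestrict_arcToGr hχ (Ideal.Quotient.mk _ (MvPolynomial.X (a, 0)))
  rwa [arcToGr_mk_X, χ.arcRestrict_mk_X] at this

/-- Chiral Poisson ideals that lie over `q` vanish on the arc space of a chart of `q`. -/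
theorem le_ker_grRestrict (hχ : χ.IsEtale) [q.IsPrime] {P : Ideal (Gr V)} (hP : IsChiralPoisson P)
    (hq : P ≤ q.comap (grToZhu V)) : P ≤ RingHom.ker (grRestrict hχ) := by
  set I : Ideal (MvPolynomial (Fin ρ × ℕ) S) := P.map (grRestrict hχ) with hI
  have hb : I = ⊥ := by
    refine hχ.eq_bot_of_stable (fun f hf => ?_) fun n i f hf => ?_
    · have : I ≤ RingHom.ker (PoissonChart.constArc ρ S) := by
        rw [hI, Ideal.map_le_iff_le_comap]
        intro x hx
        change PoissonChart.constArc ρ S (grRestrict hχ x) = 0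
        rw [constArc_grRestrict, χ.eq_zero_iff]
        exact hq hx
      exact this hf
    · rw [hI, Ideal.map] at hf
      induction hf using Submodule.span_induction with
      | mem f hf =>
        obtain ⟨x, hx, rfl⟩ := hf
        have := grRestrict_grHam hχ n (χ.a i) x
        change χ.arcHam n (χ.a i) (grRestrict hχ x) ∈ I
        rw [← this]
        exact Ideal.mem_map_of_mem _ (hP n _ x hx)
      | zero => rw [map_zero]; exact zero_mem _
      | add x y _ _ hx hy => rw [map_add]; exact add_mem hx hy
      | smul r x hx hx' =>
        rw [smul_eq_mul, Derivation.leibniz]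
        exact add_mem (Ideal.mul_mem_left _ _ hx') (Ideal.mul_mem_right _ _ hx)
  intro x hx
  rw [RingHom.mem_ker, ← Submodule.mem_bot (MvPolynomial (Fin ρ × ℕ) S), ← hb]
  exact Ideal.mem_map_of_mem _ hx

/-- The kernel is chiral Poisson since restriction intertwines the modes, and restricting further to
constant arcs shows that it lies over `q`. In particular it depends on `q` only, not on the chart.
-/
theorem ker_grRestrict (hχ : χ.IsEtale) [q.IsPrime] :
    RingHom.ker (grRestrict hχ) = chiralPoissonCore (q.comap (grToZhu V)) := by
  apply le_antisymm
  · apply (chiralPoissonCore_isGreatest _).2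
    refine ⟨isChiralPoisson_of_grHam fun n h x hx => ?_, fun x hx => ?_⟩
    · rw [RingHom.mem_ker] at hx ⊢
      have := grRestrict_grHam hχ n h x
      rw [hx, map_zero] at this
      exact this
    · rw [Ideal.mem_comap, ← χ.eq_zero_iff, ← constArc_grRestrict hχ, (RingHom.mem_ker).1 hx,
        map_zero]
  · exact le_ker_grRestrict hχ (chiralPoissonCore_isGreatest _).1.1
      (chiralPoissonCore_isGreatest _).1.2

end ChartOfGr

end VertexAlgebra

/-! ### Points -/

theorem exists_algHom_ker_eq {A : Type*} [CommRing A] [Algebra ℂ A] [Algebra.FiniteType ℂ A]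
    (m : Ideal A) [hm : m.IsMaximal] : ∃ π : A →ₐ[ℂ] ℂ, RingHom.ker π = m := by
  let _ : Field (A ⧸ m) := Ideal.Quotient.field m
  have : Module.Finite ℂ (A ⧸ m) := finite_of_finite_type_of_isJacobsonRing ℂ (A ⧸ m)
  have hb : Function.Bijective (algebraMap ℂ (A ⧸ m)) :=
    IsAlgClosed.algebraMap_bijective_of_isIntegral
  let e : ℂ ≃ₐ[ℂ] A ⧸ m := AlgEquiv.ofBijective (Algebra.ofId ℂ (A ⧸ m)) hb
  refine ⟨(e.symm : A ⧸ m →ₐ[ℂ] ℂ).comp (Ideal.Quotient.mkₐ ℂ m), ?_⟩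
  ext x
  rw [RingHom.mem_ker, AlgHom.comp_apply]
  change e.symm (Ideal.Quotient.mk m x) = 0 ↔ _
  rw [map_eq_zero_iff _ e.symm.injective, Ideal.Quotient.eq_zero_iff_mem]

/-- **Nullstellensatz**. -/
theorem exists_algHom_ne_zero {A : Type*} [CommRing A] [IsDomain A] [Algebra ℂ A]
    [Algebra.FiniteType ℂ A] {s : A} (hs : s ≠ 0) : ∃ π : A →ₐ[ℂ] ℂ, π s ≠ 0 := by
  have hJ : IsJacobsonRing A := isJacobsonRing_of_finiteType (A := ℂ)
  have h := IsJacobsonRing.out' (R := A) ⊥ (Ideal.isRadical_iff_quotient_reduced ⊥ |>.2 inferInstance)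
  have h1 : s ∉ Ideal.jacobson (⊥ : Ideal A) := by rwa [h]
  rw [Ideal.jacobson, Ideal.mem_sInf] at h1
  push Not at h1
  obtain ⟨m, ⟨-, hm⟩, hsm⟩ := h1
  obtain ⟨π, hπ⟩ := exists_algHom_ker_eq m
  refine ⟨π, fun h0 => hsm ?_⟩
  rw [← hπ]
  exact h0

theorem PoissonChart.finiteType {R : Type*} [CommRing R] [Algebra ℂ R] [Algebra.FiniteType ℂ R]
    {X : R →ₗ[ℂ] Derivation ℂ R R} {q : Ideal R} {ρ : ℕ} {S : Type*} [CommRing S] [Algebra ℂ S]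
    (χ : PoissonChart X q ρ S) : Algebra.FiniteType ℂ S := by
  obtain ⟨G, hG⟩ := Algebra.FiniteType.out (R := ℂ) (A := R)
  obtain ⟨v, hv⟩ := χ.isUnit.exists_right_inv
  classical
  refine ⟨insert v (G.image χ.ι), ?_⟩
  rw [eq_top_iff]
  rintro s -
  have h1 : ∀ f, χ.ι f ∈ Algebra.adjoin ℂ ((insert v (G.image χ.ι) : Finset S) : Set S) := by
    intro f
    have hf : f ∈ Algebra.adjoin ℂ (G : Set R) := hG ▸ Algebra.mem_top
    have h2 : χ.ι f ∈ (Algebra.adjoin ℂ (G : Set R)).map χ.ι := ⟨f, hf, rfl⟩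
    rw [AlgHom.map_adjoin] at h2
    refine Algebra.adjoin_mono ?_ h2
    rw [Finset.coe_insert, Finset.coe_image]
    exact Set.subset_insert _ _
  obtain ⟨N, f, h⟩ := χ.exists_mul s
  have : s = v ^ N * χ.ι f := by
    rw [← h, ← mul_assoc, ← mul_pow, mul_comm v, hv, one_pow, one_mul]
  rw [this]
  exact mul_mem (pow_mem (Algebra.subset_adjoin (by simp)) _) (h1 f)

/-- The index set may be infinite, so the Nullstellensatz is applied to `S` only: first a point of
`S` at which some coefficient survives, then values of the variables. -/
theorem exists_arc_ne_zero {S σ : Type*} [CommRing S] [IsDomain S] [Algebra ℂ S]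
    [Algebra.FiniteType ℂ S] {p : MvPolynomial σ S} (hp : p ≠ 0) :
    ∃ π : MvPolynomial σ S →ₐ[ℂ] ℂ, π p ≠ 0 := by
  obtain ⟨m, hm⟩ := MvPolynomial.ne_zero_iff.1 hp
  obtain ⟨π, hπ⟩ := exists_algHom_ne_zero hm
  have h1 : MvPolynomial.map π.toRingHom p ≠ 0 := by
    rw [MvPolynomial.ne_zero_iff]
    exact ⟨m, by rwa [MvPolynomial.coeff_map]⟩
  obtain ⟨x, hx⟩ : ∃ x : σ → ℂ, MvPolynomial.eval x (MvPolynomial.map π.toRingHom p) ≠ 0 := by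
    by_contra! hc
    exact h1 (MvPolynomial.funext fun x => by rw [hc, map_zero])
  refine ⟨{ (MvPolynomial.eval x).comp (MvPolynomial.map π.toRingHom) with
    commutes' := fun r => ?_ }, hx⟩
  have : algebraMap ℂ (MvPolynomial σ S) r = MvPolynomial.C (algebraMap ℂ S r) := rfl
  change MvPolynomial.eval x (MvPolynomial.map π.toRingHom (algebraMap ℂ _ r)) = _
  rw [this, MvPolynomial.map_C, MvPolynomial.eval_C]
  exact π.commutes r

/-! ### Density of the points of a chart and their chiral Poisson cores. -/

namespace VertexAlgebra

open MvPolynomial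

universe u

variable {V : Type u} [AddCommGroup V] [Module ℂ V] [VertexAlgebra V]

section Density

variable {q : Ideal (ZhuC2 V)} {ρ : ℕ} {S : Type*} [CommRing S] [Algebra ℂ S]
  {χ : PoissonChart (zhuHam V) q ρ S}

/-- After inverting `Δ` the restriction becomes surjective, because the variable `(k, n)` is the
image of `T^(n+1) t_k`. -/
theorem exists_grRestrict_eq (hχ : χ.IsEtale) [q.IsPrime] (f : MvPolynomial (Fin ρ × ℕ) S) :
    ∃ (N : ℕ) (x : Gr V), C (χ.ι χ.Δ) ^ N * f = grRestrict hχ x := by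
  induction f using MvPolynomial.induction_on with
  | C s =>
    obtain ⟨N, f, h⟩ := χ.exists_mul s
    exact ⟨N, zhuToGr V f, by rw [grRestrict_zhuToGr, ← h, map_mul, map_pow]⟩
  | add f g hf hg =>
    obtain ⟨N, x, hx⟩ := hf
    obtain ⟨M, y, hy⟩ := hg
    refine ⟨N + M, zhuToGr V χ.Δ ^ M * x + zhuToGr V χ.Δ ^ N * y, ?_⟩
    rw [map_add, map_mul, map_mul, map_pow, map_pow, grRestrict_zhuToGr, ← hx, ← hy]
    ring
  | mul_X f v hf =>
    obtain ⟨N, x, hx⟩ := hf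
    obtain ⟨k, n⟩ := v
    refine ⟨N, x * arcToGr V (Ideal.Quotient.mk _ (MvPolynomial.X (χ.t k, n + 1))), ?_⟩
    rw [map_mul, ← hx, grRestrict_arcToGr, χ.arcRestrict_mk_X, χ.arcT_iterate_t, mul_assoc]

theorem exists_mem_grRestrict_eq (hχ : χ.IsEtale) [q.IsPrime] {P : Ideal (Gr V)}
    {f : MvPolynomial (Fin ρ × ℕ) S} (hf : f ∈ P.map (grRestrict hχ)) :
    ∃ (N : ℕ), ∃ x ∈ P, C (χ.ι χ.Δ) ^ N * f = grRestrict hχ x := by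
  rw [Ideal.map] at hf
  induction hf using Submodule.span_induction with
  | mem f hf =>
    obtain ⟨x, hx, rfl⟩ := hf
    exact ⟨0, x, hx, by rw [pow_zero, one_mul]⟩
  | zero => exact ⟨0, 0, zero_mem _, by rw [map_zero, mul_zero]⟩
  | add f g _ _ hf hg =>
    obtain ⟨N, x, hxP, hx⟩ := hf
    obtain ⟨M, y, hyP, hy⟩ := hg
    refine ⟨N + M, zhuToGr V χ.Δ ^ M * x + zhuToGr V χ.Δ ^ N * y,
      add_mem (P.mul_mem_left _ hxP) (P.mul_mem_left _ hyP), ?_⟩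
    rw [map_add, map_mul, map_mul, map_pow, map_pow, grRestrict_zhuToGr, ← hx, ← hy]
    ring
  | smul r f hf hf' =>
    obtain ⟨N, x, hxP, hx⟩ := hf'
    obtain ⟨M, y, hy⟩ := exists_grRestrict_eq hχ r
    refine ⟨M + N, y * x, P.mul_mem_left _ hxP, ?_⟩
    rw [map_mul, ← hx, ← hy, smul_eq_mul]
    ring

/-- The chiral Poisson core of a point of the arc space of a chart. -/
theorem chiralPoissonCore_eq (hχ : χ.IsEtale) [q.IsPrime] {y : Ideal (Gr V)} [hy : y.IsPrime]
    (hle : RingHom.ker (grRestrict hχ) ≤ y) (hΔ : zhuToGr V χ.Δ ∉ y) :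
    chiralPoissonCore y = RingHom.ker (grRestrict hχ) := by
  obtain ⟨hP, hPy⟩ := (chiralPoissonCore_isGreatest y).1
  apply le_antisymm
  · set P := chiralPoissonCore y with hPdef
    have hb : P.map (grRestrict hχ) = ⊥ := by
      by_contra hne
      -- A nonzero image would be everything. Clearing denominators in `1` puts a power of `Δ` into
      -- `P + ker`, which is contained in `y`, against the choice of `y`.
      have htop := hχ.arc_eq_top hne fun n i f hf => ?_
      · have h1 : (1 : MvPolynomial (Fin ρ × ℕ) S) ∈ P.map (grRestrict hχ) :=
          htop ▸ Submodule.mem_top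
        obtain ⟨N, x, hx, e⟩ := exists_mem_grRestrict_eq hχ h1
        rw [mul_one, ← grRestrict_zhuToGr hχ, ← map_pow, ← sub_eq_zero, ← map_sub] at e
        have h2 : zhuToGr V χ.Δ ^ N - x ∈ y := hle e
        have h3 := add_mem h2 (hPy hx)
        rw [sub_add_cancel] at h3
        exact hΔ (hy.mem_of_pow_mem N h3)
      · rw [Ideal.map] at hf
        induction hf using Submodule.span_induction with
        | mem f hf =>
          obtain ⟨x, hx, rfl⟩ := hf
          have := grRestrict_grHam hχ n (χ.a i) x
          change χ.arcHam n (χ.a i) (grRestrict hχ x) ∈ _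
          rw [← this]
          exact Ideal.mem_map_of_mem _ (hP n _ x hx)
        | zero => rw [map_zero]; exact zero_mem _
        | add x y _ _ hx hy => rw [map_add]; exact add_mem hx hy
        | smul r x hx hx' =>
          rw [smul_eq_mul, Derivation.leibniz]
          exact add_mem (Ideal.mul_mem_left _ _ hx') (Ideal.mul_mem_right _ _ hx)
    intro x hx
    rw [RingHom.mem_ker, ← Submodule.mem_bot (MvPolynomial (Fin ρ × ℕ) S), ← hb]
    exact Ideal.mem_map_of_mem _ hx
  · refine (chiralPoissonCore_isGreatest y).2 ⟨?_, hle⟩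
    rw [ker_grRestrict hχ]
    exact (chiralPoissonCore_isGreatest _).1.1

/-- The points of the arc space of a chart are dense. -/
theorem exists_point_notMem (hχ : χ.IsEtale) [q.IsPrime] [Algebra.FiniteType ℂ (ZhuC2 V)]
    {g : Gr V} (hg : grRestrict hχ g ≠ 0) : ∃ y : SingularSupport V,
      RingHom.ker (grRestrict hχ) ≤ y.asIdeal ∧ zhuToGr V χ.Δ ∉ y.asIdeal ∧ g ∉ y.asIdeal := by
  have := χ.isDomain
  have := χ.finiteType
  obtain ⟨π, hπ⟩ := exists_arc_ne_zero hg
  have hsurj : Function.Surjective (π.comp (grRestrict hχ)) := fun c =>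
    ⟨algebraMap ℂ _ c, AlgHom.commutes _ c⟩
  refine ⟨⟨RingHom.ker (π.comp (grRestrict hχ)), RingHom.ker_isMaximal_of_surjective _ hsurj⟩,
    fun x hx => ?_, fun h => ?_, hπ⟩
  · rw [RingHom.mem_ker] at hx ⊢
    rw [AlgHom.comp_apply, hx, map_zero]
  · rw [RingHom.mem_ker, AlgHom.comp_apply, grRestrict_zhuToGr] at h
    exact ((χ.isUnit.map C).map π).ne_zero h

/-- The arc space of an étale chart lies in the closure of a single chiral symplectic core. -/
theorem exists_subset_closure (hχ : χ.IsEtale) [q.IsPrime] [Algebra.FiniteType ℂ (ZhuC2 V)] :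
    ∃ x : SingularSupport V, ∀ y : SingularSupport V, RingHom.ker (grRestrict hχ) ≤ y.asIdeal →
      y ∈ closure (chiralSymplecticCore x) := by
  have := χ.isDomain
  obtain ⟨x, hx1, hx2, -⟩ := exists_point_notMem hχ (g := 1) (by rw [map_one]; exact one_ne_zero)
  have hx := chiralPoissonCore_eq hχ hx1 hx2
  refine ⟨x, fun y hy => ?_⟩
  have hind : Topology.IsInducing (MaximalSpectrum.toPrimeSpectrum (R := Gr V)) := ⟨rfl⟩
  rw [hind.closure_eq_preimage_closure_image, Set.mem_preimage,
    ← PrimeSpectrum.zeroLocus_vanishingIdeal_eq_closure, PrimeSpectrum.mem_zeroLocus]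
  intro g hg
  rw [SetLike.mem_coe, PrimeSpectrum.mem_vanishingIdeal] at hg
  by_contra hgy
  have hg0 : grRestrict hχ g ≠ 0 := fun h => hgy (hy h)
  -- This `z` has the same chiral Poisson core as `x`, the kernel of the restriction, so `g` should
  -- vanish at it.
  obtain ⟨z, hz1, hz2, hz3⟩ := exists_point_notMem hχ hg0
  exact hz3 (hg _ ⟨z, (chiralPoissonCore_eq hχ hz1 hz2).trans hx.symm, rfl⟩)

end Density

/-- Every point of `J_∞ R_V` lies in the closure of the arc space of a chart. -/
theorem exists_arcRestrict_eq_zero [Algebra.FiniteType ℂ (ZhuC2 V)]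
    (het : ∀ (q : Ideal (ZhuC2 V)) [q.IsPrime] (ρ : ℕ) (S : Type u) [CommRing S] [Algebra ℂ S]
      (χ : PoissonChart (zhuHam V) q ρ S), χ.IsEtale)
    {k : Type u} [CommRing k] [IsDomain k] [Algebra ℂ k] (ψ : ArcAlgebra (ZhuC2 V) →ₐ[ℂ] k) :
    ∃ (q : Ideal (ZhuC2 V)) (_ : q.IsPrime) (_ : IsPoissonIdeal (zhuHam V) q) (ρ : ℕ)
      (S : Type u) (_ : CommRing S) (_ : Algebra ℂ S) (χ : PoissonChart (zhuHam V) q ρ S),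
      ∀ f, χ.arcRestrict f = 0 → ψ f = 0 := by
  let τ := taylorHom (arcD (ZhuC2 V)) ψ
  let α : ZhuC2 V →ₐ[ℂ] PowerSeries k := τ.comp (arcOf (ZhuC2 V))
  have hdom : IsDomain (PowerSeries k) := inferInstance
  set q₀ : Ideal (ZhuC2 V) := RingHom.ker α with hq₀
  have hq₀p : q₀.IsPrime := RingHom.ker_isPrime _
  have hqp : (poissonCore (zhuHam V) q₀).IsPrime := inferInstance
  have hP := isPoissonIdeal_poissonCore (zhuHam V) q₀
  obtain ⟨ρ, h1, h2⟩ := exists_rank (zhuHam V) hqp.ne_top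
  -- The ideal of minors is Poisson, so if it vanished along the arc it would lie in the Poisson
  -- core. Thus a minor can be chosen that is nonzero on the arc itself.
  have h3 : ¬ minorIdeal (zhuHam V) ρ ≤ q₀ := fun h =>
    h1 (le_poissonCore (isPoissonIdeal_minorIdeal zhuHam_lie ρ) h)
  obtain ⟨a, t, hdet⟩ := exists_det_notMem h3
  obtain ⟨χ, -, -, hΔ⟩ := exists_chart hP a t (fun h => hdet (poissonCore_le _ _ h)) h2
  refine ⟨_, hqp, hP, ρ, _, _, _, χ, fun f hf => ?_⟩
  have hχ := het _ ρ _ χ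
  -- The chosen minor is nonzero along the arc but need not be invertible in `k[[t]]`; the arc
  -- enters the chart only over the fraction field.
  obtain ⟨D, hD⟩ := exists_derivation_fractionRing (powerSeriesD k)
  let i : PowerSeries k →ₐ[ℂ] FractionRing (PowerSeries k) :=
    IsScalarTower.toAlgHom ℂ (PowerSeries k) (FractionRing (PowerSeries k))
  have hi : Function.Injective i := IsFractionRing.injective _ _
  obtain ⟨ψ₀, hψ₀⟩ := χ.exists_lift (i.comp α) (fun f hf => by
    rw [AlgHom.comp_apply, (RingHom.mem_ker).1 (poissonCore_le _ _ hf), map_zero]) (by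
    rw [isUnit_iff_ne_zero, hΔ, AlgHom.comp_apply]
    exact fun h => hdet ((map_eq_zero_iff i hi).1 h))
  obtain ⟨g, hg1, hg2⟩ := hχ.exists_arcEval D ψ₀
  have hgi : g.comp χ.arcRestrict = i.comp τ := by
    apply arcAlgebra_hom_ext
    intro a n
    rw [AlgHom.comp_apply, χ.arcEval_arcRestrict hg2, hg1, hψ₀, AlgHom.comp_apply, AlgHom.comp_apply,
      ← arcD_iterate_arcOf]
    change D^[n] (i (α a)) = i (taylorHom (arcD (ZhuC2 V)) ψ ((arcD (ZhuC2 V))^[n] (arcOf _ a)))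
    rw [← powerSeriesD_iterate_taylorHom]
    change D^[n] (i (α a)) = i ((powerSeriesD k)^[n] (α a))
    induction n with
    | zero => rfl
    | succ n ih => rw [Function.iterate_succ_apply', ih, Function.iterate_succ_apply']; exact hD _
  have h4 : i (τ f) = 0 := by
    have := DFunLike.congr_fun hgi f
    rw [AlgHom.comp_apply, hf, map_zero] at this
    exact this.symm
  rw [map_eq_zero_iff i hi] at h4
  rw [← constantCoeff_taylorHom (arcD (ZhuC2 V))]
  change PowerSeries.coeff 0 (τ f) = 0
  rw [h4, map_zero]

end VertexAlgebra

/-! ### The cover by closures and the homeomorphisms, given that all charts are étale. -/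

namespace VertexAlgebra

open MvPolynomial

universe u

variable {V : Type u} [AddCommGroup V] [Module ℂ V] [VertexAlgebra V]

theorem exists_subset_closure_of_prime [Algebra.FiniteType ℂ (ZhuC2 V)]
    (het : ∀ (q : Ideal (ZhuC2 V)) [q.IsPrime] (ρ : ℕ) (S : Type u) [CommRing S] [Algebra ℂ S]
      (χ : PoissonChart (zhuHam V) q ρ S), χ.IsEtale)
    (q : Ideal (ZhuC2 V)) [hq : q.IsPrime] (hP : IsPoissonIdeal (zhuHam V) q) :
    ∃ x : SingularSupport V, ∀ y : SingularSupport V,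
      chiralPoissonCore (q.comap (grToZhu V)) ≤ y.asIdeal →
        y ∈ closure (chiralSymplecticCore x) := by
  obtain ⟨ρ, h1, h2⟩ := exists_rank (zhuHam V) hq.ne_top
  obtain ⟨a, t, hdet⟩ := exists_det_notMem h1
  obtain ⟨χ, -, -, -⟩ := exists_chart hP a t hdet h2
  have hχ := het q ρ _ χ
  rw [← ker_grRestrict hχ]
  exact exists_subset_closure hχ

/-- Each point of `SS(V)`, viewed as a point of `J_∞ R_V`, contains the kernel of the restriction to
a chart of some Poisson prime. One chiral symplectic core per Poisson prime is enough. -/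
theorem exists_finite_closure_cover [Algebra.FiniteType ℂ (ZhuC2 V)]
    (het : ∀ (q : Ideal (ZhuC2 V)) [q.IsPrime] (ρ : ℕ) (S : Type u) [CommRing S] [Algebra ℂ S]
      (χ : PoissonChart (zhuHam V) q ρ S), χ.IsEtale)
    (hfin : {q : Ideal (ZhuC2 V) | q.IsPrime ∧ IsPoissonIdeal (zhuHam V) q}.Finite) :
    ∃ S : Set (SingularSupport V), S.Finite ∧
      ⋃ x ∈ S, closure (chiralSymplecticCore x) = Set.univ := by
  have := hfin.to_subtype
  choose x hx using fun q : {q : Ideal (ZhuC2 V) | q.IsPrime ∧ IsPoissonIdeal (zhuHam V) q} =>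
    have := q.2.1
    exists_subset_closure_of_prime het q.1 q.2.2
  refine ⟨Set.range x, Set.finite_range x, Set.eq_univ_of_forall fun y => ?_⟩
  have hy := y.isMaximal.isPrime
  obtain ⟨q, hq, hP, ρ, S, _, _, χ, hχy⟩ := exists_arcRestrict_eq_zero het
    (k := Gr V ⧸ y.asIdeal) ((Ideal.Quotient.mkₐ ℂ y.asIdeal).comp (arcToGr V))
  refine Set.mem_biUnion ⟨⟨q, hq, hP⟩, rfl⟩ (hx ⟨q, hq, hP⟩ y ?_)
  have hχ := het q ρ S χ
  rw [← ker_grRestrict hχ]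
  intro f hf
  obtain ⟨f, rfl⟩ := arcToGr_surjective f
  rw [RingHom.mem_ker, grRestrict_arcToGr] at hf
  exact Ideal.Quotient.eq_zero_iff_mem.1 (hχy f hf)

/-- Every point is in the closure of the arcs of some chart, and there the kernel vanishes by
`arcRestrict_eq_zero`. -/
theorem ker_arcToGr_le [Algebra.FiniteType ℂ (ZhuC2 V)]
    (het : ∀ (q : Ideal (ZhuC2 V)) [q.IsPrime] (ρ : ℕ) (S : Type u) [CommRing S] [Algebra ℂ S]
      (χ : PoissonChart (zhuHam V) q ρ S), χ.IsEtale)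
    (y : Ideal (ArcAlgebra (ZhuC2 V))) [hy : y.IsPrime] : RingHom.ker (arcToGr V) ≤ y := by
  obtain ⟨q, hq, -, ρ, S, _, _, χ, hχy⟩ := exists_arcRestrict_eq_zero het
    (k := ArcAlgebra (ZhuC2 V) ⧸ y) (Ideal.Quotient.mkₐ ℂ y)
  exact fun f hf => Ideal.Quotient.eq_zero_iff_mem.1
    (hχy f (arcRestrict_eq_zero (het q ρ S χ) hf))

theorem exists_homeomorph_of_isEtale [Algebra.FiniteType ℂ (ZhuC2 V)]
    (het : ∀ (q : Ideal (ZhuC2 V)) [q.IsPrime] (ρ : ℕ) (S : Type u) [CommRing S] [Algebra ℂ S]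
      (χ : PoissonChart (zhuHam V) q ρ S), χ.IsEtale) :
    (∃ e : SingularSupport V ≃ₜ ArcSpace (ZhuC2 V),
      ∀ x, (e x).asIdeal = x.asIdeal.comap (arcToGr V)) ∧
    (∃ e : SingularSupport V ≃ₜ ArcSpace (ZhuRed V),
      ∀ x, (e x).asIdeal.comap (arcToRed V) = x.asIdeal.comap (arcToGr V)) := by
  obtain ⟨e₁, he₁⟩ := exists_homeomorph_maximalSpectrum (arcToGr V) arcToGr_surjective
    fun y => have := y.isMaximal.isPrime; ker_arcToGr_le het y.asIdeal
  obtain ⟨e₂, he₂⟩ := exists_homeomorph_maximalSpectrum (arcToRed V)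
    (arcMap_surjective (Ideal.Quotient.mkₐ_surjective ℂ (nilradical (ZhuC2 V))))
    fun y => have := y.isMaximal.isPrime; ker_arcMap_nilradical_le y.asIdeal
  refine ⟨⟨e₁, he₁⟩, e₁.trans e₂.symm, fun x => ?_⟩
  rw [← he₁, ← he₂]
  simp

end VertexAlgebra

/-! ### Bounds for the iterates of a vector field -/

section PolynomialBound

open MvPolynomial

variable {σ : Type*}

/-- `b` bounds the polynomial `p` on the polydisc of radius `r`. -/
def PolydiscBound (r b : ℝ) (p : MvPolynomial σ ℂ) : Prop :=
  ∀ x : σ → ℂ, (∀ i, ‖x i‖ ≤ r) → ‖eval x p‖ ≤ b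

theorem PolydiscBound.mono {r r' b : ℝ} {p : MvPolynomial σ ℂ} (h : PolydiscBound r b p)
    (hr : r' ≤ r) : PolydiscBound r' b p := fun x hx => h x fun i => (hx i).trans hr

theorem exists_polydiscBound (r : ℝ) (p : MvPolynomial σ ℂ) : ∃ b, 0 ≤ b ∧ PolydiscBound r b p := by
  induction p using MvPolynomial.induction_on with
  | C c => exact ⟨‖c‖, norm_nonneg _, fun x _ => by rw [eval_C]⟩
  | add p q hp hq =>
    obtain ⟨b, hb, h⟩ := hp
    obtain ⟨b', hb', h'⟩ := hq
    exact ⟨b + b', add_nonneg hb hb', fun x hx => by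
      rw [map_add]
      exact (norm_add_le _ _).trans (add_le_add (h x hx) (h' x hx))⟩
  | mul_X p i hp =>
    obtain ⟨b, hb, h⟩ := hp
    refine ⟨b * |r|, by positivity, fun x hx => ?_⟩
    rw [map_mul, eval_X, norm_mul]
    exact mul_le_mul (h x hx) ((hx i).trans (le_abs_self r)) (norm_nonneg _) hb

theorem hasDerivAt_eval_update [DecidableEq σ] (p : MvPolynomial σ ℂ) (x : σ → ℂ) (i : σ) (w : ℂ) :
    HasDerivAt (fun w => eval (Function.update x i w) p)
      (eval (Function.update x i w) (pderiv i p)) w := by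
  induction p using MvPolynomial.induction_on with
  | C c => simpa using hasDerivAt_const w c
  | add p q hp hq => simpa only [map_add] using hp.fun_add hq
  | mul_X p j hp =>
    have hj : HasDerivAt (fun w => Function.update x i w j)
        (eval (Function.update x i w) (pderiv i (X j))) w := by
      rcases eq_or_ne j i with rfl | h
      · simpa using hasDerivAt_id' w
      · simpa [pderiv_X_of_ne h, Function.update_of_ne h] using hasDerivAt_const w (x j)
    have := hp.fun_mul hj
    simp only [map_mul, eval_X, Derivation.leibniz, map_add, smul_eq_mul]
    exact this.congr_deriv (by ring)

/-- Cauchy's estimate in one variable, on a disc of radius `r - r'`. -/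
theorem PolydiscBound.pderiv {r r' b : ℝ} {p : MvPolynomial σ ℂ} (h : PolydiscBound r b p)
    (hr : r' < r) (i : σ) : PolydiscBound r' (b / (r - r')) (pderiv i p) := by
  classical
  intro x hx
  have hd := hasDerivAt_eval_update p x i
  have h1 := Complex.norm_deriv_le_of_forall_mem_sphere_norm_le (c := x i) (sub_pos.2 hr)
    (f := fun w => eval (Function.update x i w) p) (C := b)
    (Differentiable.diffContOnCl fun w => (hd w).differentiableAt) (fun w hw => h _ fun j => ?_)
  · rw [(hd (x i)).deriv, Function.update_eq_self] at h1
    exact h1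
  · rcases eq_or_ne j i with rfl | hj
    · rw [Function.update_self]
      rw [mem_sphere_iff_norm] at hw
      calc ‖w‖ = ‖(w - x j) + x j‖ := by rw [sub_add_cancel]
        _ ≤ ‖w - x j‖ + ‖x j‖ := norm_add_le _ _
        _ ≤ (r - r') + r' := add_le_add hw.le (hx j)
        _ = r := by ring
    · rw [Function.update_of_ne hj]
      exact (hx j).trans hr.le

variable {κ : Type*} [Fintype σ] [Fintype κ]

/-- The vector field with coefficients `∑ τ_k P_kj`. -/
noncomputable def polyField (P : κ → σ → MvPolynomial σ ℂ) (τ : κ → ℂ) (p : MvPolynomial σ ℂ) :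
    MvPolynomial σ ℂ := ∑ k, ∑ j, C (τ k) * (P k j * pderiv j p)

theorem PolydiscBound.polyField {P : κ → σ → MvPolynomial σ ℂ} {r r' A b : ℝ}
    (hP : ∀ k j, PolydiscBound r' A (P k j)) (hA : 0 ≤ A) (hr : r' < r)
    {p : MvPolynomial σ ℂ} (h : PolydiscBound r b p) (τ : κ → ℂ) :
    PolydiscBound r' (Fintype.card κ * Fintype.card σ * A * ‖τ‖ / (r - r') * b)
      (polyField P τ p) := by
  intro x hx
  rw [_root_.polyField, map_sum]
  have h1 : ∀ k j, ‖eval x (C (τ k) * (P k j * MvPolynomial.pderiv j p))‖ ≤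
      ‖τ‖ * (A * (b / (r - r'))) := by
    intro k j
    rw [map_mul, map_mul, eval_C, norm_mul, norm_mul]
    exact mul_le_mul (norm_le_pi_norm τ k)
      (mul_le_mul (hP k j x hx) (h.pderiv hr j x hx) (norm_nonneg _) hA)
      (by positivity) (norm_nonneg _)
  refine (norm_sum_le_of_le (f := fun k => eval x (∑ j, C (τ k) * (P k j * MvPolynomial.pderiv j p)))
    _ (n := fun _ => (Fintype.card σ : ℝ) * (‖τ‖ * (A * (b / (r - r'))))) fun k _ => ?_).trans ?_
  · rw [map_sum]
    refine (norm_sum_le_of_le _ fun j _ => h1 k j).trans ?_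
    rw [Finset.sum_const, nsmul_eq_mul, Finset.card_univ]
  · rw [Finset.sum_const, nsmul_eq_mul, Finset.card_univ]
    apply le_of_eq
    ring

/-- The radius shrinks from `m + 1` to `m` in `n` equal steps. Each application of the field costs a
factor `K ‖τ‖ n`, and `n^n ≤ e^n n!` turns the product into the factorial growth that the
exponential series can absorb. -/
theorem PolydiscBound.iterate_polyField {P : κ → σ → MvPolynomial σ ℂ} {m A b : ℝ}
    (hP : ∀ k j, PolydiscBound (m + 1) A (P k j)) (hA : 0 ≤ A) (hb : 0 ≤ b) {p : MvPolynomial σ ℂ}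
    (h : PolydiscBound (m + 1) b p) (τ : κ → ℂ) (n : ℕ) :
    PolydiscBound m (b * (Fintype.card κ * Fintype.card σ * A * Real.exp 1 * ‖τ‖) ^ n *
      n.factorial) ((_root_.polyField P τ)^[n] p) := by
  set K : ℝ := Fintype.card κ * Fintype.card σ * A with hK
  have hK0 : 0 ≤ K := by positivity
  rcases Nat.eq_zero_or_pos n with rfl | hn
  · simpa using h.mono (by linarith)
  have hn' : (0 : ℝ) < n := by exact_mod_cast hn
  have key : ∀ i, i ≤ n → PolydiscBound (m + 1 - i / n) ((K * ‖τ‖ * n) ^ i * b)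
      ((_root_.polyField P τ)^[i] p) := by
    intro i
    induction i with
    | zero => intro _; simpa using h
    | succ i ih =>
      intro hi
      have h1 := ih (by omega)
      rw [Function.iterate_succ_apply']
      have hstep : m + 1 - ((i + 1 : ℕ) : ℝ) / n < m + 1 - i / n := by
        push_cast
        rw [add_div]
        have : 0 < 1 / (n : ℝ) := by positivity
        linarith
      have h2 := PolydiscBound.polyField (fun k j => (hP k j).mono (by
        have : 0 ≤ ((i + 1 : ℕ) : ℝ) / n := by positivity
        linarith)) hA hstep h1 τ
      convert h2 using 1
      have e : m + 1 - (i : ℝ) / n - (m + 1 - ((i + 1 : ℕ) : ℝ) / n) = 1 / n := by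
        push_cast
        field_simp
        ring
      rw [e, ← hK, div_div_eq_mul_div, div_one, pow_succ]
      ring
  have h3 := key n le_rfl
  rw [div_self hn'.ne', add_sub_cancel_right] at h3
  intro x hx
  refine (h3 x hx).trans ?_
  have h4 : (n : ℝ) ^ n ≤ Real.exp 1 ^ n * n.factorial := by
    have := Real.pow_div_factorial_le_exp (x := n) hn'.le n
    rw [div_le_iff₀ (by positivity)] at this
    rwa [← Real.exp_nat_mul, mul_one]
  calc (K * ‖τ‖ * n) ^ n * b = (K * ‖τ‖) ^ n * b * (n : ℝ) ^ n := by rw [mul_pow]; ring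
    _ ≤ (K * ‖τ‖) ^ n * b * (Real.exp 1 ^ n * n.factorial) :=
        mul_le_mul_of_nonneg_left h4 (by positivity)
    _ = _ := by rw [mul_right_comm K, mul_pow (K * ‖τ‖)]; ring

end PolynomialBound

section FlowBound

variable {S : Type*} [CommRing S] [Algebra ℂ S] {ρ : ℕ} (Y : Fin ρ → Derivation ℂ S S)

/-- A constant combination of vector fields. -/
def constField (τ : Fin ρ → ℂ) : Derivation ℂ S S := ∑ k, τ k • Y k

theorem constField_apply (τ : Fin ρ → ℂ) (s : S) : constField Y τ s = ∑ k, τ k • Y k s := by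
  have h : ∀ A : Finset (Fin ρ), (∑ k ∈ A, τ k • Y k) s = ∑ k ∈ A, τ k • Y k s := by
    intro A
    induction A using Finset.induction_on with
    | empty => simp
    | insert a A ha ih =>
      rw [Finset.sum_insert ha, Finset.sum_insert ha, Derivation.add_apply, ih,
        Derivation.smul_apply]
  exact h Finset.univ

/-- The fields are lifted to polynomial vector fields along the presentation `g`. That `K` does not
depend on `s` gives one radius of convergence for all functions. -/
theorem exists_flow_bound {σ : Type*} [Fintype σ] {g : σ → S}
    (hg : Function.Surjective (MvPolynomial.aeval g : MvPolynomial σ ℂ →ₐ[ℂ] S)) (m : ℝ) :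
    ∃ K : ℝ, 0 < K ∧ ∀ s : S, ∃ b : ℝ, 0 ≤ b ∧ ∀ y : S →ₐ[ℂ] ℂ, (∀ j, ‖y (g j)‖ ≤ m) →
      ∀ (τ : Fin ρ → ℂ) (n : ℕ), ‖y ((constField Y τ)^[n] s)‖ ≤ b * (K * ‖τ‖) ^ n * n.factorial := by
  classical
  choose P hP using fun k j => hg (Y k (g j))
  choose B hB0 hB using fun k j => exists_polydiscBound (m + 1) (P k j)
  set A : ℝ := ∑ k, ∑ j, B k j with hA
  have hA0 : 0 ≤ A := Finset.sum_nonneg fun k _ => Finset.sum_nonneg fun j _ => hB0 k j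
  have hPA : ∀ k j, PolydiscBound (m + 1) A (P k j) := fun k j x hx => by
    refine (hB k j x hx).trans ?_
    refine (Finset.single_le_sum (f := fun j => B k j) (fun j _ => hB0 k j)
      (Finset.mem_univ j)).trans ?_
    exact Finset.single_le_sum (f := fun k => ∑ j, B k j)
      (fun k _ => Finset.sum_nonneg fun j _ => hB0 k j) (Finset.mem_univ k)
  have h1 : ∀ τ p, constField Y τ (MvPolynomial.aeval g p) =
      MvPolynomial.aeval g (polyField P τ p) := by
    intro τ p
    rw [constField_apply, polyField, map_sum]
    refine Finset.sum_congr rfl fun k _ => ?_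
    rw [map_sum, Derivation.map_aeval_mvPolynomial, Finset.smul_sum]
    refine Finset.sum_congr rfl fun j _ => ?_
    rw [map_mul, map_mul, hP, ← MvPolynomial.algebraMap_eq, AlgHom.commutes, Algebra.smul_def,
      mul_comm (MvPolynomial.aeval g (MvPolynomial.pderiv j p))]
  have h2 : ∀ τ n p, (constField Y τ)^[n] (MvPolynomial.aeval g p) =
      MvPolynomial.aeval g ((polyField P τ)^[n] p) := by
    intro τ n p
    induction n with
    | zero => rfl
    | succ n ih => rw [Function.iterate_succ_apply', ih, h1, Function.iterate_succ_apply']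
  refine ⟨Fintype.card (Fin ρ) * Fintype.card σ * A * Real.exp 1 + 1, by positivity, fun s => ?_⟩
  obtain ⟨p, rfl⟩ := hg s
  obtain ⟨b, hb0, hb⟩ := exists_polydiscBound (m + 1) p
  refine ⟨b, hb0, fun y hy τ n => ?_⟩
  have h3 : ∀ p, y (MvPolynomial.aeval g p) = MvPolynomial.eval (fun j => y (g j)) p := by
    intro p
    rw [← AlgHom.comp_apply, MvPolynomial.comp_aeval]
    rfl
  rw [h2, h3]
  refine (PolydiscBound.iterate_polyField hPA hA0 hb0 hb τ n _ hy).trans ?_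
  gcongr
  linarith

end FlowBound

/-! ### The local flow of commuting vector fields -/

section Flow

open Topology

variable {S : Type*} [CommRing S] [Algebra ℂ S] {ρ : ℕ} (Y : Fin ρ → Derivation ℂ S S)

theorem constField_zero (s : S) : constField Y 0 s = 0 := by simp [constField_apply]

theorem constField_neg (τ : Fin ρ → ℂ) (s : S) : constField Y (-τ) s = -constField Y τ s := by
  simp [constField_apply]

theorem constField_iterate_constField (τ σ : Fin ρ → ℂ) (n : ℕ) (s : S) :
    (constField Y τ)^[n] (constField Y σ s) = ∑ k, σ k • (constField Y τ)^[n] (Y k s) := by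
  induction n with
  | zero => exact constField_apply Y σ s
  | succ n ih =>
    rw [Function.iterate_succ_apply', ih, map_sum]
    refine Finset.sum_congr rfl fun k _ => ?_
    rw [Derivation.map_smul, Function.iterate_succ_apply']

/-- The terms of the exponential series of `∑ τ_k Y_k`. -/
noncomputable def flowTerm (y : S →ₐ[ℂ] ℂ) (τ : Fin ρ → ℂ) (n : ℕ) (s : S) : ℂ :=
  (n.factorial : ℂ)⁻¹ * y ((constField Y τ)^[n] s)

/-- `p` is the endpoint of the flow of `∑ τ_k Y_k` starting at `y`. -/
def IsExp (y : S →ₐ[ℂ] ℂ) (τ : Fin ρ → ℂ) (p : S →ₐ[ℂ] ℂ) : Prop :=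
  ∀ s, HasSum (fun n => flowTerm Y y τ n s) (p s)

variable {Y}

theorem IsExp.unique {y p p' : S →ₐ[ℂ] ℂ} {τ : Fin ρ → ℂ} (h : IsExp Y y τ p) (h' : IsExp Y y τ p') :
    p = p' := AlgHom.ext fun s => (h s).unique (h' s)

theorem flowTerm_zero (y : S →ₐ[ℂ] ℂ) (τ : Fin ρ → ℂ) (s : S) : flowTerm Y y τ 0 s = y s := by
  simp [flowTerm]

theorem flowTerm_neg_constField (y : S →ₐ[ℂ] ℂ) (τ σ : Fin ρ → ℂ) (n : ℕ) (s : S) :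
    flowTerm Y y τ n (constField Y (-σ) s) = -flowTerm Y y τ n (constField Y σ s) := by
  rw [flowTerm, constField_neg, ← neg_one_smul ℂ, Derivation.iterate_smul, map_smul, flowTerm,
    neg_one_smul, mul_neg]

theorem flowTerm_constField (y : S →ₐ[ℂ] ℂ) (τ σ : Fin ρ → ℂ) (n : ℕ) (s : S) :
    flowTerm Y y τ n (constField Y σ s) = ∑ k, σ k * flowTerm Y y τ n (Y k s) := by
  rw [flowTerm, constField_iterate_constField, map_sum, Finset.mul_sum]
  refine Finset.sum_congr rfl fun k _ => ?_
  rw [map_smul, flowTerm, smul_eq_mul]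
  ring

theorem flowTerm_succ (y : S →ₐ[ℂ] ℂ) (τ : Fin ρ → ℂ) (n : ℕ) (s : S) :
    flowTerm Y y τ (n + 1) s = ((n + 1 : ℕ) : ℂ)⁻¹ * flowTerm Y y τ n (constField Y τ s) := by
  rw [flowTerm, flowTerm, Function.iterate_succ_apply, Nat.factorial_succ, Nat.cast_mul, mul_inv,
    mul_assoc]

theorem flowTerm_zero_right (y : S →ₐ[ℂ] ℂ) (n : ℕ) (s : S) (hn : n ≠ 0) :
    flowTerm Y y 0 n s = 0 := by
  obtain ⟨n, rfl⟩ := Nat.exists_eq_succ_of_ne_zero hn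
  rw [flowTerm_succ, flowTerm, constField_zero, iterate_map_zero, map_zero, mul_zero, mul_zero]

theorem isExp_zero (y : S →ₐ[ℂ] ℂ) : IsExp Y y 0 y := by
  intro s
  have := hasSum_single (f := fun n => flowTerm Y y 0 n s) 0 fun n hn => flowTerm_zero_right y n s hn
  rwa [flowTerm_zero] at this

/-- Moving the base point with velocity `θ` inserts `θ` into the term of index `n`; moving the time
with velocity `τ'` inserts `τ'` into the term of index `n - 1`. Commutation of the fields allows
both to be placed innermost. With `τ' = -θ` the sum over `n` telescopes. -/
theorem hasDerivAt_flowTerm (hY : ∀ k l s, Y k (Y l s) = Y l (Y k s)) {γ : ℂ → S →ₐ[ℂ] ℂ}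
    {τ : ℂ → Fin ρ → ℂ} {z : ℂ} {θ τ' : Fin ρ → ℂ}
    (hγ : ∀ s, HasDerivAt (fun w => γ w s) (γ z (constField Y θ s)) z)
    (hτ : ∀ k, HasDerivAt (fun w => τ w k) (τ' k) z) (n : ℕ) (s : S) :
    HasDerivAt (fun w => flowTerm Y (γ w) (τ w) n s) (flowTerm Y (γ z) (τ z) n (constField Y θ s) +
      if n = 0 then 0 else flowTerm Y (γ z) (τ z) (n - 1) (constField Y τ' s)) z := by
  induction n generalizing s with
  | zero => simpa [flowTerm_zero] using hγ s
  | succ n ih =>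
    have h1 : ∀ w, flowTerm Y (γ w) (τ w) (n + 1) s =
        ((n + 1 : ℕ) : ℂ)⁻¹ * ∑ k, τ w k * flowTerm Y (γ w) (τ w) n (Y k s) := fun w => by
      rw [flowTerm_succ, flowTerm_constField]
    simp only [h1]
    have h2 := (HasDerivAt.fun_sum fun k (_ : k ∈ Finset.univ) =>
      (hτ k).fun_mul (ih (Y k s))).const_mul ((n + 1 : ℕ) : ℂ)⁻¹
    refine h2.congr_deriv ?_
    rw [if_neg n.succ_ne_zero, Nat.add_sub_cancel]
    rw [Finset.sum_add_distrib, ← flowTerm_constField]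
    have hcomm : ∀ σ k, constField Y σ (Y k s) = Y k (constField Y σ s) := by
      intro σ k
      simp only [constField_apply, map_sum, Derivation.map_smul, hY]
    simp only [mul_add, Finset.sum_add_distrib, hcomm]
    rw [← flowTerm_constField]
    have hne : ((n + 1 : ℕ) : ℂ) ≠ 0 := Nat.cast_ne_zero.2 n.succ_ne_zero
    rw [flowTerm_succ (γ z) (τ z) n (constField Y θ s)]
    rcases n with _ | n
    · simp
      ring
    · simp only [if_neg n.succ_ne_zero, Nat.add_sub_cancel, ← flowTerm_constField]
      have h3 : flowTerm Y (γ z) (τ z) n (constField Y (τ z) (constField Y τ' s)) =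
          ((n + 1 : ℕ) : ℂ) * flowTerm Y (γ z) (τ z) (n + 1) (constField Y τ' s) := by
        rw [flowTerm_succ, mul_inv_cancel_left₀ (Nat.cast_ne_zero.2 n.succ_ne_zero)]
      rw [h3]
      field_simp
      push_cast
      ring

end Flow

/-! ### Convergence of the exponential series and its relation to integral curves. -/

section LocalFlow

open Topology

variable {S : Type*} [CommRing S] [Algebra ℂ S] {ρ : ℕ} {Y : Fin ρ → Derivation ℂ S S}

/-- The exponential series along `Y` converges geometrically for `‖τ‖ < r` at all points at which the
functions `g` are bounded by `m`. -/
def FlowRadius {σ : Type*} (Y : Fin ρ → Derivation ℂ S S) (g : σ → S) (m r : ℝ) : Prop :=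
  ∀ s : S, ∃ b : ℝ, 0 ≤ b ∧ ∀ y : S →ₐ[ℂ] ℂ, (∀ j, ‖y (g j)‖ ≤ m) →
    ∀ τ : Fin ρ → ℂ, ‖τ‖ < r → ∀ n, ‖flowTerm Y y τ n s‖ ≤ b * (‖τ‖ / r * 2⁻¹) ^ n

variable (Y) in
theorem exists_flowRadius {σ : Type*} [Fintype σ] {g : σ → S}
    (hg : Function.Surjective (MvPolynomial.aeval g : MvPolynomial σ ℂ →ₐ[ℂ] S)) (m : ℝ) :
    ∃ r : ℝ, 0 < r ∧ FlowRadius Y g m r := by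
  obtain ⟨K, hK, h⟩ := exists_flow_bound Y hg m
  -- Half of the radius given by `K`, so that the terms decay at least like `2⁻¹ ^ n` inside it.
  refine ⟨(2 * K)⁻¹, by positivity, fun s => ?_⟩
  obtain ⟨b, hb, h⟩ := h s
  refine ⟨b, hb, fun y hy τ _ n => ?_⟩
  rw [flowTerm, norm_mul, norm_inv, Complex.norm_natCast]
  have e : ‖τ‖ / (2 * K)⁻¹ * 2⁻¹ = K * ‖τ‖ := by field_simp
  rw [e, inv_mul_le_iff₀ (by positivity)]
  refine (h y hy τ n).trans (le_of_eq (by ring))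

variable {σ : Type*} {g : σ → S} {m r : ℝ}

theorem FlowRadius.bound (h : FlowRadius Y g m r) (s : S) :
    ∃ b : ℝ, 0 ≤ b ∧ ∀ y : S →ₐ[ℂ] ℂ, (∀ j, ‖y (g j)‖ ≤ m) →
      ∀ τ : Fin ρ → ℂ, ‖τ‖ < r → ∀ n, ‖flowTerm Y y τ n s‖ ≤ b * 2⁻¹ ^ n := by
  obtain ⟨b, hb, h⟩ := h s
  refine ⟨b, hb, fun y hy τ hτ n => (h y hy τ hτ n).trans ?_⟩
  have hr : 0 < r := (norm_nonneg _).trans_lt hτ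
  have : ‖τ‖ / r * 2⁻¹ ≤ 2⁻¹ := by
    have : ‖τ‖ / r ≤ 1 := (div_le_one hr).2 hτ.le
    linarith
  gcongr

theorem summable_geometric_inv_two (b : ℝ) : Summable fun n : ℕ => b * (2⁻¹ : ℝ) ^ n :=
  (summable_geometric_of_lt_one (by norm_num) (by norm_num)).mul_left b

theorem FlowRadius.summable (h : FlowRadius Y g m r) {y : S →ₐ[ℂ] ℂ} (hy : ∀ j, ‖y (g j)‖ ≤ m)
    {τ : Fin ρ → ℂ} (hτ : ‖τ‖ < r) (s : S) : Summable fun n => ‖flowTerm Y y τ n s‖ := by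
  obtain ⟨b, -, hb⟩ := h.bound s
  exact (summable_geometric_inv_two b).of_nonneg_of_le (fun n => norm_nonneg _)
    fun n => hb y hy τ hτ n

/-- The exponential of a derivation is multiplicative: the divided iterates satisfy the Leibniz
rule, and absolutely convergent series may be multiplied by the Cauchy product. -/
theorem exists_isExp_of_summable {y : S →ₐ[ℂ] ℂ} {τ : Fin ρ → ℂ}
    (h : ∀ s, Summable fun n => ‖flowTerm Y y τ n s‖) : ∃ p, IsExp Y y τ p := by
  have hadd : ∀ a b n, flowTerm Y y τ n (a + b) = flowTerm Y y τ n a + flowTerm Y y τ n b :=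
    fun a b n => by rw [flowTerm, Derivation.iterate_add, map_add, mul_add]; rfl
  have hsmul : ∀ (c : ℂ) a n, flowTerm Y y τ n (c • a) = c * flowTerm Y y τ n a := fun c a n => by
    rw [flowTerm, Derivation.iterate_smul, map_smul, smul_eq_mul, flowTerm]
    ring
  have hmul : ∀ a b n, flowTerm Y y τ n (a * b) = ∑ ij ∈ Finset.HasAntidiagonal.antidiagonal n,
      flowTerm Y y τ ij.1 a * flowTerm Y y τ ij.2 b := fun a b n => by
    have := congrArg y ((constField Y τ).iterate_mul_factorial n a b)
    simp only [map_smul, map_sum, map_mul, smul_eq_mul] at this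
    exact this
  have hone : ∀ n, n ≠ 0 → flowTerm Y y τ n 1 = 0 := fun n hn => by
    obtain ⟨n, rfl⟩ := Nat.exists_eq_succ_of_ne_zero hn
    rw [flowTerm, Function.iterate_succ_apply, Derivation.map_one_eq_zero, iterate_map_zero, map_zero,
      mul_zero]
  refine ⟨AlgHom.ofLinearMap
    { toFun := fun s => ∑' n, flowTerm Y y τ n s
      map_add' := fun a b => ?_
      map_smul' := fun c a => ?_ } ?_ fun a b => ?_, fun s => (h s).of_norm.hasSum⟩
  · simp only [hadd]
    exact (h a).of_norm.tsum_add (h b).of_norm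
  · simp only [hsmul]
    exact tsum_mul_left
  · change ∑' n, flowTerm Y y τ n 1 = 1
    rw [tsum_eq_single 0 fun n hn => hone n hn, flowTerm_zero, map_one]
  · change ∑' n, flowTerm Y y τ n (a * b) = _
    simp only [hmul]
    exact (tsum_mul_tsum_eq_tsum_sum_antidiagonal_of_summable_norm (h a) (h b)).symm

theorem FlowRadius.exists_isExp (h : FlowRadius Y g m r) {y : S →ₐ[ℂ] ℂ} (hy : ∀ j, ‖y (g j)‖ ≤ m)
    {τ : Fin ρ → ℂ} (hτ : ‖τ‖ < r) : ∃ p, IsExp Y y τ p :=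
  exists_isExp_of_summable (h.summable hy hτ)

theorem FlowRadius.exists_norm_sub_le (h : FlowRadius Y g m r) (s : S) :
    ∃ b : ℝ, 0 ≤ b ∧ ∀ y p : S →ₐ[ℂ] ℂ, (∀ j, ‖y (g j)‖ ≤ m) → ∀ τ : Fin ρ → ℂ, ‖τ‖ < r →
      IsExp Y y τ p → ‖p s - y s‖ ≤ b * ‖τ‖ := by
  obtain ⟨b, hb, h⟩ := h s
  rcases le_or_gt r 0 with hr | hr
  · exact ⟨0, le_rfl, fun y p _ τ hτ => absurd (hτ.trans_le hr) (norm_nonneg _).not_gt⟩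
  refine ⟨b / r, by positivity, fun y p hy τ hτ hp => ?_⟩
  have h1 := (hasSum_nat_add_iff' 1).2 (hp s)
  rw [Finset.sum_range_one, flowTerm_zero] at h1
  rw [← h1.tsum_eq]
  have h2 : HasSum (fun n : ℕ => b / r * ‖τ‖ * 2⁻¹ * (2⁻¹ : ℝ) ^ n) (b / r * ‖τ‖ * 2⁻¹ * 2) := by
    have := (hasSum_geometric_of_lt_one (r := (2⁻¹ : ℝ)) (by norm_num) (by norm_num)).mul_left
      (b / r * ‖τ‖ * 2⁻¹)
    norm_num at this ⊢
    exact this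
  refine (tsum_of_norm_bounded h2 fun n => (h y hy τ hτ (n + 1)).trans ?_).trans (le_of_eq (by ring))
  have h3 : ‖τ‖ / r ≤ 1 := (div_le_one hr).2 hτ.le
  have h4 : (‖τ‖ / r) ^ (n + 1) ≤ ‖τ‖ / r :=
    pow_le_of_le_one (by positivity) h3 n.succ_ne_zero
  calc b * (‖τ‖ / r * 2⁻¹) ^ (n + 1) = b * ((‖τ‖ / r) ^ (n + 1) * 2⁻¹ ^ (n + 1)) := by rw [mul_pow]
    _ ≤ b * (‖τ‖ / r * 2⁻¹ ^ (n + 1)) := by gcongr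
    _ = _ := by ring

/-- Integral curves of `∑ θ_k Y_k` are given by the exponential series. -/
theorem FlowRadius.isExp_of_hasDerivAt (hY : ∀ k l s, Y k (Y l s) = Y l (Y k s))
    {t : Fin ρ → S} (ht : ∀ k j, Y k (t j) = if k = j then 1 else 0) (h : FlowRadius Y g m r)
    {γ : ℂ → S →ₐ[ℂ] ℂ} {θ : ℂ → Fin ρ → ℂ} {U : Set ℂ} (hU : Convex ℝ U) {M : ℝ}
    (hγ : ∀ z ∈ U, ∀ s, HasDerivAt (fun w => γ w s) (γ z (constField Y (θ z) s)) z)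
    (hm : ∀ z ∈ U, ∀ j, ‖γ z (g j)‖ ≤ m) (hθ : ∀ z ∈ U, ‖θ z‖ ≤ M) {z₀ z₁ : ℂ} (h₀ : z₀ ∈ U)
    (h₁ : z₁ ∈ U) (hr : ∀ z ∈ U, ‖(fun k => γ z₁ (t k) - γ z (t k))‖ < r) :
    IsExp Y (γ z₀) (fun k => γ z₁ (t k) - γ z₀ (t k)) (γ z₁) := by
  intro s
  set τ : ℂ → Fin ρ → ℂ := fun z k => γ z₁ (t k) - γ z (t k) with hτ
  have hsum := (h.summable (hm z₀ h₀) (hr z₀ h₀) s).of_norm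
  refine (hsum.hasSum_iff_tendsto_nat).2 ?_
  rw [← Filter.tendsto_add_atTop_iff_nat 1]
  choose b hb0 hb using fun k => h.bound (Y k s)
  -- Here `τ` is the coordinate difference from `γ z` to `γ z₁`, so its velocity is `-θ` and the
  -- derivative of a partial sum telescopes to its last term. That term is geometrically small, and
  -- at `z₁`, where `τ = 0`, the partial sum equals `γ z₁ s`; the mean value inequality concludes.
  have hderiv : ∀ N, ∀ z ∈ U, HasDerivAt (fun w => ∑ n ∈ Finset.range (N + 1),
      flowTerm Y (γ w) (τ w) n s) (flowTerm Y (γ z) (τ z) N (constField Y (θ z) s)) z := by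
    intro N z hz
    have hτ' : ∀ k, HasDerivAt (fun w => τ w k) ((-θ z) k) z := by
      intro k
      have := (hγ z hz (t k)).const_sub (γ z₁ (t k))
      refine this.congr_deriv ?_
      rw [constField_apply, map_sum, Pi.neg_apply, neg_inj]
      rw [Finset.sum_eq_single k]
      · rw [ht, if_pos rfl, map_smul, map_one, smul_eq_mul, mul_one]
      · intro l _ hl
        rw [ht, if_neg hl, smul_zero, map_zero]
      · exact fun hk => absurd (Finset.mem_univ k) hk
    refine (HasDerivAt.fun_sum fun n _ => hasDerivAt_flowTerm hY (hγ z hz) hτ' n s).congr_deriv ?_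
    induction N with
    | zero => simp
    | succ N ih =>
      rw [Finset.sum_range_succ, ih, if_neg N.succ_ne_zero, Nat.add_sub_cancel,
        flowTerm_neg_constField]
      ring
  have hbound : ∀ N, ∀ z ∈ U, ‖flowTerm Y (γ z) (τ z) N (constField Y (θ z) s)‖ ≤
      (∑ k, |M| * b k) * 2⁻¹ ^ N := by
    intro N z hz
    rw [flowTerm_constField, Finset.sum_mul]
    refine norm_sum_le_of_le _ fun k _ => ?_
    rw [norm_mul, mul_assoc]
    exact mul_le_mul ((norm_le_pi_norm _ k).trans ((hθ z hz).trans (le_abs_self M)))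
      (hb k _ (hm z hz) _ (hr z hz) N) (norm_nonneg _) (abs_nonneg _)
  have hmv : ∀ N, ‖(∑ n ∈ Finset.range (N + 1), flowTerm Y (γ z₀) (τ z₀) n s) - γ z₁ s‖ ≤
      (∑ k, |M| * b k) * 2⁻¹ ^ N * ‖z₀ - z₁‖ := by
    intro N
    have h2 := hU.norm_image_sub_le_of_norm_hasDerivWithin_le
      (fun z hz => (hderiv N z hz).hasDerivWithinAt) (hbound N) h₁ h₀
    have h3 : ∑ n ∈ Finset.range (N + 1), flowTerm Y (γ z₁) (τ z₁) n s = γ z₁ s := by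
      have : τ z₁ = 0 := by
        ext k
        simp [hτ]
      rw [this, Finset.sum_range_succ', flowTerm_zero, Finset.sum_eq_zero, zero_add]
      intro n _
      exact flowTerm_zero_right _ _ _ n.succ_ne_zero
    rwa [h3] at h2
  rw [tendsto_iff_norm_sub_tendsto_zero]
  refine squeeze_zero (fun _ => norm_nonneg _) hmv ?_
  have : Filter.Tendsto (fun N : ℕ => (∑ k, |M| * b k) * (2⁻¹ : ℝ) ^ N * ‖z₀ - z₁‖) Filter.atTop
      (𝓝 ((∑ k, |M| * b k) * 0 * ‖z₀ - z₁‖)) :=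
    ((tendsto_pow_atTop_nhds_zero_of_lt_one (by norm_num) (by norm_num)).const_mul _).mul_const _
  simpa using this

/-- A field with constant coefficients maps a coordinate to a constant, so the series stops after
two terms. -/
theorem IsExp.apply_coord {t : Fin ρ → S} (ht : ∀ k j, Y k (t j) = if k = j then 1 else 0)
    {y p : S →ₐ[ℂ] ℂ} {τ : Fin ρ → ℂ} (h : IsExp Y y τ p) (k : Fin ρ) : p (t k) = y (t k) + τ k := by
  have h1 : constField Y τ (t k) = algebraMap ℂ S (τ k) := by
    rw [constField_apply, Finset.sum_eq_single k]
    · rw [ht, if_pos rfl, Algebra.smul_def, mul_one]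
    · intro l _ hl
      rw [ht, if_neg hl, smul_zero]
    · exact fun hk => absurd (Finset.mem_univ k) hk
  have h2 : HasSum (fun n => flowTerm Y y τ n (t k))
      (∑ n ∈ Finset.range 2, flowTerm Y y τ n (t k)) := by
    refine hasSum_sum_of_ne_finset_zero fun n hn => ?_
    rw [Finset.mem_range, not_lt] at hn
    obtain ⟨n, rfl⟩ := Nat.exists_eq_add_of_le' hn
    rw [flowTerm, Function.iterate_add_apply, Function.iterate_succ_apply,
      Function.iterate_one, h1, Derivation.map_algebraMap, iterate_map_zero, map_zero, mul_zero]
  rw [(h (t k)).unique h2, Finset.sum_range_succ, Finset.sum_range_one, flowTerm_zero, flowTerm]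
  simp [h1]

theorem convex_setOf_norm_add_smul_lt (w σ : Fin ρ → ℂ) (r : ℝ) :
    Convex ℝ {z : ℂ | ‖w + z • σ‖ < r} := by
  intro z₁ h₁ z₂ h₂ a b ha hb hab
  have := convex_ball (0 : Fin ρ → ℂ) r (x := w + z₁ • σ) (by simpa using h₁)
    (y := w + z₂ • σ) (by simpa using h₂) ha hb hab
  rw [mem_ball_zero_iff] at this
  have e : w + (a • z₁ + b • z₂) • σ = a • (w + z₁ • σ) + b • (w + z₂ • σ) := by
    have hw : w = a • w + b • w := by rw [← add_smul, hab, one_smul]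
    nth_rewrite 1 [hw]
    rw [smul_add, smul_add, add_smul, smul_assoc, smul_assoc]
    abel
  change ‖w + (a • z₁ + b • z₂) • σ‖ < r
  rwa [e]

/-- The converse of `FlowRadius.isExp_of_hasDerivAt`: along a line in time space the exponential
series may be differentiated term by term, the derivatives being dominated by a geometric series. -/
theorem FlowRadius.hasDerivAt_isExp (hY : ∀ k l s, Y k (Y l s) = Y l (Y k s))
    (h : FlowRadius Y g m r) {y : S →ₐ[ℂ] ℂ} (hy : ∀ j, ‖y (g j)‖ ≤ m) {γ : ℂ → S →ₐ[ℂ] ℂ}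
    (w σ : Fin ρ → ℂ) (hγ : ∀ z : ℂ, ‖w + z • σ‖ < r → IsExp Y y (w + z • σ) (γ z)) {z : ℂ}
    (hz : ‖w + z • σ‖ < r) (s : S) :
    HasDerivAt (fun z => γ z s) (γ z (constField Y σ s)) z := by
  obtain ⟨b, hb0, hb⟩ := h.bound (constField Y σ s)
  have hset : {z : ℂ | ‖w + z • σ‖ < r} = (fun z : ℂ => w + z • σ) ⁻¹' Metric.ball 0 r := by
    ext z
    simp
  have hcont : Continuous fun z : ℂ => w + z • σ := by fun_prop
  have hopen : IsOpen {z : ℂ | ‖w + z • σ‖ < r} := by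
    rw [hset]
    exact Metric.isOpen_ball.preimage hcont
  have hconv := convex_setOf_norm_add_smul_lt w σ r
  have hterm : ∀ n, ∀ z ∈ {z : ℂ | ‖w + z • σ‖ < r},
      HasDerivAt (fun z : ℂ => flowTerm Y y (w + z • σ) n s)
        (if n = 0 then 0 else flowTerm Y y (w + z • σ) (n - 1) (constField Y σ s)) z := by
    intro n z _
    have := hasDerivAt_flowTerm hY (γ := fun _ => y) (τ := fun z => w + z • σ) (z := z) (θ := 0)
      (τ' := σ) (fun s => by
        rw [constField_zero, map_zero]
        exact hasDerivAt_const z (y s)) (fun k => by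
        have := ((hasDerivAt_id' z).mul_const (σ k)).const_add (w k)
        rw [one_mul] at this
        exact this) n s
    rw [constField_zero, flowTerm, iterate_map_zero, map_zero, mul_zero, zero_add] at this
    exact this
  have hu : Summable fun n : ℕ => b * 2 * (2⁻¹ : ℝ) ^ n := summable_geometric_inv_two _
  have key := hasDerivAt_tsum_of_isPreconnected hu hopen hconv.isPreconnected hterm
    (fun n z hz' => ?_) hz (h.summable hy hz s).of_norm hz
  · have e : ∑' n, (if n = 0 then 0 else flowTerm Y y (w + z • σ) (n - 1) (constField Y σ s)) =
        γ z (constField Y σ s) := by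
      refine HasSum.tsum_eq ?_
      rw [← hasSum_nat_add_iff' 1]
      simpa using hγ z hz (constField Y σ s)
    rw [e] at key
    refine key.congr_of_eventuallyEq ?_
    filter_upwards [hopen.mem_nhds hz] with z' hz'
    exact (hγ z' hz' s).tsum_eq.symm
  · rcases n with _ | n
    · simp [hb0]
    · rw [if_neg n.succ_ne_zero, Nat.add_sub_cancel]
      refine (hb y hy _ hz' n).trans (le_of_eq ?_)
      rw [pow_succ]
      ring

end LocalFlow

/-! ### Approximation by countable sets along the flow -/

section FlowApprox

open Topology

variable {S : Type*} [CommRing S] [Algebra ℂ S] {ρ : ℕ} {Y : Fin ρ → Derivation ℂ S S}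
  {σ : Type*} {g : σ → S}

theorem FlowRadius.mono {m m' r r' : ℝ} (h : FlowRadius Y g m r) (hm : m' ≤ m) (hr : r' ≤ r) :
    FlowRadius Y g m' r' := by
  intro s
  obtain ⟨b, hb, h⟩ := h s
  refine ⟨b, hb, fun y hy τ hτ n =>
    (h y (fun j => (hy j).trans hm) τ (hτ.trans_le hr) n).trans ?_⟩
  have hr' : 0 < r' := (norm_nonneg _).trans_lt hτ
  have hr0 : 0 < r := hr'.trans_le hr
  gcongr

variable (Y g) in
/-- The flow along `Y` exists for `‖τ‖ < r` and satisfies the group law at all points at which the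
functions `g` are bounded by `m`. -/
structure LocalFlow (m r : ℝ) : Prop where
  pos : 0 < r
  radius : FlowRadius Y g m (2 * r)
  comp : ∀ y : S →ₐ[ℂ] ℂ, (∀ j, ‖y (g j)‖ + 1 ≤ m) → ∀ w v p p', ‖w‖ < r → ‖v‖ < r →
    IsExp Y y w p → IsExp Y y v p' → IsExp Y p (v - w) p'

theorem LocalFlow.exists_isExp {m r : ℝ} (h : LocalFlow Y g m r) {y : S →ₐ[ℂ] ℂ}
    (hy : ∀ j, ‖y (g j)‖ + 1 ≤ m) {w : Fin ρ → ℂ} (hw : ‖w‖ < r) : ∃ p, IsExp Y y w p :=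
  h.radius.exists_isExp (fun j => by linarith [hy j]) (by linarith [h.pos])

/-- The segment of times from `w` to `v` gives an integral curve of the constant field `v - w`, so
the exponential series based at `p` describes its endpoint `p'`. This is the group law. -/
theorem exists_localFlow [Fintype σ] (hY : ∀ k l s, Y k (Y l s) = Y l (Y k s)) {t : Fin ρ → S}
    (ht : ∀ k j, Y k (t j) = if k = j then 1 else 0)
    (hg : Function.Surjective (MvPolynomial.aeval g : MvPolynomial σ ℂ →ₐ[ℂ] S)) (m : ℝ) :
    ∃ r, LocalFlow Y g m r := by
  obtain ⟨r₀, hr₀, h⟩ := exists_flowRadius Y hg m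
  choose b hb0 hb using fun j => h.exists_norm_sub_le (g j)
  set B : ℝ := ∑ j, b j + 1 with hB
  have hB0 : 0 < B := by
    have := Finset.sum_nonneg fun j (_ : j ∈ Finset.univ) => hb0 j
    linarith
  have hbB : ∀ j, b j ≤ B := fun j => by
    have := Finset.single_le_sum (f := b) (fun j _ => hb0 j) (Finset.mem_univ j)
    linarith
  -- The bound `r₀ / 2` keeps differences of two times below `r₀`; the bound `B⁻¹` keeps each `g j`
  -- within distance `1` of its start, which is the margin `+ 1` in `LocalFlow.comp`.
  refine ⟨min (r₀ / 2) B⁻¹, lt_min (by positivity) (by positivity),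
    h.mono le_rfl (by linarith [min_le_left (r₀ / 2) B⁻¹]), ?_⟩
  set r := min (r₀ / 2) B⁻¹
  have hrr : r ≤ r₀ / 2 := min_le_left _ _
  have hrB : r ≤ B⁻¹ := min_le_right _ _
  intro y hy w v p p' hw hv hp hp'
  have hy' : ∀ j, ‖y (g j)‖ ≤ m := fun j => by linarith [hy j]
  have hE : ∀ u : Fin ρ → ℂ, ∃ p, ‖u‖ < r → IsExp Y y u p := fun u => by
    by_cases hu : ‖u‖ < r
    · obtain ⟨p, hp⟩ := h.exists_isExp hy' (τ := u) (by linarith)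
      exact ⟨p, fun _ => hp⟩
    · exact ⟨y, fun h => absurd h hu⟩
  choose E hE using hE
  have hlt : r < r₀ := by linarith
  have e0 : w + (0 : ℂ) • (v - w) = w := by rw [zero_smul, add_zero]
  have e1 : w + (1 : ℂ) • (v - w) = v := by rw [one_smul, add_sub_cancel]
  have hEw : E (w + (0 : ℂ) • (v - w)) = p := by
    rw [e0]
    exact (hE w hw).unique hp
  have hEv : E (w + (1 : ℂ) • (v - w)) = p' := by
    rw [e1]
    exact (hE v hv).unique hp'
  have key := h.isExp_of_hasDerivAt hY ht (γ := fun z => E (w + z • (v - w)))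
    (θ := fun _ => v - w) (U := {z | ‖w + z • (v - w)‖ < r}) (M := ‖v - w‖) (z₀ := 0) (z₁ := 1)
    (convex_setOf_norm_add_smul_lt w (v - w) r)
    (fun z hz s => (h.mono le_rfl hlt.le).hasDerivAt_isExp hY hy' w (v - w)
      (γ := fun z => E (w + z • (v - w))) (fun z hz => hE _ hz) hz s)
    (fun z hz j => ?_) (fun _ _ => le_rfl) (by simpa using hw) (by simpa using hv) fun z hz => ?_
  · simp only [hEw, hEv] at key
    convert key using 1
    ext k
    rw [hp.apply_coord ht, hp'.apply_coord ht, Pi.sub_apply]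
    ring
  · have h1 := hb j y _ hy' _ (hz.trans hlt) (hE _ hz)
    have h2 : b j * ‖w + z • (v - w)‖ ≤ B * B⁻¹ :=
      mul_le_mul (hbB j) (hz.le.trans hrB) (norm_nonneg _) hB0.le
    rw [mul_inv_cancel₀ hB0.ne'] at h2
    have h3 := norm_add_le (y (g j)) (E (w + z • (v - w)) (g j) - y (g j))
    rw [add_sub_cancel] at h3
    exact h3.trans (le_trans (by linarith) (hy j))
  · have : (fun k => E (w + (1 : ℂ) • (v - w)) (t k) - E (w + z • (v - w)) (t k)) =
        v - (w + z • (v - w)) := by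
      ext k
      rw [hEv, hp'.apply_coord ht, (hE _ hz).apply_coord ht, Pi.sub_apply]
      ring
    rw [this]
    have h4 := norm_sub_le v (w + z • (v - w))
    have hz' : ‖w + z • (v - w)‖ < r := hz
    linarith

variable (Y) in
/-- `y` is a limit of points of `C` along the flow. -/
def FlowApprox (C : Set (S →ₐ[ℂ] ℂ)) (y : S →ₐ[ℂ] ℂ) : Prop :=
  ∀ ε > 0, ∃ w p, ‖w‖ < ε ∧ IsExp Y y w p ∧ p ∈ C

variable {C : Set (S →ₐ[ℂ] ℂ)} {D : Set (Fin ρ → ℂ)} {m r : ℝ}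

/-- Let `p ∈ C` be reached from `y` in a short time `w`. A time `u ∈ D` close to `v - w` leads from
`p` to a point of `C`, which is reached from `y'` in the short time `w + u - v`. -/
theorem LocalFlow.flowApprox_of_isExp (h : LocalFlow Y g m r) (hD : Dense D)
    (hC : ∀ c ∈ C, ∀ w ∈ D, ∀ c', IsExp Y c w c' → c' ∈ C) {y y' : S →ₐ[ℂ] ℂ}
    (hy : ∀ j, ‖y (g j)‖ + 1 ≤ m) {v : Fin ρ → ℂ} (hv : ‖v‖ < r) (hyy' : IsExp Y y v y')
    (hA : FlowApprox Y C y) : FlowApprox Y C y' := by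
  intro ε hε
  obtain ⟨w, p, hw, hp, hpC⟩ := hA r h.pos
  obtain ⟨u, hu, huD⟩ := Metric.dense_iff.1 hD (v - w) (min ε (r - ‖v‖))
    (lt_min hε (by linarith))
  rw [Metric.mem_ball, dist_eq_norm, lt_min_iff] at hu
  have e : w + u = v + (u - (v - w)) := by abel
  have hwu : ‖w + u‖ < r := by
    rw [e]
    linarith [norm_add_le v (u - (v - w))]
  obtain ⟨p', hp'⟩ := h.exists_isExp hy hwu
  have h1 := h.comp y hy w (w + u) p p' hw hwu hp hp'
  rw [add_sub_cancel_left] at h1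
  refine ⟨w + u - v, p', ?_, h.comp y hy v (w + u) y' p' hv hwu hyy' hp', hC p hpC u huD p' h1⟩
  rw [e, add_sub_cancel_left]
  exact hu.1

theorem LocalFlow.exists_isExp_of_flowApprox (h : LocalFlow Y g m r) {y : S →ₐ[ℂ] ℂ}
    (hy : ∀ j, ‖y (g j)‖ + 1 ≤ m) (hA : FlowApprox Y C y) :
    ∃ c ∈ C, ∃ w, IsExp Y c w y := by
  obtain ⟨w, p, hw, hp, hpC⟩ := hA r h.pos
  refine ⟨p, hpC, 0 - w, h.comp y hy w 0 p y hw ?_ hp (isExp_zero y)⟩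
  rw [norm_zero]
  exact h.pos

end FlowApprox

/-! ### Flows in charts, and comparison of two charts of the same Poisson prime. -/

namespace PoissonChart

open Topology

variable {R : Type*} [CommRing R] [Algebra ℂ R] {X : R →ₗ[ℂ] Derivation ℂ R R} {q : Ideal R}
  {ρ : ℕ} {S : Type*} [CommRing S] [Algebra ℂ S] (χ : PoissonChart X q ρ S)

theorem exists_localFlow [Algebra.FiniteType ℂ R] (hX : ∀ a b, X (X a b) = ⁅X a, X b⁆)
    (y : S →ₐ[ℂ] ℂ) : ∃ (n : ℕ) (g : Fin n → S) (m r : ℝ), (∀ j, ‖y (g j)‖ + 1 < m) ∧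
      LocalFlow χ.Y g m r := by
  have := χ.finiteType
  obtain ⟨n, f, hf⟩ := Algebra.FiniteType.iff_quotient_mvPolynomial''.1 this
  set g : Fin n → S := fun j => f (MvPolynomial.X j) with hg
  have e : (MvPolynomial.aeval g : MvPolynomial (Fin n) ℂ →ₐ[ℂ] S) = f :=
    (MvPolynomial.aeval_unique f).symm
  obtain ⟨r, hr⟩ := _root_.exists_localFlow (Y := χ.Y) (g := g) (t := fun k => χ.ι (χ.t k))
    (χ.Y_comm hX) χ.Y_t (by rw [e]; exact hf) (∑ j, ‖y (g j)‖ + 2)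
  refine ⟨n, g, _, r, fun j => ?_, hr⟩
  have := Finset.single_le_sum (f := fun j => ‖y (g j)‖) (fun j _ => norm_nonneg _)
    (Finset.mem_univ j)
  linarith

theorem exists_point {x : R →ₐ[ℂ] ℂ} (hx : ∀ f ∈ q, x f = 0) (hΔ : x χ.Δ ≠ 0) :
    ∃ y : S →ₐ[ℂ] ℂ, ∀ f, y (χ.ι f) = x f := χ.exists_lift x hx (isUnit_iff_ne_zero.2 hΔ)

theorem apply_Δ_ne_zero (y : S →ₐ[ℂ] ℂ) : y (χ.ι χ.Δ) ≠ 0 := (χ.isUnit.map y).ne_zero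

theorem apply_eq_div {y : S →ₐ[ℂ] ℂ} {s : S} {N : ℕ} {f : R} (h : χ.ι χ.Δ ^ N * s = χ.ι f) :
    y s = y (χ.ι f) / y (χ.ι (χ.Δ ^ N)) := by
  rw [← h, map_mul, map_pow, map_pow, map_pow, mul_div_cancel_left₀]
  exact pow_ne_zero _ (χ.apply_Δ_ne_zero y)

theorem tendsto_lift {α : Type*} {l : Filter α} {γ : α → S →ₐ[ℂ] ℂ} {y : S →ₐ[ℂ] ℂ}
    (h : ∀ f, Filter.Tendsto (fun a => γ a (χ.ι f)) l (𝓝 (y (χ.ι f)))) (s : S) :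
    Filter.Tendsto (fun a => γ a s) l (𝓝 (y s)) := by
  obtain ⟨N, f, hs⟩ := χ.exists_mul s
  simp only [χ.apply_eq_div hs]
  refine (h f).div (h _) ?_
  rw [map_pow, map_pow]
  exact pow_ne_zero _ (χ.apply_Δ_ne_zero y)

/-- Elements of `S` are quotients of functions on `R` with nonvanishing denominator, so the quotient
rule extends the equation of a Hamiltonian curve to `S`. In the fields `Y_k` its coefficients are
the velocities of the coordinates. -/
theorem hasDerivAt_lift {γ : ℂ → S →ₐ[ℂ] ℂ} {z : ℂ} {h : R}
    (hγ : ∀ f, HasDerivAt (fun w => γ w (χ.ι f)) (γ z (χ.ι (X h f))) z) (s : S) :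
    HasDerivAt (fun w => γ w s)
      (γ z (constField χ.Y (fun k => γ z (χ.ι (X h (χ.t k)))) s)) z := by
  obtain ⟨N, f, hs⟩ := χ.exists_mul s
  have hne : γ z (χ.ι (χ.Δ ^ N)) ≠ 0 := by
    rw [map_pow, map_pow]
    exact pow_ne_zero _ (χ.apply_Δ_ne_zero _)
  have h1 := (hγ f).fun_div (hγ (χ.Δ ^ N)) hne
  have h2 : ∀ w, γ w (χ.ι f) / γ w (χ.ι (χ.Δ ^ N)) = γ w s := fun w => (χ.apply_eq_div hs).symm
  simp only [h2] at h1
  refine h1.congr_deriv ?_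
  have h3 : γ z (constField χ.Y (fun k => γ z (χ.ι (X h (χ.t k)))) s) = γ z (χ.ham h s) := by
    rw [constField_apply, ham_eq, Derivation.sum_smul_apply, map_sum, map_sum]
    exact Finset.sum_congr rfl fun k _ => by rw [map_smul, map_mul, smul_eq_mul]
  have h4 := congrArg (fun u => γ z (χ.ham h u)) hs
  simp only [← map_pow, Derivation.leibniz, map_add, smul_eq_mul, map_mul, ham_ι] at h4
  rw [h3, ← h4, ← hs, ← map_pow, map_mul]
  field_simp
  ring

/-- The functions `c k i` are frozen at `y`, so the Hamiltonian `h` is adapted to this single point.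
That suffices because equations of curves are pointwise. -/
theorem exists_ham_constField (y : S →ₐ[ℂ] ℂ) (σ : Fin ρ → ℂ) :
    ∃ h : R, ∀ f, y (constField χ.Y σ (χ.ι f)) = y (χ.ι (X h f)) := by
  refine ⟨∑ k, ∑ i, (σ k * y (χ.c k i)) • χ.a i, fun f => ?_⟩
  rw [constField_apply, map_sum, map_sum]
  have e : ∀ A : R →ₗ[ℂ] Derivation ℂ R R, ∀ u : Fin ρ → R,
      (∑ k, A (u k)) f = ∑ k, A (u k) f := fun A u => by
    have := Derivation.sum_smul_apply Finset.univ (fun _ => (1 : R)) (fun k => A (u k)) f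
    simpa using this
  rw [e, map_sum, map_sum]
  refine Finset.sum_congr rfl fun k _ => ?_
  rw [map_sum, e, map_sum, map_sum, map_smul, Y_apply, map_sum, Finset.smul_sum]
  refine Finset.sum_congr rfl fun i _ => ?_
  rw [map_smul, Derivation.smul_apply, map_smul, map_smul, ham_ι, map_mul, smul_eq_mul, smul_eq_mul,
    mul_assoc]

variable {S' : Type*} [CommRing S'] [Algebra ℂ S'] (χ' : PoissonChart X q ρ S')

/-- A flow line in one chart is a flow line in any other chart. -/
theorem exists_isExp_of_isExp [Algebra.FiniteType ℂ R] (hX : ∀ a b, X (X a b) = ⁅X a, X b⁆)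
    {y : S →ₐ[ℂ] ℂ} {y' : S' →ₐ[ℂ] ℂ} (hy : ∀ f, y (χ.ι f) = y' (χ'.ι f)) {ε : ℝ} (hε : 0 < ε) :
    ∃ δ > 0, ∀ w p, ‖w‖ < δ → IsExp χ.Y y w p → ∃ w' p', ‖w'‖ < ε ∧ IsExp χ'.Y y' w' p' ∧
      ∀ f, p (χ.ι f) = p' (χ'.ι f) := by
  obtain ⟨n, g, m, r, hm, hr⟩ := χ.exists_localFlow hX y
  obtain ⟨n', g', m', r', hm', hr'⟩ := χ'.exists_localFlow hX y'
  have hy1 : ∀ j, ‖y (g j)‖ ≤ m := fun j => by linarith [hm j]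
  have hE : ∀ u : Fin ρ → ℂ, ∃ p, ‖u‖ < r → IsExp χ.Y y u p := fun u => by
    by_cases hu : ‖u‖ < r
    · obtain ⟨p, hp⟩ := hr.exists_isExp (fun j => (hm j).le) hu
      exact ⟨p, fun _ => hp⟩
    · exact ⟨y, fun h => absurd h hu⟩
  choose E hE using hE
  have hball : ∀ᶠ u : Fin ρ → ℂ in 𝓝 0, ‖u‖ < r := by
    filter_upwards [Metric.ball_mem_nhds (0 : Fin ρ → ℂ) hr.pos] with u hu
    simpa using hu
  have hEt : ∀ s, Filter.Tendsto (fun u => E u s) (𝓝 0) (𝓝 (y s)) := by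
    intro s
    obtain ⟨b, hb0, hb⟩ := hr.radius.exists_norm_sub_le s
    rw [tendsto_iff_norm_sub_tendsto_zero]
    refine squeeze_zero' (Filter.Eventually.of_forall fun _ => norm_nonneg _)
      (g := fun u => b * ‖u‖) ?_ ?_
    · filter_upwards [hball] with u hu
      exact hb y _ hy1 u (by linarith [hr.pos]) (hE u hu)
    · have : Filter.Tendsto (fun u : Fin ρ → ℂ => b * ‖u‖) (𝓝 0) (𝓝 (b * ‖(0 : Fin ρ → ℂ)‖)) :=
        (continuous_const.mul continuous_norm).tendsto 0
      simpa using this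
  have hkill : ∀ (p : S →ₐ[ℂ] ℂ), ∀ f ∈ q, p (χ.ι f) = 0 := fun p f hf => by
    rw [(χ.eq_zero_iff f).2 hf, map_zero]
  have hE' : ∀ u, ∃ p' : S' →ₐ[ℂ] ℂ, E u (χ.ι χ'.Δ) ≠ 0 → ∀ f, p' (χ'.ι f) = E u (χ.ι f) :=
    fun u => by
    by_cases hu : E u (χ.ι χ'.Δ) ≠ 0
    · obtain ⟨p', hp'⟩ := χ'.exists_point (x := (E u).comp χ.ι) (fun f hf => hkill _ f hf) hu
      exact ⟨p', fun _ => hp'⟩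
    · exact ⟨y', fun h => absurd h hu⟩
  choose E' hE' using hE'
  -- For short times the flow line stays in the domain of `χ'`, so the arbitrary values of `E` and
  -- `E'` elsewhere do not matter.
  have hΔ : ∀ᶠ u in 𝓝 0, E u (χ.ι χ'.Δ) ≠ 0 :=
    (hEt _).eventually_ne (by rw [hy]; exact χ'.apply_Δ_ne_zero y')
  have hEt' : ∀ s, Filter.Tendsto (fun u => E' u s) (𝓝 0) (𝓝 (y' s)) := by
    refine χ'.tendsto_lift fun f => ?_
    rw [← hy]
    refine (hEt (χ.ι f)).congr' ?_
    filter_upwards [hΔ] with u hu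
    rw [hE' u hu]
  have hg' : ∀ᶠ u in 𝓝 0, ∀ j, ‖E' u (g' j)‖ < m' := by
    rw [Filter.eventually_all]
    intro j
    exact (hEt' (g' j)).norm.eventually_lt_const (by linarith [hm' j])
  set κ : ℝ := min ε r' / 2 with hκ
  have hκ0 : 0 < κ := half_pos (lt_min hε hr'.pos)
  have ht' : ∀ᶠ u in 𝓝 0, ∀ k, ‖E' u (χ'.ι (χ'.t k)) - y' (χ'.ι (χ'.t k))‖ < κ := by
    rw [Filter.eventually_all]
    intro k
    have := ((hEt' (χ'.ι (χ'.t k))).sub_const (y' (χ'.ι (χ'.t k)))).norm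
    rw [sub_self, norm_zero] at this
    exact this.eventually_lt_const hκ0
  obtain ⟨δ, hδ, hball'⟩ := Metric.eventually_nhds_iff.1
    (hball.and (hΔ.and (hg'.and ht')))
  simp only [dist_zero_right] at hball'
  refine ⟨δ, hδ, fun w p hw hp => ?_⟩
  have hU : Convex ℝ {z : ℂ | ‖(0 : Fin ρ → ℂ) + z • w‖ < δ} :=
    convex_setOf_norm_add_smul_lt 0 w δ
  have hopen : IsOpen {z : ℂ | ‖(0 : Fin ρ → ℂ) + z • w‖ < δ} :=
    isOpen_lt (by fun_prop) continuous_const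
  choose b hb0 hb using fun k => hr.radius.exists_norm_sub_le
    (constField χ.Y w (χ.ι (χ'.t k)))
  have hcurve : ∀ z : ℂ, ‖(0 : Fin ρ → ℂ) + z • w‖ < δ → ∀ s,
      HasDerivAt (fun z : ℂ => E (0 + z • w) s) (E (0 + z • w) (constField χ.Y w s)) z := by
    intro z hz s
    exact (hr.radius.mono le_rfl (by linarith [hr.pos])).hasDerivAt_isExp (χ.Y_comm hX) hy1 0 w
      (γ := fun z => E (0 + z • w)) (r := r) (fun z hz => hE _ hz) (hball' hz).1 s
  -- The line is tangent at each `z` to the Hamiltonian field of some `H z`. The velocity in the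
  -- coordinates of `χ'` therefore varies with `z`, as `FlowRadius.isExp_of_hasDerivAt` allows.
  choose H hH using fun z : ℂ => χ.exists_ham_constField (E (0 + z • w)) w
  have hder : ∀ z : ℂ, ‖(0 : Fin ρ → ℂ) + z • w‖ < δ → ∀ f,
      HasDerivAt (fun z : ℂ => E' (0 + z • w) (χ'.ι f)) (E' (0 + z • w) (χ'.ι (X (H z) f))) z := by
    intro z hz f
    have h1 := hcurve z hz (χ.ι f)
    rw [hH, ← hE' _ (hball' hz).2.1] at h1
    refine h1.congr_of_eventuallyEq ?_
    filter_upwards [hopen.mem_nhds hz] with z' hz'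
    exact hE' _ (hball' hz').2.1 f
  have hEp : E (0 + (1 : ℂ) • w) = p := by
    have : (0 : Fin ρ → ℂ) + (1 : ℂ) • w = w := by simp
    rw [this]
    exact (hE w (hball' hw).1).unique hp
  have hE0 : E' (0 + (0 : ℂ) • w) = y' := by
    have e : (0 : Fin ρ → ℂ) + (0 : ℂ) • w = 0 := by simp
    have h0 : ‖(0 : Fin ρ → ℂ)‖ < δ := by simpa using hδ
    rw [e]
    apply χ'.algHom_ext
    intro f
    rw [hE' 0 (hball' h0).2.1, ← hy, (hE 0 (hball' h0).1).unique (isExp_zero y)]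
  have h1w : ‖(0 : Fin ρ → ℂ) + (1 : ℂ) • w‖ < δ := by simpa using hw
  have h0w : ‖(0 : Fin ρ → ℂ) + (0 : ℂ) • w‖ < δ := by simpa using hδ
  have key := hr'.radius.isExp_of_hasDerivAt (χ'.Y_comm hX) (t := fun k => χ'.ι (χ'.t k)) χ'.Y_t
    (γ := fun z => E' (0 + z • w)) (θ := fun z k => E' (0 + z • w) (χ'.ι (X (H z) (χ'.t k))))
    (M := ∑ k, (‖y (constField χ.Y w (χ.ι (χ'.t k)))‖ + b k * r)) hU
    (fun z hz s => χ'.hasDerivAt_lift (γ := fun z => E' (0 + z • w)) (hder z hz) s)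
    (fun z hz j => ((hball' hz).2.2.1 j).le) (fun z hz => ?_) h0w h1w fun z hz => ?_
  · refine ⟨_, _, ?_, by simpa only [hE0] using key, fun f => ?_⟩
    · rw [pi_norm_lt_iff hε]
      intro k
      have := (hball' h1w).2.2.2 k
      refine this.trans_le ?_
      rw [hκ]
      linarith [min_le_left ε r']
    · rw [hE' _ (hball' h1w).2.1, hEp]
  · have hpos : ∀ k, 0 ≤ ‖y (constField χ.Y w (χ.ι (χ'.t k)))‖ + b k * r := fun k => by
      have := mul_nonneg (hb0 k) hr.pos.le
      positivity
    rw [pi_norm_le_iff_of_nonneg (Finset.sum_nonneg fun k _ => hpos k)]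
    intro k
    rw [hE' _ (hball' hz).2.1, ← hH]
    refine le_trans ?_ (Finset.single_le_sum (fun k _ => hpos k) (Finset.mem_univ k))
    have h1 := hb k y _ hy1 _ (by linarith [hr.pos, (hball' hz).1]) (hE _ (hball' hz).1)
    have h2 := norm_add_le (y (constField χ.Y w (χ.ι (χ'.t k))))
      (E (0 + z • w) (constField χ.Y w (χ.ι (χ'.t k))) - y (constField χ.Y w (χ.ι (χ'.t k))))
    rw [add_sub_cancel] at h2
    have h3 : b k * ‖(0 : Fin ρ → ℂ) + z • w‖ ≤ b k * r :=
      mul_le_mul_of_nonneg_left (hball' hz).1.le (hb0 k)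
    linarith
  · rw [pi_norm_lt_iff (by linarith [hr'.pos])]
    intro k
    have h1 := (hball' h1w).2.2.2 k
    have h2 := (hball' hz).2.2.2 k
    have h3 := norm_sub_le (E' (0 + (1 : ℂ) • w) (χ'.ι (χ'.t k)) - y' (χ'.ι (χ'.t k)))
      (E' (0 + z • w) (χ'.ι (χ'.t k)) - y' (χ'.ι (χ'.t k)))
    rw [sub_sub_sub_cancel_right] at h3
    have h4 : κ ≤ r' / 2 := by
      rw [hκ]
      linarith [min_le_right ε r']
    linarith

end PoissonChart

/-! ### Leaves in Darboux charts -/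

section HamiltonianCurve

open Topology

variable {R : Type*} [CommRing R] [Algebra ℂ R] (X : R →ₗ[ℂ] Derivation ℂ R R)

/-- Two points that lie on a common integral curve of a Hamiltonian vector field. -/
def HamStep (x y : R →ₐ[ℂ] ℂ) : Prop :=
  ∃ (h : R) (r : ℝ) (γ : ℂ → R →ₐ[ℂ] ℂ), (∀ z ∈ Metric.ball (0 : ℂ) r, ∀ f : R,
    HasDerivAt (fun w => γ w f) (γ z (X h f)) z) ∧ γ 0 = x ∧ ∃ z ∈ Metric.ball (0 : ℂ) r, γ z = y

variable {X}

/-- The derivatives of `γ w f` at `z₀` are the values `γ z₀ (D^k f)`, which all vanish. The function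
is holomorphic on a disc, so the identity theorem applies. -/
theorem apply_eq_zero_of_integralCurve {D : Derivation ℂ R R} {γ : ℂ → R →ₐ[ℂ] ℂ} {r : ℝ}
    (hγ : ∀ z ∈ Metric.ball (0 : ℂ) r, ∀ f : R, HasDerivAt (fun w => γ w f) (γ z (D f)) z)
    {n : Ideal R} (hn : ∀ f ∈ n, D f ∈ n) {z₀ z : ℂ} (hz₀ : z₀ ∈ Metric.ball (0 : ℂ) r)
    (hz : z ∈ Metric.ball (0 : ℂ) r) (h : ∀ f ∈ n, γ z₀ f = 0) : ∀ f ∈ n, γ z f = 0 := by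
  intro f hf
  have hd : DifferentiableOn ℂ (fun w => γ w f) (Metric.ball 0 r) := fun w hw =>
    (hγ w hw f).differentiableAt.differentiableWithinAt
  have hit : ∀ k, ∀ w ∈ Metric.ball (0 : ℂ) r,
      iteratedDeriv k (fun w => γ w f) w = γ w (D^[k] f) := by
    intro k
    induction k with
    | zero => intro w _; simp
    | succ k ih =>
      intro w hw
      have h1 : iteratedDeriv k (fun w => γ w f) =ᶠ[𝓝 w] fun w => γ w (D^[k] f) := by
        filter_upwards [Metric.isOpen_ball.mem_nhds hw] with w' hw'
        exact ih w' hw'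
      rw [iteratedDeriv_succ, h1.deriv_eq, (hγ w hw _).deriv, Function.iterate_succ_apply']
  have hmem : ∀ k, D^[k] f ∈ n := by
    intro k
    induction k with
    | zero => exact hf
    | succ k ih => rw [Function.iterate_succ_apply']; exact hn _ ih
  obtain ⟨δ, hδ, hsub⟩ := Metric.isOpen_iff.1 Metric.isOpen_ball z₀ hz₀
  have hev : (fun w => γ w f) =ᶠ[𝓝 z₀] 0 := by
    filter_upwards [Metric.ball_mem_nhds z₀ hδ] with w hw
    rw [← Complex.taylorSeries_eq_on_ball (hd.mono hsub) hw]
    simp only [hit _ z₀ hz₀, h _ (hmem _), smul_zero, tsum_zero, Pi.zero_apply]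
  exact (hd.analyticOnNhd Metric.isOpen_ball).eqOn_zero_of_preconnected_of_eventuallyEq_zero
    (convex_ball (0 : ℂ) r).isPreconnected hz₀ hev hz

theorem HamStep.apply_eq_zero_iff {x y : R →ₐ[ℂ] ℂ} (h : HamStep X x y) {n : Ideal R}
    (hn : IsPoissonIdeal X n) : (∀ f ∈ n, x f = 0) ↔ ∀ f ∈ n, y f = 0 := by
  obtain ⟨h, r, γ, hγ, rfl, z, hz, rfl⟩ := h
  have h0 : (0 : ℂ) ∈ Metric.ball (0 : ℂ) r :=
    Metric.mem_ball_self ((dist_nonneg).trans_lt (Metric.mem_ball.1 hz))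
  exact ⟨apply_eq_zero_of_integralCurve hγ (hn h) h0 hz,
    apply_eq_zero_of_integralCurve hγ (hn h) hz h0⟩

theorem eqvGen_hamStep_poissonCore_eq {x y : R →ₐ[ℂ] ℂ} (h : Relation.EqvGen (HamStep X) x y) :
    poissonCore X (RingHom.ker x) = poissonCore X (RingHom.ker y) := by
  induction h with
  | rel x y h =>
    have hc := fun x : R →ₐ[ℂ] ℂ => isPoissonIdeal_poissonCore (X := X) (RingHom.ker x)
    refine le_antisymm (le_poissonCore (hc x) fun f hf => ?_) (le_poissonCore (hc y) fun f hf => ?_)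
    · exact (h.apply_eq_zero_iff (hc x)).1 (fun f hf => RingHom.mem_ker.1 (poissonCore_le X _ hf)) f hf
    · exact (h.apply_eq_zero_iff (hc y)).2 (fun f hf => RingHom.mem_ker.1 (poissonCore_le X _ hf)) f hf
  | refl => rfl
  | symm _ _ _ ih => exact ih.symm
  | trans _ _ _ _ _ h1 h2 => exact h1.trans h2

end HamiltonianCurve

/-- The closure of a point under countably many partial functions is countable. -/
theorem exists_countable_closure {α J : Type*} [Countable J] (T : J → α → α → Prop)
    (hT : ∀ j a b b', T j a b → T j a b' → b = b') (a : α) :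
    ∃ C : Set α, C.Countable ∧ a ∈ C ∧ ∀ j, ∀ c ∈ C, ∀ c', T j c c' → c' ∈ C := by
  have h : ∀ j c, ∃ c', ∀ b, T j c b → b = c' := by
    intro j c
    by_cases hc : ∃ b, T j c b
    · obtain ⟨b, hb⟩ := hc
      exact ⟨b, fun b' hb' => hT j c _ _ hb' hb⟩
    · exact ⟨c, fun b hb => absurd ⟨b, hb⟩ hc⟩
  choose F hF using h
  refine ⟨Set.range fun l : List J => l.foldr F a, Set.countable_range _, ⟨[], rfl⟩, ?_⟩
  rintro j _ ⟨l, rfl⟩ c' hc'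
  exact ⟨j :: l, (hF j _ c' hc').symm⟩

namespace PoissonChart

open Topology

variable {R : Type*} [CommRing R] [Algebra ℂ R] {X : R →ₗ[ℂ] Derivation ℂ R R} {q : Ideal R}
  {ρ : ℕ} {S : Type*} [CommRing S] [Algebra ℂ S] (χ : PoissonChart X q ρ S)

/-- `x` is a limit of points of `C` along the leaf through `x`. -/
def Approx (C : Set (R →ₐ[ℂ] ℂ)) (x : R →ₐ[ℂ] ℂ) : Prop :=
  ∃ y : S →ₐ[ℂ] ℂ, y.comp χ.ι = x ∧ FlowApprox χ.Y {c | c.comp χ.ι ∈ C} y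

variable {C : Set (R →ₐ[ℂ] ℂ)} {D : Set (Fin ρ → ℂ)}

theorem approx_of_approx [Algebra.FiniteType ℂ R] (hX : ∀ a b, X (X a b) = ⁅X a, X b⁆)
    {S' : Type*} [CommRing S'] [Algebra ℂ S'] (χ' : PoissonChart X q ρ S') {x : R →ₐ[ℂ] ℂ}
    (h : χ.Approx C x) (hx : x χ'.Δ ≠ 0) : χ'.Approx C x := by
  obtain ⟨y, rfl, hy⟩ := h
  obtain ⟨y', hy'⟩ := χ'.exists_point (x := y.comp χ.ι) (fun f hf => by
    rw [AlgHom.comp_apply, (χ.eq_zero_iff f).2 hf, map_zero]) hx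
  refine ⟨y', AlgHom.ext hy', fun ε hε => ?_⟩
  obtain ⟨δ, hδ, h⟩ := χ.exists_isExp_of_isExp χ' hX (fun f => (hy' f).symm) hε
  obtain ⟨w, p, hw, hp, hpC⟩ := hy δ hδ
  obtain ⟨w', p', hw', hp', e⟩ := h w p hw hp
  refine ⟨w', p', hw', hp', ?_⟩
  have : p'.comp χ'.ι = p.comp χ.ι := AlgHom.ext fun f => (e f).symm
  rw [Set.mem_ofPred_eq, this]
  exact hpC

/-- A short piece of a Hamiltonian curve is a flow line of the chart between any two of its points,
so `LocalFlow.flowApprox_of_isExp` applies in both directions. -/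
theorem eventually_approx_iff [Algebra.FiniteType ℂ R] (hX : ∀ a b, X (X a b) = ⁅X a, X b⁆)
    (hD : Dense D) (hC : ∀ c : S →ₐ[ℂ] ℂ, c.comp χ.ι ∈ C → ∀ w ∈ D, ∀ c', IsExp χ.Y c w c' →
      c'.comp χ.ι ∈ C) {γ : ℂ → R →ₐ[ℂ] ℂ} {h : R} {U : Set ℂ} (hU : IsOpen U)
    (hγ : ∀ z ∈ U, ∀ f, HasDerivAt (fun w => γ w f) (γ z (X h f)) z)
    (hq : ∀ z ∈ U, ∀ f ∈ q, γ z f = 0) {z₀ : ℂ} (hz₀ : z₀ ∈ U) (hΔ : γ z₀ χ.Δ ≠ 0) :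
    ∀ᶠ z in 𝓝 z₀, (χ.Approx C (γ z₀) ↔ χ.Approx C (γ z)) := by
  obtain ⟨y, hy⟩ := χ.exists_point (hq z₀ hz₀) hΔ
  obtain ⟨n, g, m, r, hm, hr⟩ := χ.exists_localFlow hX y
  have hlift : ∀ z, ∃ p : S →ₐ[ℂ] ℂ, z ∈ U → γ z χ.Δ ≠ 0 → ∀ f, p (χ.ι f) = γ z f := fun z => by
    by_cases hz : z ∈ U ∧ γ z χ.Δ ≠ 0
    · obtain ⟨p, hp⟩ := χ.exists_point (hq z hz.1) hz.2
      exact ⟨p, fun _ _ => hp⟩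
    · exact ⟨y, fun h h' => absurd ⟨h, h'⟩ hz⟩
  choose E hE using hlift
  have hcont : ∀ f, Filter.Tendsto (fun z => γ z f) (𝓝 z₀) (𝓝 (γ z₀ f)) := fun f =>
    (hγ z₀ hz₀ f).continuousAt.tendsto
  have hUΔ : ∀ᶠ z in 𝓝 z₀, z ∈ U ∧ γ z χ.Δ ≠ 0 :=
    (hU.eventually_mem hz₀).and ((hcont χ.Δ).eventually_ne hΔ)
  have hEt : ∀ s, Filter.Tendsto (fun z => E z s) (𝓝 z₀) (𝓝 (y s)) := by
    refine χ.tendsto_lift fun f => ?_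
    rw [hy]
    refine (hcont f).congr' ?_
    filter_upwards [hUΔ] with z hz
    rw [hE z hz.1 hz.2]
  have hg : ∀ᶠ z in 𝓝 z₀, ∀ j, ‖E z (g j)‖ < m - 1 := by
    rw [Filter.eventually_all]
    intro j
    exact (hEt (g j)).norm.eventually_lt_const (by linarith [hm j])
  have ht : ∀ᶠ z in 𝓝 z₀, ∀ k, ‖E z (χ.ι (χ.t k)) - y (χ.ι (χ.t k))‖ < r / 4 := by
    rw [Filter.eventually_all]
    intro k
    have := ((hEt (χ.ι (χ.t k))).sub_const (y (χ.ι (χ.t k)))).norm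
    rw [sub_self, norm_zero] at this
    exact this.eventually_lt_const (by linarith [hr.pos])
  set M : ℝ := ∑ k, ‖γ z₀ (X h (χ.t k))‖ + 1 with hM
  have hθ : ∀ᶠ z in 𝓝 z₀, ∀ k, ‖γ z (X h (χ.t k))‖ < M := by
    rw [Filter.eventually_all]
    intro k
    refine (hcont _).norm.eventually_lt_const ?_
    have := Finset.single_le_sum (f := fun k => ‖γ z₀ (X h (χ.t k))‖) (fun k _ => norm_nonneg _)
      (Finset.mem_univ k)
    linarith
  obtain ⟨δ, hδ, hball⟩ := Metric.eventually_nhds_iff_ball.1 (hUΔ.and (hg.and (ht.and hθ)))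
  have hder : ∀ z ∈ Metric.ball z₀ δ, ∀ f,
      HasDerivAt (fun z => E z (χ.ι f)) (E z (χ.ι (X h f))) z := by
    intro z hz f
    rw [hE z (hball z hz).1.1 (hball z hz).1.2]
    refine (hγ z (hball z hz).1.1 f).congr_of_eventuallyEq ?_
    filter_upwards [Metric.isOpen_ball.mem_nhds hz] with z' hz'
    exact hE z' (hball z' hz').1.1 (hball z' hz').1.2 f
  have htt : ∀ z ∈ Metric.ball z₀ δ, ∀ z' ∈ Metric.ball z₀ δ,
      ‖(fun k => E z' (χ.ι (χ.t k)) - E z (χ.ι (χ.t k)))‖ < r := by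
    intro z hz z' hz'
    rw [pi_norm_lt_iff hr.pos]
    intro k
    have h1 := (hball z hz).2.2.1 k
    have h2 := (hball z' hz').2.2.1 k
    have h3 := norm_sub_le (E z' (χ.ι (χ.t k)) - y (χ.ι (χ.t k)))
      (E z (χ.ι (χ.t k)) - y (χ.ι (χ.t k)))
    rw [sub_sub_sub_cancel_right] at h3
    linarith [hr.pos]
  have hM0 : 0 ≤ M := by positivity
  have key : ∀ z ∈ Metric.ball z₀ δ, ∀ z' ∈ Metric.ball z₀ δ,
      χ.Approx C (γ z) → χ.Approx C (γ z') := by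
    intro z hz z' hz' ⟨p, hp, hA⟩
    have e : p = E z := by
      apply χ.algHom_ext
      intro f
      rw [hE z (hball z hz).1.1 (hball z hz).1.2, ← hp, AlgHom.comp_apply]
    subst e
    refine ⟨E z', AlgHom.ext (hE z' (hball z' hz').1.1 (hball z' hz').1.2), ?_⟩
    have h1 := hr.radius.isExp_of_hasDerivAt (χ.Y_comm hX) (t := fun k => χ.ι (χ.t k)) χ.Y_t
      (γ := E) (θ := fun z k => E z (χ.ι (X h (χ.t k)))) (M := M) (convex_ball z₀ δ)
      (fun z hz s => χ.hasDerivAt_lift (hder z hz) s)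
      (fun z hz j => by linarith [(hball z hz).2.1 j]) (fun z hz => by
        rw [pi_norm_le_iff_of_nonneg hM0]
        intro k
        rw [hE z (hball z hz).1.1 (hball z hz).1.2]
        exact ((hball z hz).2.2.2 k).le) hz hz'
      (fun z hz => (htt z hz z' hz').trans (by linarith [hr.pos]))
    exact hr.flowApprox_of_isExp hD (fun c hc w hw c' hcc' => hC c hc w hw c' hcc')
      (fun j => by linarith [(hball z hz).2.1 j]) (htt z hz z' hz') h1 hA
  filter_upwards [Metric.ball_mem_nhds z₀ hδ] with z hz
  exact ⟨key z₀ (Metric.mem_ball_self hδ) z hz, key z hz z₀ (Metric.mem_ball_self hδ)⟩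

/-- In a chart, a leaf meets each fibre of the coordinate map in a countable set. -/
theorem countable_leaf_fiber [Algebra.FiniteType ℂ R] (hX : ∀ a b, X (X a b) = ⁅X a, X b⁆)
    {I : Type*} [Countable I] {S : I → Type*} [∀ i, CommRing (S i)] [∀ i, Algebra ℂ (S i)]
    (χ : ∀ i, PoissonChart X q ρ (S i)) {n : Ideal R} (hn : IsPoissonIdeal X n)
    (hcov : ∀ x : R →ₐ[ℂ] ℂ, (∀ f ∈ q, x f = 0) → (¬ ∀ f ∈ n, x f = 0) → ∃ i, x (χ i).Δ ≠ 0)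
    {x₀ : R →ₐ[ℂ] ℂ} (hx₀ : ∀ f ∈ q, x₀ f = 0) (hx₀' : ¬ ∀ f ∈ n, x₀ f = 0) (i : I)
    (v : Fin ρ → ℂ) : {x : R →ₐ[ℂ] ℂ | Relation.EqvGen (HamStep X) x₀ x ∧ x (χ i).Δ ≠ 0 ∧
      ∀ k, x ((χ i).t k) = v k}.Countable := by
  obtain ⟨D, hDc, hD⟩ := TopologicalSpace.exists_countable_dense (Fin ρ → ℂ)
  have := hDc.to_subtype
  -- `C` is the orbit of `x₀` under the partial flows with times in the countable dense set `D`, in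
  -- all charts. It is countable, and the aim is that the whole leaf is approximated by it.
  obtain ⟨C, hCc, hx₀C, hC⟩ := exists_countable_closure (J := I × D)
    (fun j x x' => ∃ y y', y.comp (χ j.1).ι = x ∧ y'.comp (χ j.1).ι = x' ∧
      IsExp (χ j.1).Y y j.2 y') (by
      rintro j _ _ _ ⟨y, y', rfl, rfl, h⟩ ⟨z, z', e, rfl, h'⟩
      have : z = y := (χ j.1).algHom_ext fun f => DFunLike.congr_fun e f
      subst this
      rw [h.unique h']) x₀
  have hC' : ∀ i, ∀ c : S i →ₐ[ℂ] ℂ, c.comp (χ i).ι ∈ C → ∀ w ∈ D, ∀ c', IsExp (χ i).Y c w c' →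
      c'.comp (χ i).ι ∈ C := fun i c hc w hw c' h =>
    hC ⟨i, w, hw⟩ _ hc _ ⟨c, c', rfl, rfl, h⟩
  -- Since `q` and `n` are Poisson, `A` is constant along leaves, so the leaf of `x₀` stays in the
  -- region covered by the charts.
  set A : (R →ₐ[ℂ] ℂ) → Prop := fun x => (∀ f ∈ q, x f = 0) ∧ ¬ ∀ f ∈ n, x f = 0 with hA
  set P : (R →ₐ[ℂ] ℂ) → Prop := fun x => ∃ i, (χ i).Approx C x with hP
  have hPall : ∀ x, P x → ∀ i, x (χ i).Δ ≠ 0 → (χ i).Approx C x := by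
    rintro x ⟨j, hj⟩ i hi
    exact (χ j).approx_of_approx hX (χ i) hj hi
  have hq : IsPoissonIdeal X q := (χ i).isPoisson
  have hstep : ∀ x y, HamStep X x y → ((A x ∧ P x) ↔ (A y ∧ P y)) := by
    intro x y hxy
    have hAxy : A x ↔ A y :=
      and_congr (hxy.apply_eq_zero_iff hq) (not_congr (hxy.apply_eq_zero_iff hn))
    rw [← hAxy]
    refine and_congr_right fun hAx => ?_
    obtain ⟨h, r, γ, hγ, rfl, z, hz, rfl⟩ := hxy
    have h0 : (0 : ℂ) ∈ Metric.ball (0 : ℂ) r :=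
      Metric.mem_ball_self ((dist_nonneg).trans_lt (Metric.mem_ball.1 hz))
    have hAz : ∀ z ∈ Metric.ball (0 : ℂ) r, A (γ z) := fun z hz => by
      have hs : HamStep X (γ 0) (γ z) := ⟨h, r, γ, hγ, rfl, z, hz, rfl⟩
      exact ⟨(hs.apply_eq_zero_iff hq).1 hAx.1, fun hc => hAx.2 ((hs.apply_eq_zero_iff hn).2 hc)⟩
    -- Being approximable is locally constant along a Hamiltonian curve, and a disc is connected.
    refine (convex_ball (0 : ℂ) r).isPreconnected.induction₂ (fun z z' => P (γ z) ↔ P (γ z'))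
      (fun z hz => ?_) (fun _ _ _ _ _ _ h1 h2 => h1.trans h2) (fun _ _ _ _ h => h.symm) h0 hz
    apply nhdsWithin_le_nhds
    obtain ⟨i, hi⟩ := hcov _ (hAz z hz).1 (hAz z hz).2
    filter_upwards [(χ i).eventually_approx_iff hX hD (hC' i) Metric.isOpen_ball hγ
      (fun z hz => (hAz z hz).1) hz hi,
      (hγ z hz (χ i).Δ).continuousAt.eventually_ne hi] with z' hz' hi'
    exact ⟨fun h => ⟨i, hz'.1 (hPall _ h i hi)⟩, fun h => ⟨i, hz'.2 (hPall _ h i hi')⟩⟩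
  have hEqv : ∀ x y, Relation.EqvGen (HamStep X) x y → ((A x ∧ P x) ↔ (A y ∧ P y)) := by
    intro x y h
    induction h with
    | rel x y h => exact hstep x y h
    | refl => rfl
    | symm _ _ _ ih => exact ih.symm
    | trans _ _ _ _ _ h1 h2 => exact h1.trans h2
  have hP₀ : A x₀ ∧ P x₀ := by
    refine ⟨⟨hx₀, hx₀'⟩, ?_⟩
    obtain ⟨i, hi⟩ := hcov _ hx₀ hx₀'
    obtain ⟨y, hy⟩ := (χ i).exists_point hx₀ hi
    have e : y.comp (χ i).ι = x₀ := AlgHom.ext hy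
    refine ⟨i, y, e, fun ε hε => ⟨0, y, by rwa [norm_zero], isExp_zero y, ?_⟩⟩
    rw [Set.mem_ofPred_eq, e]
    exact hx₀C
  -- Each point of the leaf in this chart is the endpoint of a flow from some `c ∈ C`. The flow
  -- shifts the coordinates by its time, so `c` and the prescribed coordinates determine the point.
  refine (hCc.biUnion (t := fun c _ => {x | ∃ (p y : S i →ₐ[ℂ] ℂ) (w : Fin ρ → ℂ),
    p.comp (χ i).ι = c ∧ y.comp (χ i).ι = x ∧ IsExp (χ i).Y p w y ∧
      ∀ k, x ((χ i).t k) = v k}) fun c _ => ?_).mono ?_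
  · apply Set.Subsingleton.countable
    rintro _ ⟨p, y, w, rfl, rfl, h, hv⟩ _ ⟨p', y', w', e, rfl, h', hv'⟩
    have : p' = p := (χ i).algHom_ext fun f => DFunLike.congr_fun e f
    subst this
    have hw : w = w' := by
      ext k
      have h1 := h.apply_coord (t := fun k => (χ i).ι ((χ i).t k)) (χ i).Y_t k
      have h2 := h'.apply_coord (t := fun k => (χ i).ι ((χ i).t k)) (χ i).Y_t k
      have h3 := hv k
      have h4 := hv' k
      rw [AlgHom.comp_apply] at h3 h4
      rw [h3] at h1
      rw [h4, h1] at h2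
      exact add_left_cancel h2
    subst hw
    rw [h.unique h']
  · rintro x ⟨hx, hxΔ, hxv⟩
    obtain ⟨y, rfl, hy⟩ := hPall x ((hEqv _ _ hx).1 hP₀).2 i hxΔ
    obtain ⟨l, g, m, r, hm, hr⟩ := (χ i).exists_localFlow hX y
    obtain ⟨c, hc, w, hw⟩ := hr.exists_isExp_of_flowApprox (fun j => (hm j).le) hy
    exact Set.mem_biUnion hc ⟨c, y, w, rfl, rfl, hw, hxv⟩

end PoissonChart

/-! ### Algebraicity of charts -/

/-- Chevalley's theorem: the image of `Spec S` is constructible and contains the generic point,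
since `f` is injective, so it contains a nonempty basic open set. A closed point in the image lifts
to a closed point. -/
theorem exists_ne_zero_forall_exists_algHom {B S : Type*} [CommRing B] [IsDomain B] [Algebra ℂ B]
    [Algebra.FiniteType ℂ B] [CommRing S] [IsDomain S] [Algebra ℂ S] [Algebra.FiniteType ℂ S]
    (f : B →ₐ[ℂ] S) (hf : Function.Injective f) :
    ∃ b : B, b ≠ 0 ∧ ∀ φ : B →ₐ[ℂ] ℂ, φ b ≠ 0 → ∃ ψ : S →ₐ[ℂ] ℂ, ψ.comp f = φ := by
  have hB : IsNoetherianRing B := Algebra.FiniteType.isNoetherianRing ℂ B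
  have hft : (f : B →+* S).FiniteType := by
    refine RingHom.FiniteType.of_comp_finiteType (f := algebraMap ℂ B) ?_
    have e : (f : B →+* S).comp (algebraMap ℂ B) = algebraMap ℂ S := f.comp_algebraMap
    rw [e]
    exact RingHom.finiteType_algebraMap.2 inferInstance
  obtain ⟨T, hT⟩ := PrimeSpectrum.exists_constructibleSetData_iff.2
    (PrimeSpectrum.isConstructible_range_comap (RingHom.FinitePresentation.of_finiteType.1 hft))
  have h0 : (⊥ : PrimeSpectrum B) ∈ T.toSet := by
    rw [hT]
    refine ⟨⊥, ?_⟩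
    ext1
    change Ideal.comap (f : B →+* S) ⊥ = ⊥
    exact (RingHom.injective_iff_ker_eq_bot _).1 hf
  simp only [PrimeSpectrum.ConstructibleSetData.toSet, Set.mem_iUnion] at h0
  obtain ⟨C, hC, h0, h1⟩ := h0
  have hg : ∀ i, C.g i = 0 := fun i => h0 ⟨i, rfl⟩
  have hb : C.f ≠ 0 := fun h => h1 (by
    rintro _ rfl
    exact h)
  refine ⟨C.f, hb, fun φ hφ => ?_⟩
  have hmax : (RingHom.ker φ).IsMaximal := RingHom.ker_isMaximal_of_surjective _ fun c =>
    ⟨algebraMap ℂ B c, φ.commutes c⟩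
  have hm : (⟨RingHom.ker φ, hmax.isPrime⟩ : PrimeSpectrum B) ∈ T.toSet := by
    simp only [PrimeSpectrum.ConstructibleSetData.toSet, Set.mem_iUnion]
    refine ⟨C, hC, ?_, fun h => hφ (h rfl)⟩
    rintro _ ⟨i, rfl⟩
    rw [hg]
    exact zero_mem _
  rw [hT] at hm
  obtain ⟨P, hP⟩ := hm
  obtain ⟨M, hM, hPM⟩ := Ideal.exists_le_maximal P.asIdeal P.isPrime.ne_top
  obtain ⟨π, hπ⟩ := exists_algHom_ker_eq M
  have hker : ∀ x, φ x = 0 → π (f x) = 0 := by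
    intro x hx
    rw [← RingHom.mem_ker, hπ]
    apply hPM
    have h2 := congrArg PrimeSpectrum.asIdeal hP
    have h3 : x ∈ (PrimeSpectrum.comap (f : B →+* S) P).asIdeal := by
      rw [h2]
      exact hx
    exact h3
  refine ⟨π, AlgHom.ext fun x => ?_⟩
  have h4 := hker (x - algebraMap ℂ B (φ x)) (by rw [map_sub, φ.commutes]; exact sub_self _)
  rw [map_sub, map_sub, f.commutes, π.commutes, sub_eq_zero] at h4
  exact h4

/-- If `s` were transcendental, `Spec S` would dominate `Spec A[T]`. Over a general point of `Spec
A` all but finitely many complex numbers would then be values of `s` on a single fibre of `u`, which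
would be uncountable. -/
theorem isAlgebraic_adjoin_of_countable_fiber {S κ : Type*} [CommRing S] [IsDomain S] [Algebra ℂ S]
    [Algebra.FiniteType ℂ S] [Finite κ] (u : κ → S)
    (h : ∀ v : κ → ℂ, {y : S →ₐ[ℂ] ℂ | ∀ k, y (u k) = v k}.Countable) (s : S) :
    IsAlgebraic (Algebra.adjoin ℂ (Set.range u)) s := by
  by_contra hs
  set A := Algebra.adjoin ℂ (Set.range u) with hA
  have hAft : Algebra.FiniteType ℂ A := by
    have : (Set.range u).Finite := Set.finite_range u
    rw [← Subalgebra.fg_iff_finiteType, Subalgebra.fg_def]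
    exact ⟨_, this, rfl⟩
  have : Algebra.FiniteType ℂ (Polynomial A) := Algebra.FiniteType.trans hAft inferInstance
  have hinj : Function.Injective (Polynomial.aeval s : Polynomial A →ₐ[A] S) :=
    transcendental_iff_injective.1 hs
  obtain ⟨b, hb, hlift⟩ := exists_ne_zero_forall_exists_algHom
    ((Polynomial.aeval s : Polynomial A →ₐ[A] S).restrictScalars ℂ) hinj
  obtain ⟨n, hn⟩ : ∃ n, b.coeff n ≠ 0 := by
    by_contra! hc
    exact hb (Polynomial.ext hc)
  obtain ⟨φ, hφ⟩ := exists_algHom_ne_zero hn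
  have hbφ : b.map (φ : A →+* ℂ) ≠ 0 := fun h0 => hφ (by
    have := congrArg (fun p => Polynomial.coeff p n) h0
    simpa using this)
  apply not_countable_complex
  have hroots : {c : ℂ | (b.map (φ : A →+* ℂ)).IsRoot c}.Finite :=
    Polynomial.finite_setOfPred_isRoot hbφ
  refine (((h fun k => φ ⟨u k, Algebra.subset_adjoin ⟨k, rfl⟩⟩).image fun y => y s).union
    hroots.countable).mono fun c _ => ?_
  by_cases hc : (b.map (φ : A →+* ℂ)).IsRoot c
  · exact Or.inr hc
  · left
    obtain ⟨ψ, hψ⟩ := hlift ((Polynomial.aeval c).comp (Polynomial.mapAlgHom φ)) fun h0 => hc (by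
      rw [AlgHom.comp_apply, Polynomial.coe_aeval_eq_eval] at h0
      exact h0)
    refine ⟨ψ, fun k => ?_, ?_⟩
    · have := DFunLike.congr_fun hψ (Polynomial.C ⟨u k, Algebra.subset_adjoin ⟨k, rfl⟩⟩)
      simpa using this
    · have := DFunLike.congr_fun hψ Polynomial.X
      simpa using this

/-! ### Étaleness of charts and Poisson primes when there are few leaves. -/

namespace PoissonChart

variable {R : Type*} [CommRing R] [Algebra ℂ R] {X : R →ₗ[ℂ] Derivation ℂ R R} {q : Ideal R}
  {ρ : ℕ} {S : Type*} [CommRing S] [Algebra ℂ S] (χ : PoissonChart X q ρ S)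

/-- The rank relation factors the bracket matrix through width `ρ`, padded by a zero column. This
allows further charts of the same `q` and `ρ` to be built from an abstract chart. -/
theorem minorIdeal_succ_le (χ : PoissonChart X q ρ S) : minorIdeal X (ρ + 1) ≤ q := by
  rw [minorIdeal, Ideal.span_le]
  rintro _ ⟨a, t, rfl⟩
  rw [SetLike.mem_coe, ← χ.eq_zero_iff]
  set A : Matrix (Fin (ρ + 1)) (Fin (ρ + 1)) S := Matrix.of fun i =>
    Fin.snoc (α := fun _ => S) (fun k => χ.ι (X (a i) (χ.t k))) 0 with hA
  set W : Matrix (Fin (ρ + 1)) (Fin (ρ + 1)) S := Matrix.of fun k j =>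
    Fin.snoc (α := fun _ => S) (fun k => ∑ i, χ.c k i * χ.ι (X (χ.a i) (t j))) 0 k with hW
  have e : (bracketMatrix X a t).map χ.ι = A * W := by
    ext i j
    rw [Matrix.mul_apply, Fin.sum_univ_castSucc]
    simp only [hA, hW, Matrix.of_apply, Fin.snoc_castSucc, Fin.snoc_last, mul_zero, add_zero]
    exact χ.rank (a i) (t j)
  have e' : ((bracketMatrix X a t).map χ.ι).det = χ.ι (bracketMatrix X a t).det :=
    (AlgHom.map_det χ.ι _).symm
  rw [← e', e, Matrix.det_mul, Matrix.det_eq_zero_of_column_eq_zero (Fin.last ρ), zero_mul]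
  intro i
  simp [hA]

theorem isUnit_det : IsUnit (χ.ι (bracketMatrix X χ.a χ.t).det) := by
  have e : (Matrix.of χ.c) * (bracketMatrix X χ.a χ.t).map χ.ι = 1 := by
    ext k j
    rw [Matrix.mul_apply, Matrix.one_apply]
    exact χ.sum_c k j
  have e' : ((bracketMatrix X χ.a χ.t).map χ.ι).det = χ.ι (bracketMatrix X χ.a χ.t).det :=
    (AlgHom.map_det χ.ι _).symm
  have h := congrArg Matrix.det e
  rw [Matrix.det_mul, Matrix.det_one, e'] at h
  exact IsUnit.of_mul_eq_one_right _ h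

theorem countable_fiber [Algebra.FiniteType ℂ R] [q.IsPrime] (hX : ∀ a b, X (X a b) = ⁅X a, X b⁆)
    (hfin : Countable (Quotient (Relation.EqvGen.setoid (HamStep X)))) (v : Fin ρ → ℂ) :
    {y : S →ₐ[ℂ] ℂ | ∀ k, y (χ.ι (χ.t k)) = v k}.Countable := by
  classical
  have := Algebra.FiniteType.isNoetherianRing ℂ R
  -- Finitely many minors generate the ideal of minors, so their charts cover the zero set of `q`
  -- off the zero set of that ideal.
  obtain ⟨F₀, hF₀, hspan⟩ := (Submodule.fg_span_iff_fg_span_finset_subset (R := R)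
    {d | ∃ a t : Fin ρ → R, d = (bracketMatrix X a t).det}).1 (IsNoetherian.noetherian _)
  have hF₀' : ∀ d ∈ F₀, ∃ p : (Fin ρ → R) × (Fin ρ → R), d = (bracketMatrix X p.1 p.2).det := by
    intro d hd
    obtain ⟨a, t, h⟩ := hF₀ hd
    exact ⟨(a, t), h⟩
  choose! P hP using hF₀'
  -- The pair of `χ` is added so that the fibre in question appears in one chart of the family. The
  -- element `χ.Δ` itself may differ from the determinant, but the determinant is a unit on `χ`.
  set F : Finset ((Fin ρ → R) × (Fin ρ → R)) := insert (χ.a, χ.t) (F₀.image P)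
    with hF
  set I := {p : (Fin ρ → R) × (Fin ρ → R) // p ∈ F ∧ (bracketMatrix X p.1 p.2).det ∉ q} with hI
  have hIc : Finite I := Finite.of_injective (fun p : I => (⟨p.1, p.2.1⟩ : {p // p ∈ F}))
    fun p p' h => Subtype.ext (congrArg (fun x => x.1) h)
  choose ch hch using fun p : I =>
    exists_chart χ.isPoisson p.1.1 p.1.2 p.2.2 χ.minorIdeal_succ_le
  have hcov : ∀ x : R →ₐ[ℂ] ℂ, (∀ f ∈ q, x f = 0) → (¬ ∀ f ∈ minorIdeal X ρ, x f = 0) →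
      ∃ i, x (ch i).Δ ≠ 0 := by
    intro x hx hx'
    by_contra! hc
    apply hx'
    have h1 : minorIdeal X ρ ≤ RingHom.ker x := by
      rw [minorIdeal, Ideal.span, hspan, Submodule.span_le]
      intro d hd
      rw [SetLike.mem_coe, RingHom.mem_ker]
      by_contra hd'
      have hdq : (bracketMatrix X (P d).1 (P d).2).det ∉ q := fun h => hd' (by
        rw [hP d hd]
        exact hx _ h)
      have h2 := hc ⟨P d, Finset.mem_insert_of_mem (Finset.mem_image_of_mem _ hd), hdq⟩
      rw [(hch _).2.2] at h2
      apply hd'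
      rw [hP d hd]
      exact h2
    exact fun f hf => RingHom.mem_ker.1 (h1 hf)
  have hdet : (bracketMatrix X χ.a χ.t).det ∉ q := fun h => by
    have := χ.isDomain
    have h1 := χ.isUnit_det
    rw [(χ.eq_zero_iff _).2 h] at h1
    exact not_isUnit_zero h1
  set i₀ : I := ⟨(χ.a, χ.t), Finset.mem_insert_self _ _, hdet⟩ with hi₀
  have hx : ∀ y : S →ₐ[ℂ] ℂ, (∀ f ∈ q, y.comp χ.ι f = 0) ∧
      y.comp χ.ι (bracketMatrix X χ.a χ.t).det ≠ 0 := fun y =>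
    ⟨fun f hf => by rw [AlgHom.comp_apply, (χ.eq_zero_iff f).2 hf, map_zero],
      (χ.isUnit_det.map y).ne_zero⟩
  have hinj : Function.Injective fun y : S →ₐ[ℂ] ℂ => y.comp χ.ι := fun y y' h =>
    χ.algHom_ext fun f => DFunLike.congr_fun h f
  have hleaf : ∀ l : Quotient (Relation.EqvGen.setoid (HamStep X)),
      {y : S →ₐ[ℂ] ℂ | (∀ k, y (χ.ι (χ.t k)) = v k) ∧
        Quotient.mk (Relation.EqvGen.setoid (HamStep X)) (y.comp χ.ι) = l}.Countable := by
    intro l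
    rcases Set.eq_empty_or_nonempty {y : S →ₐ[ℂ] ℂ | (∀ k, y (χ.ι (χ.t k)) = v k) ∧
        Quotient.mk (Relation.EqvGen.setoid (HamStep X)) (y.comp χ.ι) = l} with h | ⟨y₀, -, hy₀⟩
    · rw [h]
      exact Set.countable_empty
    · have hc := countable_leaf_fiber hX ch (isPoissonIdeal_minorIdeal hX ρ) hcov
        (x₀ := y₀.comp χ.ι) (hx y₀).1 (fun h => (hx y₀).2 (h _ (det_mem_minorIdeal _ _))) i₀ v
      refine (hc.preimage hinj).mono ?_
      rintro y ⟨hy, hyl⟩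
      refine ⟨Quotient.exact (hy₀.trans hyl.symm), ?_, fun k => ?_⟩
      · rw [(hch i₀).2.2]
        exact (hx y).2
      · rw [(hch i₀).2.1]
        exact hy k
  refine (Set.countable_iUnion hleaf).mono fun y hy => ?_
  rw [Set.mem_iUnion]
  exact ⟨_, hy, rfl⟩

theorem isEtale_of_countable [Algebra.FiniteType ℂ R] [q.IsPrime]
    (hX : ∀ a b, X (X a b) = ⁅X a, X b⁆)
    (hfin : Countable (Quotient (Relation.EqvGen.setoid (HamStep X)))) : χ.IsEtale := by
  have := χ.isDomain
  have := χ.finiteType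
  exact isAlgebraic_adjoin_of_countable_fiber _ (χ.countable_fiber hX hfin)

/-- The core generates in `S` an ideal that is stable under the `Y_k` and vanishes at `y`. In an
étale chart it must be zero, so the core lies in `q`. -/
theorem IsEtale.poissonCore_ker_eq {χ : PoissonChart X q ρ S} (hχ : χ.IsEtale) [q.IsPrime]
    (y : S →ₐ[ℂ] ℂ) : poissonCore X (RingHom.ker (y.comp χ.ι)) = q := by
  apply le_antisymm
  · set c := poissonCore X (RingHom.ker (y.comp χ.ι)) with hc
    have hstable : ∀ k, ∀ s ∈ c.map χ.ι, χ.Y k s ∈ c.map χ.ι := by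
      intro k s hs
      rw [Ideal.map] at hs
      induction hs using Submodule.span_induction with
      | mem x hx =>
        obtain ⟨f, hf, rfl⟩ := hx
        rw [Y_apply]
        refine Ideal.sum_mem _ fun i _ => Ideal.mul_mem_left _ _ ?_
        change χ.ham (χ.a i) (χ.ι f) ∈ _
        rw [ham_ι]
        exact Ideal.mem_map_of_mem _ (isPoissonIdeal_poissonCore (X := X) _ _ f hf)
      | zero => rw [map_zero]; exact zero_mem _
      | add x z _ _ hx hz => rw [map_add]; exact add_mem hx hz
      | smul r x hx hx' =>
        rw [smul_eq_mul, Derivation.leibniz]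
        refine add_mem (Ideal.mul_mem_left _ _ hx') ?_
        rw [smul_eq_mul]
        exact Ideal.mul_mem_right _ _ hx
    have hle : c.map χ.ι ≤ RingHom.ker y := by
      rw [Ideal.map_le_iff_le_comap]
      intro f hf
      exact poissonCore_le X _ hf
    have hbot : c.map χ.ι = ⊥ := by
      by_contra h
      have h1 := hle (hχ.eq_top_of_stable h hstable ▸ Submodule.mem_top : (1 : S) ∈ c.map χ.ι)
      rw [RingHom.mem_ker, map_one] at h1
      exact one_ne_zero h1
    intro f hf
    rw [← χ.eq_zero_iff]
    have := Ideal.mem_map_of_mem χ.ι hf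
    rwa [hbot] at this
  · refine le_poissonCore χ.isPoisson fun f hf => ?_
    rw [RingHom.mem_ker, AlgHom.comp_apply, (χ.eq_zero_iff f).2 hf, map_zero]

end PoissonChart

/-- Every Poisson prime is the Poisson core of a point of one of its charts, and Poisson cores are
constant along leaves, so there are at most as many Poisson primes as leaves. -/
theorem finite_isPrime_isPoissonIdeal {R : Type*} [CommRing R] [Algebra ℂ R]
    [Algebra.FiniteType ℂ R] {X : R →ₗ[ℂ] Derivation ℂ R R} (hX : ∀ a b, X (X a b) = ⁅X a, X b⁆)
    (hfin : Finite (Quotient (Relation.EqvGen.setoid (HamStep X)))) :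
    {q : Ideal R | q.IsPrime ∧ IsPoissonIdeal X q}.Finite := by
  set core : Quotient (Relation.EqvGen.setoid (HamStep X)) → Ideal R :=
    Quotient.lift (fun x => poissonCore X (RingHom.ker x))
      fun _ _ h => eqvGen_hamStep_poissonCore_eq h with hcore
  refine (Set.finite_range core).subset ?_
  rintro q ⟨hq, hqX⟩
  obtain ⟨ρ, h1, h2⟩ := exists_rank (X := X) hq.ne_top
  obtain ⟨a, t, hat⟩ := exists_det_notMem h1
  obtain ⟨χ, -⟩ := exists_chart hqX a t hat h2
  have := χ.isDomain
  have := χ.finiteType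
  obtain ⟨y, -⟩ := exists_algHom_ne_zero
    (one_ne_zero (α := Localization.Away (Ideal.Quotient.mk q (bracketMatrix X a t).det)))
  exact ⟨Quotient.mk _ (y.comp χ.ι), (χ.isEtale_of_countable hX inferInstance).poissonCore_ker_eq y⟩

/-! ### Quasi-lisse vertex algebras and the theorem. -/

namespace VertexAlgebra

universe u

variable {V : Type u} [AddCommGroup V] [Module ℂ V] [VertexAlgebra V]

theorem isEtale_of_isQuasiLisse [Algebra.FiniteType ℂ (ZhuC2 V)] (hql : IsQuasiLisse V)
    (q : Ideal (ZhuC2 V)) [q.IsPrime] (ρ : ℕ) (S : Type u) [CommRing S] [Algebra ℂ S]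
    (χ : PoissonChart (zhuHam V) q ρ S) : χ.IsEtale :=
  have : Finite (Quotient (Relation.EqvGen.setoid (HamStep (zhuHam V)))) := hql
  χ.isEtale_of_countable (zhuHam_lie (V := V)) inferInstance

theorem finite_poissonPrime [Algebra.FiniteType ℂ (ZhuC2 V)] (hql : IsQuasiLisse V) :
    {q : Ideal (ZhuC2 V) | q.IsPrime ∧ IsPoissonIdeal (zhuHam V) q}.Finite :=
  finite_isPrime_isPoissonIdeal (zhuHam_lie (V := V)) hql

end VertexAlgebra

theorem mainTheorem2 {V : Type*} [AddCommGroup V] [Module ℂ V] [VertexAlgebra V]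
    (hsep : ⨅ p : ℕ, VertexAlgebra.liF V p = ⊥)
    (hfg : Algebra.FiniteType ℂ (VertexAlgebra.ZhuC2 V))
    (hql : VertexAlgebra.IsQuasiLisse V) :
    (∃ S : Set (VertexAlgebra.SingularSupport V), S.Finite ∧
      ⋃ x ∈ S, closure (VertexAlgebra.chiralSymplecticCore x) = Set.univ) ∧
    (∃ e : VertexAlgebra.SingularSupport V ≃ₜ ArcSpace (VertexAlgebra.ZhuC2 V),
      ∀ x, (e x).asIdeal = x.asIdeal.comap (VertexAlgebra.arcToGr V)) ∧
    (∃ e : VertexAlgebra.SingularSupport V ≃ₜ ArcSpace (VertexAlgebra.ZhuRed V),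
      ∀ x, (e x).asIdeal.comap (VertexAlgebra.arcToRed V) =
        x.asIdeal.comap (VertexAlgebra.arcToGr V)) := by
  exact ⟨VertexAlgebra.exists_finite_closure_cover
      (fun q _ ρ S _ _ χ => VertexAlgebra.isEtale_of_isQuasiLisse hql q ρ S χ)
      (VertexAlgebra.finite_poissonPrime hql),
    VertexAlgebra.exists_homeomorph_of_isEtale
      (fun q _ ρ S _ _ χ => VertexAlgebra.isEtale_of_isQuasiLisse hql q ρ S χ)⟩
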